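/- All manifolds are smooth, finite-dimensional, Hausdorff and without boundary. Let $\pi_B\colon B\to M$ be a smooth fibre bundle and suppose that it is regularly foliated: there is an involutive subbundle $T\mathcal F_B\subset TB$ which $d\pi_B$ maps fibrewise injectively onto a subbundle $T\mathcal F_M\subset TM$. Let $\mathcal F$ be the sheaf of smooth local vector fields on $M$ tangent to $T\mathcal F_M$. For $X\in\mathcal F(\mathcal O)$ let $\ell(X)$ be the vector field on $\pi_B^{-1}(\mathcal O)$ whose value at $b$ is the unique vector of $T_b\mathcal F_B$ with $d\pi_B(\ell(X)(b))=X(\pi_B(b))$. For $k\in\{0,1,\dots,\infty,\mathrm g\}$ let $\Gamma_k(\pi_B)$ be the set of pairs $(x,[\sigma]^k_x)$, where $\sigma$ is a smooth local section of $\pi_B$ defined near $x$ and $[\sigma]^k_x$ is its $k$-jet at $x$ (its germ at $x$ if $k=\mathrm g$). A class $(x,[\sigma]^k_x)$ is *$\mathcal F$-invariant* if, for every $X\in\mathcal F$ defined near $x$, the velocity at $t=0$ of the family $\sigma_t=\mathrm{Fl}^{\ell(X)}_t\circ\sigma\circ\mathrm{Fl}^{X}_{-t}$ vanishes to order $k$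 at $x$, meaning the following. * $k=0$: no condition. * $1\le k<\infty$: the derivative at $t=0$ of the curve $t\mapsto[\sigma_t]^{k-1}_x$ of $(k-1)$-jets is zero. (This depends only on $[\sigma]^k_x$.) * $k=\infty$: the derivative at $t=0$ of the curve of $j$-jets $t\mapsto[\sigma_t]^{j}_x$ is zero for every $j<\infty$. * $k=\mathrm g$: the germ at $x$ of the section $y\mapsto\frac{d}{dt}\big|_{t=0}\sigma_t(y)$ of $\sigma^*VB$ is zero, where $VB=\ker d\pi_B$. Let $\Gamma_k(\pi_B)^{\mathcal F}\subset\Gamma_k(\pi_B)$ be the set of $\mathcal F$-invariant classes. A local section $\sigma$ is *distinguished* if about every point of its image there are foliated coordinates $(x,y,f)$ of $B$ in which $\sigma$ has the form $f=s(y)$. Here $(x,y)$ are pulled back from foliated coordinates of $M$, in which $T\mathcal F_M=\{dy=0\}$, and $T\mathcal F_B=\{dy=0,\ df=0\}$. Let $\mathcal D_k(\pi_B)\subset\Gamma_k(\pi_B)$ be the set of classes $(x,[\sigma]^k_x)$ of distinguished sections $\sigma$. Then for every $k\in\{0,1,\dots,\infty,\mathrm g\}$, $$\Gamma_k(\pi_B)^{\mathcal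 F}=\mathcal D_k(\pi_B).$$ Moreover the diffeologies agree. Give the set of pairs $(x,\sigma)$ with $x\in\mathrm{dom}(\sigma)$ the functional diffeology: $u\mapsto(x_u,\sigma_u)$ is a plot if and only if $x_u$ is smooth in $u$ and, for all $u_0$ and all $z_0\in\mathrm{dom}(\sigma_{u_0})$, the map $(u,z)\mapsto\sigma_u(z)$ is defined and smooth near $(u_0,z_0)$. Give $\Gamma_k(\pi_B)$ the quotient diffeology. Then the diffeology of $\Gamma_k(\pi_B)^{\mathcal F}$ as a subspace of $\Gamma_k(\pi_B)$ is the diffeology of $\mathcal D_k(\pi_B)$ as a quotient of the space of pairs $(x,\sigma)$ with $\sigma$ distinguished. -/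

import Mathlib

open Set Filter Topology
open scoped Manifold ContDiff

noncomputable section

namespace FolBundle

/-! ### Diffeologies: pushforward along a surjection, and subspaces

A diffeology is presented, with Mathlib's `DiffeologicalSpace.CorePlotsOn`, through its plots on
arbitrary open subsets of Euclidean spaces. -/

section Diffeologies

open DiffeologicalSpace

/-- The pushforward diffeology along a surjection `f : Y → X`: a parametrisation is a plot if and
only if it locally lifts to a plot of `Y`. (Constant parametrisations lift since `f` is onto.) -/
def pushforward {X Y : Type*} (C : CorePlotsOn Y) (f : Y → X) (hf : Function.Surjective f) :
    CorePlotsOn X where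
  isPlotOn {n} u _ p := ∀ a ∈ u, ∃ (v : Set (EuclideanSpace ℝ (Fin n))) (hv : IsOpen v),
    a ∈ v ∧ v ⊆ u ∧ ∃ ψ : EuclideanSpace ℝ (Fin n) → Y,
      C.isPlotOn hv ψ ∧ ∀ w ∈ v, f (ψ w) = p w
  isPlotOn_congr {n u} _ p q h := by
    constructor
    · intro H a ha
      obtain ⟨v, hv, hav, hvu, ψ, hψ, e⟩ := H a ha
      exact ⟨v, hv, hav, hvu, ψ, hψ, fun w hw => (e w hw).trans (h (hvu hw))⟩
    · intro H a ha
      obtain ⟨v, hv, hav, hvu, ψ, hψ, e⟩ := H a ha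
      exact ⟨v, hv, hav, hvu, ψ, hψ, fun w hw => (e w hw).trans (h (hvu hw)).symm⟩
  isPlot_const {n} x := by
    obtain ⟨y, rfl⟩ := hf x
    intro a _
    exact ⟨univ, isOpen_univ, mem_univ _, Subset.rfl, fun _ => y,
      C.isPlotOn_univ.2 (C.isPlot_const y), fun _ _ => rfl⟩
  isPlotOn_reparam {n m u v hu} hv p g h hp hg := by
    intro a ha
    obtain ⟨w, hw, haw, hwu, ψ, hψ, e⟩ := hp (g a) (h ha)
    have ho : IsOpen (v ∩ g ⁻¹' w) := hg.continuousOn.isOpen_inter_preimage hv hw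
    exact ⟨v ∩ g ⁻¹' w, ho, ⟨ha, haw⟩, inter_subset_left, ψ ∘ g,
      C.isPlotOn_reparam ho (fun z hz => hz.2) hψ (hg.mono inter_subset_left),
      fun z hz => e _ hz.2⟩
  locality {n u} _ p h := by
    intro a ha
    obtain ⟨v, hv, hav, H⟩ := h a ha
    obtain ⟨w, hw, haw, hwv, ψ, hψ, e⟩ := H a hav
    refine ⟨w ∩ u, hw.inter ‹_›, ⟨haw, ha⟩, inter_subset_right, ψ, ?_, fun z hz => e z hz.1⟩
    exact C.isPlotOn_reparam (f := id) (hw.inter ‹_›) (fun z hz => hz.1) hψ contDiffOn_id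

/-- The subspace diffeology on a subtype: a parametrisation is a plot if and only if it is a plot
of the ambient space. -/
def subspace {X : Type*} (C : CorePlotsOn X) (P : X → Prop) : CorePlotsOn {x // P x} where
  isPlotOn hu p := C.isPlotOn hu (fun a => (p a).1)
  isPlotOn_congr hu _ _ h := C.isPlotOn_congr hu fun a ha => congrArg Subtype.val (h ha)
  isPlot_const x := C.isPlotOn_univ.2 (C.isPlot_const x.1)
  isPlotOn_reparam hv _ _ h hp hf := C.isPlotOn_reparam hv h hp hf
  locality hu _ h := C.locality hu h

end Diffeologies

/-- The orders of contact `0, 1, 2, …, ∞` (jets) and `g` (germs). -/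
inductive JetOrder where
  | jet (k : ℕ∞)
  | germ

section Bundles

variable {EM EB EF M B : Type*}
  [NormedAddCommGroup EM] [NormedSpace ℝ EM] [TopologicalSpace M] [ChartedSpace EM M]
  [NormedAddCommGroup EB] [NormedSpace ℝ EB] [TopologicalSpace B] [ChartedSpace EB B]
  [NormedAddCommGroup EF] [NormedSpace ℝ EF]

/-- `π : B → M` is a smooth fibre bundle with typical fibre `F`: it has smooth local
trivialisations with smooth inverses around every point of `M`. -/
def IsSmoothFibreBundle (EM EB EF : Type*) {M B : Type*}
    [NormedAddCommGroup EM] [NormedSpace ℝ EM] [TopologicalSpace M] [ChartedSpace EM M]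
    [NormedAddCommGroup EB] [NormedSpace ℝ EB] [TopologicalSpace B] [ChartedSpace EB B]
    [NormedAddCommGroup EF] [NormedSpace ℝ EF]
    (F : Type*) [TopologicalSpace F] [ChartedSpace EF F] (π : B → M) : Prop :=
  ∀ x : M, ∃ e : Bundle.Trivialization F π, x ∈ e.baseSet ∧
    ContMDiffOn 𝓘(ℝ, EB) (𝓘(ℝ, EM).prod 𝓘(ℝ, EF)) ∞ e e.source ∧
    ContMDiffOn (𝓘(ℝ, EM).prod 𝓘(ℝ, EF)) 𝓘(ℝ, EB) ∞ e.toOpenPartialHomeomorph.symm e.target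

/-- `X` is a smooth vector field on the set `U`. -/
def IsSmoothFieldOn [IsManifold 𝓘(ℝ, EM) ∞ M] (X : ∀ x : M, TangentSpace 𝓘(ℝ, EM) x) (U : Set M) : Prop :=
  ContMDiffOn 𝓘(ℝ, EM) 𝓘(ℝ, EM).tangent ∞
    (fun x => (⟨x, X x⟩ : TangentBundle 𝓘(ℝ, EM) M)) U

/-- A family of subspaces of the tangent spaces is a smooth subbundle of the tangent bundle if it
is locally spanned by pointwise linearly independent smooth vector fields. -/
def IsSubbundle [IsManifold 𝓘(ℝ, EM) ∞ M]
    (D : ∀ x : M, Submodule ℝ (TangentSpace 𝓘(ℝ, EM) x)) : Prop :=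
  ∀ x₀ : M, ∃ U : Set M, IsOpen U ∧ x₀ ∈ U ∧
    ∃ (p : ℕ) (X : Fin p → ∀ x : M, TangentSpace 𝓘(ℝ, EM) x),
      (∀ i, IsSmoothFieldOn (X i) U) ∧
      ∀ x ∈ U, LinearIndependent ℝ (fun i => X i x) ∧
        Submodule.span ℝ (range fun i => X i x) = D x

/-- A family of tangent subspaces is involutive if the smooth local vector fields tangent to it
are closed under the Lie bracket. -/
def IsInvolutive [IsManifold 𝓘(ℝ, EM) ∞ M]
    (D : ∀ x : M, Submodule ℝ (TangentSpace 𝓘(ℝ, EM) x)) : Prop :=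
  ∀ (U : Set M), IsOpen U → ∀ X Y : ∀ x : M, TangentSpace 𝓘(ℝ, EM) x,
    IsSmoothFieldOn X U → IsSmoothFieldOn Y U →
    (∀ x ∈ U, X x ∈ D x) → (∀ x ∈ U, Y x ∈ D x) →
    ∀ x ∈ U, VectorField.mlieBracket 𝓘(ℝ, EM) X Y x ∈ D x

/-- A regular foliation of the bundle `π : B → M`, in the sense of Kamber and Tondeur: an
involutive subbundle `TFB` of `TB` that is projected fibrewise injectively onto a subbundle `TFM`
of `TM`. -/
structure RegularFoliation (EM EB : Type*) {M B : Type*}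
    [NormedAddCommGroup EM] [NormedSpace ℝ EM] [TopologicalSpace M] [ChartedSpace EM M]
    [NormedAddCommGroup EB] [NormedSpace ℝ EB] [TopologicalSpace B] [ChartedSpace EB B]
    [IsManifold 𝓘(ℝ, EM) ∞ M] [IsManifold 𝓘(ℝ, EB) ∞ B]
    (π : B → M) where
  /-- the foliation of the total space -/
  TFB : ∀ b : B, Submodule ℝ (TangentSpace 𝓘(ℝ, EB) b)
  /-- the foliation of the base -/
  TFM : ∀ x : M, Submodule ℝ (TangentSpace 𝓘(ℝ, EM) x)
  isSubbundle_TFB : IsSubbundle TFB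
  isInvolutive_TFB : IsInvolutive TFB
  isSubbundle_TFM : IsSubbundle TFM
  map_TFB : ∀ b, (TFB b).map (mfderiv 𝓘(ℝ, EB) 𝓘(ℝ, EM) π b).toLinearMap = TFM (π b)
  injOn_TFB : ∀ b, InjOn (mfderiv 𝓘(ℝ, EB) 𝓘(ℝ, EM) π b) (TFB b)

variable {π : B → M} [IsManifold 𝓘(ℝ, EM) ∞ M] [IsManifold 𝓘(ℝ, EB) ∞ B]

namespace RegularFoliation

/-- `X` is a section over the open set `O` of the sheaf `ℱ` of smooth vector fields tangent to the
foliation of the base. -/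
def IsFoliationField (S : RegularFoliation EM EB π) (O : Set M)
    (X : ∀ x : M, TangentSpace 𝓘(ℝ, EM) x) : Prop :=
  IsOpen O ∧ IsSmoothFieldOn X O ∧ ∀ x ∈ O, X x ∈ S.TFM x

open Classical in
/-- The partial connection of a regularly foliated bundle: the value of `ℓ(X)` at `b` is the vector
of `TFB b` which is mapped by `dπ` to `X (π b)`; for `X (π b)` in `TFM (π b)` there is exactly one
such vector. -/
def lift (S : RegularFoliation EM EB π) (X : ∀ x : M, TangentSpace 𝓘(ℝ, EM) x) (b : B) :
    TangentSpace 𝓘(ℝ, EB) b :=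
  if h : ∃ w ∈ S.TFB b, mfderiv 𝓘(ℝ, EB) 𝓘(ℝ, EM) π b w = X (π b) then h.choose else 0

theorem lift_spec (S : RegularFoliation EM EB π) {X : ∀ x : M, TangentSpace 𝓘(ℝ, EM) x} {b : B}
    (h : X (π b) ∈ S.TFM (π b)) :
    S.lift X b ∈ S.TFB b ∧ mfderiv 𝓘(ℝ, EB) 𝓘(ℝ, EM) π b (S.lift X b) = X (π b) := by
  have h' : ∃ w ∈ S.TFB b, mfderiv 𝓘(ℝ, EB) 𝓘(ℝ, EM) π b w = X (π b) := by
    rw [← S.map_TFB b] at h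
    exact h
  rw [lift, dif_pos h']
  exact h'.choose_spec

/-- Foliated coordinates `(x, y, f)` on an open subset of the total space, over foliated
coordinates `(x, y)` on an open subset of the base: `x` are leafwise, `y` transverse and `f` fibre
coordinates. That is, `(x, y)` is pulled back from the base, the foliation of the base is
`dy = 0`, and the foliation of the total space is `dy = 0, df = 0`. -/
structure FoliatedCoords (S : RegularFoliation EM EB π) (p q r : ℕ) where
  /-- the coordinates `(x, y)` -/
  base : OpenPartialHomeomorph M (EuclideanSpace ℝ (Fin p) × EuclideanSpace ℝ (Fin q))
  /-- the coordinates `(x, y, f)` -/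
  total : OpenPartialHomeomorph B
    (EuclideanSpace ℝ (Fin p) × EuclideanSpace ℝ (Fin q) × EuclideanSpace ℝ (Fin r))
  base_smooth : ContMDiffOn 𝓘(ℝ, EM)
    𝓘(ℝ, EuclideanSpace ℝ (Fin p) × EuclideanSpace ℝ (Fin q)) ∞ base base.source
  base_symm_smooth : ContMDiffOn 𝓘(ℝ, EuclideanSpace ℝ (Fin p) × EuclideanSpace ℝ (Fin q))
    𝓘(ℝ, EM) ∞ base.symm base.target
  total_smooth : ContMDiffOn 𝓘(ℝ, EB)
    𝓘(ℝ, EuclideanSpace ℝ (Fin p) × EuclideanSpace ℝ (Fin q) × EuclideanSpace ℝ (Fin r)) ∞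
    total total.source
  total_symm_smooth : ContMDiffOn
    𝓘(ℝ, EuclideanSpace ℝ (Fin p) × EuclideanSpace ℝ (Fin q) × EuclideanSpace ℝ (Fin r))
    𝓘(ℝ, EB) ∞ total.symm total.target
  proj_mem : ∀ b ∈ total.source, π b ∈ base.source
  base_proj : ∀ b ∈ total.source, base (π b) = ((total b).1, (total b).2.1)
  TFM_eq : ∀ x ∈ base.source, S.TFM x =
    (mfderiv 𝓘(ℝ, EM) 𝓘(ℝ, EuclideanSpace ℝ (Fin q)) (fun z => (base z).2) x).toLinearMap.ker
  TFB_eq : ∀ b ∈ total.source, S.TFB b =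
    (mfderiv 𝓘(ℝ, EB) 𝓘(ℝ, EuclideanSpace ℝ (Fin q) × EuclideanSpace ℝ (Fin r))
      (fun z => (total z).2) b).toLinearMap.ker

end RegularFoliation

/-- A smooth local section of `π`. It is recorded as a function on all of `M` of which only the
values on the open set `dom` matter. -/
structure LocalSection (EM EB : Type*) {M B : Type*}
    [NormedAddCommGroup EM] [NormedSpace ℝ EM] [TopologicalSpace M] [ChartedSpace EM M]
    [NormedAddCommGroup EB] [NormedSpace ℝ EB] [TopologicalSpace B] [ChartedSpace EB B]
    (π : B → M) where
  /-- the domain -/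
  dom : Set M
  /-- the section -/
  toFun : M → B
  isOpen_dom : IsOpen dom
  smooth : ContMDiffOn 𝓘(ℝ, EM) 𝓘(ℝ, EB) ∞ toFun dom
  proj : ∀ x ∈ dom, π (toFun x) = x

/-- The section `σ` is distinguished: about every point of its image there are foliated coordinates
`(x, y, f)` in which `σ` is given by `f = s(y)`, independently of the leafwise coordinates `x`. -/
def LocalSection.IsDistinguished (S : RegularFoliation EM EB π) (σ : LocalSection EM EB π) :
    Prop :=
  ∀ x ∈ σ.dom, ∃ (p q r : ℕ) (C : S.FoliatedCoords p q r),
    x ∈ C.base.source ∧ C.base.source ⊆ σ.dom ∧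
    ∃ s : EuclideanSpace ℝ (Fin q) → EuclideanSpace ℝ (Fin r), ∀ z ∈ C.base.source,
      σ.toFun z ∈ C.total.source ∧ (C.total (σ.toFun z)).2.2 = s (C.base z).2

/-- The space `Γ_loc(π)` of pairs `(x, σ)` of a local section `σ` and a point `x` of its domain. -/
structure PointedSection (EM EB : Type*) {M B : Type*}
    [NormedAddCommGroup EM] [NormedSpace ℝ EM] [TopologicalSpace M] [ChartedSpace EM M]
    [NormedAddCommGroup EB] [NormedSpace ℝ EB] [TopologicalSpace B] [ChartedSpace EB B]
    (π : B → M) where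
  /-- the base point -/
  pt : M
  /-- the section -/
  sec : LocalSection EM EB π
  mem : pt ∈ sec.dom

/-- `(x, σ)` and `(y, τ)` have the same `k`-jet, respectively germ: `x = y`, and `σ` and `τ` have
the same value and the same partial derivatives up to order `k` at `x` in local coordinates,
respectively agree near `x`. (Equality of the derivatives does not depend on the coordinates.) -/
def SameJet : JetOrder → PointedSection EM EB π → PointedSection EM EB π → Prop
  | .jet k, P, Q => P.pt = Q.pt ∧ P.sec.toFun P.pt = Q.sec.toFun P.pt ∧
      ∀ i : ℕ, (i : ℕ∞) ≤ k →
        iteratedFDeriv ℝ i (writtenInExtChartAt 𝓘(ℝ, EM) 𝓘(ℝ, EB) P.pt P.sec.toFun)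
            (extChartAt 𝓘(ℝ, EM) P.pt P.pt) =
          iteratedFDeriv ℝ i (writtenInExtChartAt 𝓘(ℝ, EM) 𝓘(ℝ, EB) P.pt Q.sec.toFun)
            (extChartAt 𝓘(ℝ, EM) P.pt P.pt)
  | .germ, P, Q => P.pt = Q.pt ∧ P.sec.toFun =ᶠ[𝓝 P.pt] Q.sec.toFun

variable (EM EB π) in
/-- The equivalence relation whose classes are the `k`-jets, respectively the germs. -/
def jetSetoid (k : JetOrder) : Setoid (PointedSection EM EB π) where
  r := SameJet k
  iseqv := by
    cases k with
    | jet k =>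
      refine ⟨fun P => ⟨rfl, rfl, fun _ _ => rfl⟩, ?_, ?_⟩
      · rintro P Q ⟨h, h', H⟩
        refine ⟨h.symm, ?_, fun i hi => ?_⟩
        · rw [← h, h']
        · rw [← h]; exact (H i hi).symm
      · rintro P Q R ⟨h, h', H⟩ ⟨g, g', G⟩
        rw [← h] at g' G
        exact ⟨h.trans g, h'.trans g', fun i hi => (H i hi).trans (G i hi)⟩
    | germ =>
      refine ⟨fun P => ⟨rfl, EventuallyEq.rfl⟩, ?_, ?_⟩
      · rintro P Q ⟨h, H⟩
        exact ⟨h.symm, h ▸ H.symm⟩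
      · rintro P Q R ⟨h, H⟩ ⟨g, G⟩
        exact ⟨h.trans g, H.trans (h ▸ G)⟩

variable (EM EB π) in
/-- The space `Γ_k(π)` of all `k`-jets (`k = 0, …, ∞`), respectively germs, of local sections. -/
abbrev JetSpace (k : JetOrder) : Type _ := Quotient (jetSetoid EM EB π k)

/-- The class `(x, [σ]^k_x)` of `(x, σ)`. -/
def toJet (k : JetOrder) (P : PointedSection EM EB π) : JetSpace EM EB π k :=
  Quotient.mk (jetSetoid EM EB π k) P

/-- `Φ` is a local flow near the point `a` of the vector field `X` on the open set `O`. -/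
def IsLocalFlow (X : ∀ x : M, TangentSpace 𝓘(ℝ, EM) x) (O : Set M) (Φ : ℝ → M → M) (a : M) :
    Prop :=
  ∃ ε > 0, ∃ W : Set M, IsOpen W ∧ a ∈ W ∧
    ContMDiffOn (𝓘(ℝ, ℝ).prod 𝓘(ℝ, EM)) 𝓘(ℝ, EM) ∞ (fun z : ℝ × M => Φ z.1 z.2)
      (Ioo (-ε) ε ×ˢ W) ∧
    ∀ x ∈ W, Φ 0 x = x ∧ ∀ t ∈ Ioo (-ε) ε, Φ t x ∈ O ∧
      HasMFDerivAt 𝓘(ℝ, ℝ) 𝓘(ℝ, EM) (fun s => Φ s x) t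
        ((1 : ℝ →L[ℝ] ℝ).smulRight (X (Φ t x)))

/-- The vertical tangent vector at time `0` of a curve `σ_t` of local sections through `σ = σ_0`
vanishes at the level of the vertical `k`-prolongation at `x`.
For a finite `k ≥ 1` the vertical prolongation takes values in the vertical vectors of the bundle
of `(k-1)`-jets (it is the image of the prolongation under the contact form, and only this is
determined by the `k`-jet of `σ`), so that all coordinate derivatives of `σ_t` at `x` of order
`i` with `i + 1 ≤ k` are stationary; for `k = 0` the vertical prolongation is zero; for `k = ∞`
all derivatives are stationary. For germs, the velocity of `σ_t` is the germ at `x` of the section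
`y ↦ d/dt σ_t(y)` of the pulled-back vertical tangent bundle. -/
def VelocityVanishes (σt : ℝ → M → B) (x : M) : JetOrder → Prop
  | .jet k => ∀ i : ℕ, ((i + 1 : ℕ) : ℕ∞) ≤ k →
      HasDerivAt (fun t : ℝ => iteratedFDeriv ℝ i
        (extChartAt 𝓘(ℝ, EB) (σt 0 x) ∘ σt t ∘ (extChartAt 𝓘(ℝ, EM) x).symm)
        (extChartAt 𝓘(ℝ, EM) x x)) 0 0
  | .germ => ∀ᶠ y in 𝓝 x, HasMFDerivAt 𝓘(ℝ, ℝ) 𝓘(ℝ, EB) (fun t : ℝ => σt t y) 0 0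

/-- `(x, σ)` is `ℱ`-invariant to order `k`: for every section `X` of `ℱ` near `x`, the vertical
`k`-prolongation of `ℓ(X)`, which is the velocity at `t = 0` of
`t ↦ Fl^{ℓ(X)}_t ∘ σ ∘ Fl^X_{-t}`, vanishes at `(x, [σ]^k_x)`. -/
def PointedSection.IsInvariant (S : RegularFoliation EM EB π) (k : JetOrder)
    (P : PointedSection EM EB π) : Prop :=
  ∀ (O : Set M) (X : ∀ x : M, TangentSpace 𝓘(ℝ, EM) x), S.IsFoliationField O X → P.pt ∈ O →
    ∀ (φ : ℝ → M → M) (Φ : ℝ → B → B), IsLocalFlow X O φ P.pt →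
      IsLocalFlow (S.lift X) (π ⁻¹' O) Φ (P.sec.toFun P.pt) →
      VelocityVanishes (EM := EM) (EB := EB)
        (fun t y => Φ t (P.sec.toFun (φ (-t) y))) P.pt k

/-- The space `Γ_k(π)^ℱ` of `ℱ`-invariant `k`-jets, respectively germs. -/
def invariantJets (S : RegularFoliation EM EB π) (k : JetOrder) : Set (JetSpace EM EB π k) :=
  {j | ∃ P : PointedSection EM EB π, toJet k P = j ∧ P.IsInvariant S k}

/-- The space `𝒟_k(π)` of `k`-jets, respectively germs, of distinguished sections. -/
def distinguishedJets (S : RegularFoliation EM EB π) (k : JetOrder) :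
    Set (JetSpace EM EB π k) :=
  {j | ∃ P : PointedSection EM EB π, P.sec.IsDistinguished S ∧ toJet k P = j}

/-! ### The diffeologies -/

variable (EM EB π) in
/-- The diffeology of `Γ_loc(π)`, a subspace of the product of `M` with the space of all local
sections, which carries the functional diffeology: a parametrisation `a ↦ (x_a, σ_a)` is a plot if
`x_a` depends smoothly on `a` and, for all `a₀` and all `x₀` in the domain of `σ_{a₀}`,
the map `(a, x) ↦ σ_a(x)` is defined and smooth on a neighbourhood of `(a₀, x₀)`. -/
def sectionPlots : DiffeologicalSpace.CorePlotsOn (PointedSection EM EB π) where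
  isPlotOn {n} u _ ψ :=
    ContMDiffOn 𝓘(ℝ, EuclideanSpace ℝ (Fin n)) 𝓘(ℝ, EM) ∞ (fun a => (ψ a).pt) u ∧
    ∀ a₀ ∈ u, ∀ x₀ ∈ (ψ a₀).sec.dom, ∃ (V : Set (EuclideanSpace ℝ (Fin n))) (O : Set M),
      IsOpen V ∧ a₀ ∈ V ∧ V ⊆ u ∧ IsOpen O ∧ x₀ ∈ O ∧ (∀ a ∈ V, O ⊆ (ψ a).sec.dom) ∧
      ContMDiffOn (𝓘(ℝ, EuclideanSpace ℝ (Fin n)).prod 𝓘(ℝ, EM)) 𝓘(ℝ, EB) ∞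
        (fun z : EuclideanSpace ℝ (Fin n) × M => (ψ z.1).sec.toFun z.2) (V ×ˢ O)
  isPlotOn_congr {n u} _ p q h := by
    have key : ∀ p q : EuclideanSpace ℝ (Fin n) → PointedSection EM EB π, EqOn p q u →
        (ContMDiffOn 𝓘(ℝ, EuclideanSpace ℝ (Fin n)) 𝓘(ℝ, EM) ∞ (fun a => (p a).pt) u ∧
        ∀ a₀ ∈ u, ∀ x₀ ∈ (p a₀).sec.dom, ∃ (V : Set (EuclideanSpace ℝ (Fin n))) (O : Set M),
          IsOpen V ∧ a₀ ∈ V ∧ V ⊆ u ∧ IsOpen O ∧ x₀ ∈ O ∧ (∀ a ∈ V, O ⊆ (p a).sec.dom) ∧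
          ContMDiffOn (𝓘(ℝ, EuclideanSpace ℝ (Fin n)).prod 𝓘(ℝ, EM)) 𝓘(ℝ, EB) ∞
            (fun z : EuclideanSpace ℝ (Fin n) × M => (p z.1).sec.toFun z.2) (V ×ˢ O)) →
        (ContMDiffOn 𝓘(ℝ, EuclideanSpace ℝ (Fin n)) 𝓘(ℝ, EM) ∞ (fun a => (q a).pt) u ∧
        ∀ a₀ ∈ u, ∀ x₀ ∈ (q a₀).sec.dom, ∃ (V : Set (EuclideanSpace ℝ (Fin n))) (O : Set M),
          IsOpen V ∧ a₀ ∈ V ∧ V ⊆ u ∧ IsOpen O ∧ x₀ ∈ O ∧ (∀ a ∈ V, O ⊆ (q a).sec.dom) ∧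
          ContMDiffOn (𝓘(ℝ, EuclideanSpace ℝ (Fin n)).prod 𝓘(ℝ, EM)) 𝓘(ℝ, EB) ∞
            (fun z : EuclideanSpace ℝ (Fin n) × M => (q z.1).sec.toFun z.2) (V ×ˢ O)) := by
      rintro p q h ⟨h1, h2⟩
      refine ⟨h1.congr fun a ha => by rw [h ha], fun a₀ ha₀ x₀ hx₀ => ?_⟩
      rw [← h ha₀] at hx₀
      obtain ⟨V, O, hV, haV, hVu, hO, hxO, hd, hs⟩ := h2 a₀ ha₀ x₀ hx₀
      refine ⟨V, O, hV, haV, hVu, hO, hxO, fun a ha => ?_, hs.congr fun z hz => ?_⟩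
      · rw [← h (hVu ha)]; exact hd a ha
      · rw [← h (hVu hz.1)]
    exact ⟨key p q h, key q p h.symm⟩
  isPlot_const {n} P := by
    refine ⟨contMDiffOn_const, fun a₀ _ x₀ hx₀ => ⟨univ, P.sec.dom, isOpen_univ, mem_univ _,
      Subset.rfl, P.sec.isOpen_dom, hx₀, fun _ _ => Subset.rfl, ?_⟩⟩
    exact P.sec.smooth.comp contMDiffOn_snd fun z hz => hz.2
  isPlotOn_reparam {n m u v hu} hv p f h hp hf := by
    refine ⟨hp.1.comp hf.contMDiffOn h, fun a₀ ha₀ x₀ hx₀ => ?_⟩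
    obtain ⟨V, O, hV, haV, hVu, hO, hxO, hd, hs⟩ := hp.2 (f a₀) (h ha₀) x₀ hx₀
    refine ⟨v ∩ f ⁻¹' V, O, hf.continuousOn.isOpen_inter_preimage hv hV, ⟨ha₀, haV⟩,
      inter_subset_left, hO, hxO, fun a ha => hd _ ha.2, ?_⟩
    refine hs.comp (f := fun z : EuclideanSpace ℝ (Fin m) × M => (f z.1, z.2)) ?_
      fun z hz => ⟨hz.1.2, hz.2⟩
    exact ((hf.contMDiffOn.mono inter_subset_left).comp contMDiffOn_fst
      fun z hz => hz.1).prodMk contMDiffOn_snd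
  locality {n u} hu p h := by
    refine ⟨fun a ha => ?_, fun a₀ ha₀ x₀ hx₀ => ?_⟩
    · obtain ⟨v, hv, hav, H, -⟩ := h a ha
      exact (H.contMDiffAt (hv.mem_nhds hav)).contMDiffWithinAt
    · obtain ⟨v, hv, hav, -, H⟩ := h a₀ ha₀
      obtain ⟨V, O, hV, haV, hVu, hO, hxO, hd, hs⟩ := H a₀ hav x₀ hx₀
      exact ⟨V ∩ u, O, hV.inter hu, ⟨haV, ha₀⟩, inter_subset_right, hO, hxO,
        fun a ha => hd a ha.1, hs.mono (prod_mono inter_subset_left Subset.rfl)⟩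

variable (EM EB π) in
/-- The diffeology of `Γ_k(π)`, the quotient of that of `Γ_loc(π)`. -/
def jetPlots (k : JetOrder) : DiffeologicalSpace.CorePlotsOn (JetSpace EM EB π k) :=
  pushforward (sectionPlots EM EB π) (toJet k) Quotient.mk_surjective

/-- The diffeology of a subset of `Γ_k(π)` as a diffeological subspace of `Γ_k(π)`. -/
@[reducible]
def subspaceDiffeology {k : JetOrder} (A : Set (JetSpace EM EB π k)) : DiffeologicalSpace A :=
  .ofCorePlotsOn (subspace (jetPlots EM EB π k) (· ∈ A))

/-- The diffeology of `𝒟_k(π)` as the space of `k`-jets, respectively germs, of the sheaf of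
distinguished sections: the quotient of the functional diffeology on the pairs `(x, σ)` with `σ` a
distinguished section. -/
@[reducible]
def distinguishedDiffeology (S : RegularFoliation EM EB π) (k : JetOrder) :
    DiffeologicalSpace (distinguishedJets S k) :=
  .ofCorePlotsOn (pushforward
    (subspace (sectionPlots EM EB π) fun P => P.sec.IsDistinguished S)
    (fun P => (⟨toJet k P.1, P.1, P.2, rfl⟩ : distinguishedJets S k))
    (by rintro ⟨_, P, hP, rfl⟩; exact ⟨⟨P, hP⟩, rfl⟩))

end Bundles

end FolBundle

end

/-! The equality of spaces reduces to a computation in foliated coordinates `(x, y, f)`. There a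
section is the graph of a function `f(x, y)`, and the lift of a leafwise coordinate field is again a
coordinate field, so both flows are translations. Transport along the flow of `-v` turns `f` into
`f((x, y) + t(v, 0))`, with velocity the leafwise derivative of `f` along `v`. Invariance to order
`k` therefore forces the leafwise derivatives of `f` to vanish to order `k - 1` at the base point
`(x₀, y₀)` (`PointedSection.IsInvariant.leafFlat`). As derivatives commute, `f(x, y)` and the frozen
function `f(x₀, y)` then have the same `k`-jet, or germ (`LeafFlat.contact_freeze`), and the frozen
section is distinguished. For `k = 0` nothing is required, and freezing keeps the value. Conversely,
a distinguished section is constant along the leaves, so `dσ(X) = ℓ(X) ∘ σ` and the velocity of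
`σ_t` vanishes near the point (`PointedSection.isInvariant_of_isDistinguished`).

Freezing depends smoothly on parameters. A smooth family of pointed sections is locally replaced by
a family of distinguished ones, with no change to the invariant classes
(`exists_distinguished_plot`). A constant family gives one inclusion of the spaces; an arbitrary
family gives the comparison of the diffeologies.

Foliated coordinates come from a fibred Frobenius theorem
(`RegularFoliation.exists_foliatedCoords`). In a fibred chart `TFB` is the graph of a smooth `G : P
× Q × R → (P →L Q × R)`, and involutivity is the symmetry condition that makes `∂_u w = G(u, w)`
completely integrable. The equation is solved along rays as a fixed point problem for continuous
curves on the unit interval, where the implicit function theorem gives smooth dependence on the data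
(`exists_leafwise_integral`). Since `TFB` projects to `TFM`, the system is triangular, and its
`Q`-component straightens the base compatibly.

Jets are defined in the preferred charts of the manifolds. Transfer to foliated coordinates rests on
the composition formula for Taylor series, which shows that `JetEq` is stable under smooth maps on
either side. -/

noncomputable section

namespace FolBundle

/-! ### Jets of maps between normed spaces: composition, parameters, freezing of variables. -/

section JetsInNormedSpaces

variable {E V W U : Type*} [NormedAddCommGroup E] [NormedSpace ℝ E] [NormedAddCommGroup V]
  [NormedSpace ℝ V] [NormedAddCommGroup W] [NormedSpace ℝ W] [NormedAddCommGroup U]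
  [NormedSpace ℝ U]

/-- The iterated derivative of a composition is the Taylor composition of the iterated
derivatives. -/
theorem iteratedFDeriv_comp_eq_taylorComp {g : V → W} {f : E → V} {x : E}
    (hg : ContDiffAt ℝ ∞ g (f x)) (hf : ContDiffAt ℝ ∞ f x) (n : ℕ) :
    iteratedFDeriv ℝ n (g ∘ f) x =
      FormalMultilinearSeries.taylorComp (ftaylorSeries ℝ g (f x)) (ftaylorSeries ℝ f x) n := by
  obtain ⟨u, hu, hfu⟩ := hf.contDiffOn (m := n) (mod_cast le_top) (by simp)
  obtain ⟨v, hv, hgv⟩ := hg.contDiffOn (m := n) (mod_cast le_top) (by simp)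
  obtain ⟨v', hv'v, hv'o, hxv'⟩ := mem_nhds_iff.1 hv
  have hpre : u ∩ f ⁻¹' v' ∈ 𝓝 x :=
    inter_mem hu (hf.continuousAt.preimage_mem_nhds (hv'o.mem_nhds hxv'))
  -- On open sets the derivatives within the set are the full derivatives, so the composition
  -- formula for Taylor series on `s` and `v'` becomes one for derivatives at the point.
  obtain ⟨s, hsu, hso, hxs⟩ := mem_nhds_iff.1 hpre
  have hf' := (hfu.mono (hsu.trans inter_subset_left)).ftaylorSeriesWithin hso.uniqueDiffOn
  have hg' := (hgv.mono hv'v).ftaylorSeriesWithin hv'o.uniqueDiffOn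
  have H := hg'.comp hf' (fun z hz => (hsu hz).2)
  have := H.eq_iteratedFDerivWithin_of_uniqueDiffOn (m := n) le_rfl hso.uniqueDiffOn hxs
  rw [iteratedFDerivWithin_of_isOpen n hso hxs] at this
  rw [← this]
  have e1 : ftaylorSeriesWithin ℝ f s x = ftaylorSeries ℝ f x := by
    ext1 i; exact iteratedFDerivWithin_of_isOpen i hso hxs
  have e2 : ftaylorSeriesWithin ℝ g v' (f x) = ftaylorSeries ℝ g (f x) := by
    ext1 i; exact iteratedFDerivWithin_of_isOpen i hv'o hxv'
  rw [e1, e2]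

/-- `f` and `g` have the same derivatives up to order `k` at `x`. -/
def JetEq (k : ℕ∞) (f g : E → V) (x : E) : Prop :=
  ∀ i : ℕ, (i : ℕ∞) ≤ k → iteratedFDeriv ℝ i f x = iteratedFDeriv ℝ i g x

namespace JetEq

variable {k : ℕ∞} {f f₁ f₂ f₃ : E → V} {x : E}

theorem of_eventuallyEq (h : f₁ =ᶠ[𝓝 x] f₂) : JetEq k f₁ f₂ x :=
  fun i _ => (h.iteratedFDeriv ℝ i).eq_of_nhds

theorem trans (h : JetEq k f₁ f₂ x) (h' : JetEq k f₂ f₃ x) : JetEq k f₁ f₃ x :=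
  fun i hi => (h i hi).trans (h' i hi)

theorem congr {g₁ g₂ : E → V} (h : JetEq k f₁ f₂ x) (h₁ : g₁ =ᶠ[𝓝 x] f₁) (h₂ : g₂ =ᶠ[𝓝 x] f₂) :
    JetEq k g₁ g₂ x :=
  (of_eventuallyEq h₁).trans (h.trans (of_eventuallyEq h₂.symm))

theorem apply_eq (h : JetEq k f₁ f₂ x) : f₁ x = f₂ x := by
  have := congrArg (fun A => A 0) (h 0 (by simp))
  simpa using this

/-- The summand of the Taylor composition that belongs to an ordered partition `c` of `n` sees the
inner map only through derivatives of orders `c.partSize m ≤ n`. -/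
theorem comp_left {g : V → W} (h : JetEq k f₁ f₂ x) (hg : ContDiffAt ℝ ∞ g (f₁ x))
    (h₁ : ContDiffAt ℝ ∞ f₁ x) (h₂ : ContDiffAt ℝ ∞ f₂ x) : JetEq k (g ∘ f₁) (g ∘ f₂) x := by
  intro n hn
  rw [iteratedFDeriv_comp_eq_taylorComp hg h₁,
    iteratedFDeriv_comp_eq_taylorComp (h.apply_eq ▸ hg) h₂, ← h.apply_eq]
  refine Finset.sum_congr rfl fun c _ => ?_
  ext v
  simp only [FormalMultilinearSeries.compAlongOrderedFinpartition_apply]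
  congr 1
  ext m
  simp only [OrderedFinpartition.applyOrderedFinpartition_apply, ftaylorSeries]
  rw [h (c.partSize m) (le_trans (mod_cast c.partSize_le m) hn)]

/-- Here the outer map varies; it enters a summand only through its derivative of order `c.length ≤
n`. -/
theorem comp_right {g₁ g₂ : V → W} (h : JetEq k g₁ g₂ (f x)) (h₁ : ContDiffAt ℝ ∞ g₁ (f x))
    (h₂ : ContDiffAt ℝ ∞ g₂ (f x)) (hf : ContDiffAt ℝ ∞ f x) :
    JetEq k (g₁ ∘ f) (g₂ ∘ f) x := by
  intro n hn
  rw [iteratedFDeriv_comp_eq_taylorComp h₁ hf, iteratedFDeriv_comp_eq_taylorComp h₂ hf]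
  refine Finset.sum_congr rfl fun c _ => ?_
  ext v
  simp only [FormalMultilinearSeries.compAlongOrderedFinpartition_apply, ftaylorSeries]
  rw [h c.length (le_trans (mod_cast c.length_le) hn)]

theorem add {g₁ g₂ : E → V} (h : JetEq k f₁ f₂ x) (h' : JetEq k g₁ g₂ x)
    (hf₁ : ContDiffAt ℝ ∞ f₁ x) (hf₂ : ContDiffAt ℝ ∞ f₂ x)
    (hg₁ : ContDiffAt ℝ ∞ g₁ x) (hg₂ : ContDiffAt ℝ ∞ g₂ x) :
    JetEq k (f₁ + g₁) (f₂ + g₂) x := by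
  intro n hn
  have e : ∀ f : E → V, ContDiffAt ℝ ∞ f x → ContDiffAt ℝ n f x :=
    fun f hf => hf.of_le (mod_cast le_top)
  rw [iteratedFDeriv_add_apply (e _ hf₁) (e _ hg₁), iteratedFDeriv_add_apply (e _ hf₂) (e _ hg₂),
    h n hn, h' n hn]

/-- A pair is the sum of its images under the two linear inclusions, so `comp_left` and `add`
suffice. -/
theorem prodMk {g₁ g₂ : E → W} (h : JetEq k f₁ f₂ x) (h' : JetEq k g₁ g₂ x)
    (hf₁ : ContDiffAt ℝ ∞ f₁ x) (hf₂ : ContDiffAt ℝ ∞ f₂ x)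
    (hg₁ : ContDiffAt ℝ ∞ g₁ x) (hg₂ : ContDiffAt ℝ ∞ g₂ x) :
    JetEq k (fun z => (f₁ z, g₁ z)) (fun z => (f₂ z, g₂ z)) x := by
  have a := h.comp_left (ContinuousLinearMap.inl ℝ V W).contDiff.contDiffAt hf₁ hf₂
  have b := h'.comp_left (ContinuousLinearMap.inr ℝ V W).contDiff.contDiffAt hg₁ hg₂
  have c := a.add b ((ContinuousLinearMap.inl ℝ V W).contDiff.contDiffAt.comp x hf₁)
    ((ContinuousLinearMap.inl ℝ V W).contDiff.contDiffAt.comp x hf₂)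
    ((ContinuousLinearMap.inr ℝ V W).contDiff.contDiffAt.comp x hg₁)
    ((ContinuousLinearMap.inr ℝ V W).contDiff.contDiffAt.comp x hg₂)
  refine c.congr (.of_forall fun z => ?_) (.of_forall fun z => ?_) <;> simp

theorem refl : JetEq k f f x := fun _ _ => rfl

/-- Flatness is preserved by multiplication with an operator valued function. -/
theorem clm_apply_zero {A : E → V →L[ℝ] W} {h : E → V} (H : JetEq k h 0 x)
    (hA : ContDiffAt ℝ ∞ A x) (hh : ContDiffAt ℝ ∞ h x) :
    JetEq k (fun z => A z (h z)) 0 x := by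
  have h0 : ContDiffAt ℝ ∞ (0 : E → V) x := contDiffAt_const
  have := (refl (f := A) (x := x) (k := k)).prodMk H hA hA hh h0
  have := this.comp_left (g := fun q : (V →L[ℝ] W) × V => q.1 q.2)
    (by fun_prop) (hA.prodMk hh) (hA.prodMk h0)
  exact this.congr (.of_forall fun z => rfl) (.of_forall fun z => by simp)

end JetEq

/-- The innermost direction of differentiation is the last argument of the iterated derivative. This
allows derivatives of order `i + 1` to be tested one direction at a time. -/
theorem iteratedFDeriv_fderiv_apply {f : E → V} {x : E} (hf : ContDiffAt ℝ ∞ f x) (i : ℕ) (w : E)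
    (m : Fin i → E) :
    iteratedFDeriv ℝ i (fun z => fderiv ℝ f z w) x m =
      iteratedFDeriv ℝ (i + 1) f x (Fin.snoc m w) := by
  rw [iteratedFDeriv_succ_apply_right]
  simp only [Fin.init_snoc, Fin.snoc_last]
  have hd : ContDiffAt ℝ i (fderiv ℝ f) x := hf.fderiv_right (m := i) (mod_cast le_top)
  have := ContinuousLinearMap.iteratedFDeriv_comp_left
    (ContinuousLinearMap.apply ℝ V w) hd (i := i) le_rfl
  have e : (fun z => fderiv ℝ f z w) = (ContinuousLinearMap.apply ℝ V w) ∘ fderiv ℝ f := rfl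
  rw [e, this]
  simp

/-- One derivative costs one order of contact. This is the shift between the `k`-jet of a section
and the `(k-1)`-jet in which its velocity is read. -/
theorem JetEq.fderiv_apply {k : ℕ∞} {f₁ f₂ : E → V} {x : E} (h : JetEq (k + 1) f₁ f₂ x)
    (h₁ : ContDiffAt ℝ ∞ f₁ x) (h₂ : ContDiffAt ℝ ∞ f₂ x) (w : E) :
    JetEq k (fun z => fderiv ℝ f₁ z w) (fun z => fderiv ℝ f₂ z w) x := by
  intro i hi
  ext m
  rw [iteratedFDeriv_fderiv_apply h₁, iteratedFDeriv_fderiv_apply h₂, h (i + 1)]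
  push_cast; gcongr

theorem fderiv_slice_right {X : Type*} [NormedAddCommGroup X] [NormedSpace ℝ X] {K : ℝ × E → X}
    {t : ℝ} {z : E} (hK : DifferentiableAt ℝ K (t, z)) :
    fderiv ℝ (fun z' => K (t, z')) z = (fderiv ℝ K (t, z)).comp (.inr ℝ ℝ E) :=
  (hK.hasFDerivAt.comp z (hasFDerivAt_prodMk_right t z)).fderiv

theorem hasDerivAt_slice_left {X : Type*} [NormedAddCommGroup X] [NormedSpace ℝ X] {K : ℝ × E → X}
    {t : ℝ} {z : E} (hK : DifferentiableAt ℝ K (t, z)) :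
    HasDerivAt (fun s => K (s, z)) (fderiv ℝ K (t, z) (1, 0)) t := by
  simpa [Function.comp_def] using (hK.hasFDerivAt.comp t (hasFDerivAt_prodMk_left t z)).hasDerivAt

theorem hasDerivAt_linearIsometryEquiv_comp {X Y : Type*} [NormedAddCommGroup X] [NormedSpace ℝ X]
    [NormedAddCommGroup Y] [NormedSpace ℝ Y] (L : X ≃ₗᵢ[ℝ] Y) {f : ℝ → X} {f' : X} {t : ℝ}
    (hf : HasDerivAt f f' t) : HasDerivAt (fun s => L (f s)) (L f') t :=
  L.toContinuousLinearEquiv.toContinuousLinearMap.hasFDerivAt.comp_hasDerivAt t hf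

theorem hasDerivAt_comp_inr {X : Type*} [NormedAddCommGroup X] [NormedSpace ℝ X]
    {A : ℝ → ℝ × E →L[ℝ] X} {A' : ℝ × E →L[ℝ] X} {t : ℝ} (h : HasDerivAt A A' t) :
    HasDerivAt (fun s => (A s).comp (.inr ℝ ℝ E)) (A'.comp (.inr ℝ ℝ E)) t :=
  ((ContinuousLinearMap.compL ℝ E (ℝ × E) X).flip (.inr ℝ ℝ E)).hasFDerivAt.comp_hasDerivAt t h

/-- Each derivative in `z` is the joint derivative restricted to the second factor and uses up one
order of joint smoothness, whence `n + i`. -/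
theorem contDiffOn_iteratedFDeriv_slice {H : ℝ × E → V} {Ω : Set (ℝ × E)} (hΩ : IsOpen Ω) (i : ℕ) :
    ∀ n : ℕ, ContDiffOn ℝ ((n + i : ℕ) : ℕ∞) H Ω →
      ContDiffOn ℝ (n : ℕ∞) (fun p : ℝ × E => iteratedFDeriv ℝ i (fun z => H (p.1, z)) p.2) Ω := by
  induction i with
  | zero =>
    intro n h
    have := (continuousMultilinearCurryFin0 ℝ E V).symm.contDiff (n := (n : ℕ∞)).comp_contDiffOn h
    exact this.congr fun p _ => by rw [iteratedFDeriv_zero_eq_comp]; rfl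
  | succ i ih =>
    intro n h
    have h1 := ih (n + 1) (by convert h using 3; omega)
    have h2 := h1.fderiv_of_isOpen hΩ (m := (n : ℕ∞)) (by norm_cast)
    have h3 : ContDiffOn ℝ (n : ℕ∞) (fun p : ℝ × E => (fderiv ℝ (fun p : ℝ × E =>
        iteratedFDeriv ℝ i (fun z => H (p.1, z)) p.2) p).comp
          (ContinuousLinearMap.inr ℝ ℝ E)) Ω := h2.clm_comp contDiffOn_const
    have := (continuousMultilinearCurryLeftEquiv ℝ
      (fun _ : Fin (i + 1) => E) V).symm.contDiff (n := (n : ℕ∞)).comp_contDiffOn h3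
    refine this.congr fun p hp => ?_
    rw [iteratedFDeriv_succ_eq_comp_left]
    simp only [Function.comp_apply]
    rw [← fderiv_slice_right (z := p.2)]
    exact (h1.contDiffAt (hΩ.mem_nhds hp)).differentiableAt (by simp)

/-- Differentiation in a parameter commutes with differentiation. -/
theorem hasDerivAt_fderiv_slice {X : Type*} [NormedAddCommGroup X] [NormedSpace ℝ X]
    {K : ℝ × E → X} {t : ℝ} {z : E} (hK : ContDiffAt ℝ 2 K (t, z)) :
    HasDerivAt (fun s => fderiv ℝ (fun z' => K (s, z')) z)
      (fderiv ℝ (fun z' => fderiv ℝ K (t, z') (1, 0)) z) t := by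
  have hK1 : DifferentiableAt ℝ (fderiv ℝ K) (t, z) :=
    (hK.fderiv_right (m := 1) (by norm_num)).differentiableAt (by simp)
  -- Symmetry of the second derivative is what exchanges the derivatives in `t` and in `z`.
  have hsymm : IsSymmSndFDerivAt ℝ K (t, z) := hK.isSymmSndFDerivAt (by simp)
  have hd : ∀ᶠ q in 𝓝 (t, z), DifferentiableAt ℝ K q :=
    (hK.eventually (by simp)).mono fun q hq => hq.differentiableAt (by simp)
  have hnear : ∀ᶠ s in 𝓝 t, DifferentiableAt ℝ K (s, z) :=
    (Continuous.prodMk_left z).continuousAt.eventually hd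
  refine ((hasDerivAt_comp_inr (hasDerivAt_slice_left hK1)).congr_of_eventuallyEq
    (hnear.mono fun s hs => fderiv_slice_right hs)).congr_deriv ?_
  have h2 : DifferentiableAt ℝ (fun p => fderiv ℝ K p (1, 0)) (t, z) :=
    hK1.clm_apply (differentiableAt_const _)
  rw [fderiv_slice_right (K := fun p => fderiv ℝ K p (1, 0)) h2,
    fderiv_clm_apply hK1 (differentiableAt_const _)]
  ext v : 1
  simp [hsymm.eq (1, 0) (0, v)]

/-- Induction on `i`: the exchange of single derivatives is applied to the `i`-th derivative,
regarded as a function of `(t, z)`. The order `2 + i` leaves this function of class `C²`, as the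
symmetry of its second derivative requires. -/
theorem hasDerivAt_iteratedFDeriv_slice {H : ℝ × E → V} {Ω : Set (ℝ × E)} (hΩ : IsOpen Ω) (i : ℕ)
    (hH : ContDiffOn ℝ ((2 + i : ℕ) : ℕ∞) H Ω) {t : ℝ} {z : E} (hp : (t, z) ∈ Ω) :
    HasDerivAt (fun s => iteratedFDeriv ℝ i (fun z => H (s, z)) z)
      (iteratedFDeriv ℝ i (fun z => fderiv ℝ H (t, z) (1, 0)) z) t := by
  induction i generalizing t z with
  | zero =>
    have h1 : DifferentiableAt ℝ H (t, z) :=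
      (hH.contDiffAt (hΩ.mem_nhds hp)).differentiableAt (by simp)
    have := hasDerivAt_linearIsometryEquiv_comp (continuousMultilinearCurryFin0 ℝ E V).symm
      (hasDerivAt_slice_left h1)
    simpa [iteratedFDeriv_zero_eq_comp, Function.comp_def] using this
  | succ i ih =>
    have hH' : ContDiffOn ℝ ((2 + i : ℕ) : ℕ∞) H Ω :=
      hH.of_le (by exact_mod_cast (by omega : 2 + i ≤ 2 + (i + 1)))
    have hK2 := contDiffOn_iteratedFDeriv_slice hΩ i 2 hH'
    have hD := hasDerivAt_fderiv_slice (hK2.contDiffAt (hΩ.mem_nhds hp))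
    have hcH := hasDerivAt_linearIsometryEquiv_comp
      (continuousMultilinearCurryLeftEquiv ℝ (fun _ : Fin (i + 1) => E) V).symm hD
    refine hcH.congr_deriv ?_
    have hnear' : ∀ᶠ z' in 𝓝 z, (t, z') ∈ Ω :=
      (Continuous.prodMk_right t).continuousAt.eventually_mem (hΩ.mem_nhds hp)
    -- The induction hypothesis is used at all points near `z`, because its conclusion is
    -- differentiated once more.
    have : (fun z' => fderiv ℝ (fun p : ℝ × E => iteratedFDeriv ℝ i (fun z => H (p.1, z)) p.2)
        (t, z') (1, 0)) =ᶠ[𝓝 z] iteratedFDeriv ℝ i fun z' => fderiv ℝ H (t, z') (1, 0) := by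
      filter_upwards [hnear'] with z' hz'
      exact (hasDerivAt_slice_left ((hK2.contDiffAt (hΩ.mem_nhds hz')).differentiableAt
        (by simp))).unique (ih hH' hz')
    rw [this.fderiv_eq]
    rfl

/-- Differentiation in a parameter commutes with iterated differentiation. -/
theorem hasDerivAt_iteratedFDeriv_of_contDiffAt {H : ℝ × E → V} {t₀ : ℝ} {z₀ : E}
    (hH : ContDiffAt ℝ ∞ H (t₀, z₀)) (i : ℕ) :
    HasDerivAt (fun t => iteratedFDeriv ℝ i (fun z => H (t, z)) z₀)
      (iteratedFDeriv ℝ i (fun z => fderiv ℝ H (t₀, z) (1, 0)) z₀) t₀ := by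
  obtain ⟨u, hu, hHu⟩ := hH.contDiffOn (m := ((2 + i : ℕ) : ℕ∞)) (mod_cast le_top)
    (by norm_cast; simp)
  obtain ⟨Ω, hΩu, hΩ, hp⟩ := mem_nhds_iff.1 hu
  exact hasDerivAt_iteratedFDeriv_slice hΩ i (hHu.mono hΩu) hp

/-- If all derivatives up to order `k` of the derivatives of `f` in the directions of the first
factor vanish at a point, then `f` has the same `k + 1`-jet as the function with the first variable
frozen. -/
theorem jetEq_freeze_left {P Q : Type*} [NormedAddCommGroup P] [NormedSpace ℝ P]
    [NormedAddCommGroup Q] [NormedSpace ℝ Q] {x₀ : P} {y₀ : Q} (i : ℕ) :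
    ∀ {f : P × Q → V}, ContDiffAt ℝ ∞ f (x₀, y₀) →
    (∀ j : ℕ, j + 1 ≤ i → ∀ v : P,
      iteratedFDeriv ℝ j (fun z => fderiv ℝ f z (v, 0)) (x₀, y₀) = 0) →
    iteratedFDeriv ℝ i f (x₀, y₀) = iteratedFDeriv ℝ i (fun z => f (x₀, z.2)) (x₀, y₀) := by
  induction i with
  | zero => intro f _ _; ext m; simp
  | succ i ih =>
    intro f hf h
    have hfr : ∀ {g : P × Q → V}, ContDiffAt ℝ ∞ g (x₀, y₀) →
        ContDiffAt ℝ ∞ (fun z : P × Q => g (x₀, z.2)) (x₀, y₀) := fun {g} hg =>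
      ContDiffAt.comp (x₀, y₀) (g := g) (f := fun z : P × Q => (x₀, z.2)) hg (by fun_prop)
    have hdf : ∀ w, ContDiffAt ℝ ∞ (fun z => fderiv ℝ f z w) (x₀, y₀) := fun w =>
      (hf.fderiv_right (m := ∞) (by simp)).clm_apply contDiffAt_const
    have hev : ∀ᶠ z in 𝓝 (x₀, y₀), ContDiffAt ℝ 2 f z :=
      (hf.of_le (m := ((2 : ℕ) : ℕ∞)) (mod_cast le_top)).eventually (by simp)
    have hevfr : ∀ᶠ z : P × Q in 𝓝 (x₀, y₀), ContDiffAt ℝ 2 f (x₀, z.2) := by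
      have : ContinuousAt (fun z : P × Q => (x₀, z.2)) (x₀, y₀) := by fun_prop
      exact this.eventually hev
    have hder : ∀ᶠ z : P × Q in 𝓝 (x₀, y₀), ∀ w : P × Q,
        fderiv ℝ (fun z : P × Q => f (x₀, z.2)) z w = fderiv ℝ f (x₀, z.2) (0, w.2) := by
      filter_upwards [hevfr] with z hz w
      have h1 : HasFDerivAt (fun z : P × Q => (x₀, z.2))
          ((0 : P × Q →L[ℝ] P).prod (.snd ℝ P Q)) z :=
        (hasFDerivAt_const x₀ z).prodMk hasFDerivAt_snd
      have h2 := ((hz.differentiableAt (by simp)).hasFDerivAt.comp z h1).fderiv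
      simp only [Function.comp_def] at h2
      rw [h2]; rfl
    ext m
    -- The last direction splits as `(v, 0) + (0, w)`. The first part vanishes by hypothesis; the
    -- second is handled by induction applied to the derivative of `f` along `(0, w)`.
    obtain ⟨m, ⟨v, w⟩, rfl⟩ : ∃ m' w, m = Fin.snoc m' w := ⟨Fin.init m, m (Fin.last _), by simp⟩
    rw [← iteratedFDeriv_fderiv_apply hf, ← iteratedFDeriv_fderiv_apply (hfr hf)]
    have e1 : iteratedFDeriv ℝ i (fun z => fderiv ℝ f z (v, w)) (x₀, y₀) =
        iteratedFDeriv ℝ i (fun z => fderiv ℝ f z (0, w)) (x₀, y₀) := by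
      have e : (fun z => fderiv ℝ f z (v, w)) =
          (fun z => fderiv ℝ f z (v, 0)) + fun z => fderiv ℝ f z (0, w) := by
        ext z; simp [← map_add]
      have c : ∀ w, ContDiffAt ℝ i (fun z => fderiv ℝ f z w) (x₀, y₀) := fun w =>
        (hdf w).of_le (mod_cast le_top)
      rw [e, iteratedFDeriv_add_apply (c _) (c _), h i le_rfl v, zero_add]
    have e2 : (fun z => fderiv ℝ (fun z : P × Q => f (x₀, z.2)) z (v, w)) =ᶠ[𝓝 (x₀, y₀)]
        fun z => fderiv ℝ f (x₀, z.2) (0, w) := hder.mono fun z hz => hz _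
    rw [e1, (e2.iteratedFDeriv ℝ i).eq_of_nhds]
    rw [ih (hdf (0, w))]
    intro j hj u
    -- The derivative along `(0, w)` inherits the hypothesis: directional derivatives commute, so an
    -- order `j` derivative of `∂_(u,0) ∂_(0,w) f` is an order `j + 1` derivative of `∂_(u,0) f`.
    have e3 : (fun z => fderiv ℝ (fun z => fderiv ℝ f z (0, w)) z (u, 0)) =ᶠ[𝓝 (x₀, y₀)]
        fun z => fderiv ℝ (fun z => fderiv ℝ f z (u, 0)) z (0, w) := by
      filter_upwards [hev] with z hz
      have hd : DifferentiableAt ℝ (fderiv ℝ f) z :=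
        (hz.fderiv_right (m := 1) (by norm_num)).differentiableAt (by simp)
      rw [fderiv_clm_apply hd (differentiableAt_const _),
        fderiv_clm_apply hd (differentiableAt_const _)]
      simp [(hz.isSymmSndFDerivAt (by simp)).eq (u, 0) (0, w)]
    rw [(e3.iteratedFDeriv ℝ j).eq_of_nhds]
    ext m'
    rw [iteratedFDeriv_fderiv_apply (hdf (u, 0)), h (j + 1) (by omega) u]
    simp

end JetsInNormedSpaces
end FolBundle

end

noncomputable section

namespace FolBundle

/-! ### Superposition and integration operators on spaces of continuous curves. -/

section Superposition

variable {K : Type*} [TopologicalSpace K] [CompactSpace K]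
variable {E F : Type*} [NormedAddCommGroup E] [NormedSpace ℝ E] [NormedAddCommGroup F]
  [NormedSpace ℝ F]

/-- Pointwise application of a continuous family of operators, as a bounded bilinear map. -/
def curveApply (K : Type*) [TopologicalSpace K] [CompactSpace K] (E F : Type*)
    [NormedAddCommGroup E] [NormedSpace ℝ E] [NormedAddCommGroup F] [NormedSpace ℝ F] :
    C(K, E →L[ℝ] F) →L[ℝ] C(K, E) →L[ℝ] C(K, F) :=
  LinearMap.mkContinuous₂
    (LinearMap.mk₂ ℝ (fun (A : C(K, E →L[ℝ] F)) (h : C(K, E)) =>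
        (⟨fun x => A x (h x), by fun_prop⟩ : C(K, F)))
      (fun A B h => by ext; simp) (fun c A h => by ext; simp)
      (fun A g h => by ext; simp) (fun c A h => by ext; simp)) 1 (fun A h => by
        rw [ContinuousMap.norm_le _ (by positivity)]
        intro x
        simp only [LinearMap.mk₂_apply, ContinuousMap.coe_mk, one_mul]
        exact (A x).le_of_opNorm_le_of_le (A.norm_coe_le_norm x) (h.norm_coe_le_norm x))

@[simp]
theorem curveApply_apply (A : C(K, E →L[ℝ] F)) (h : C(K, E)) (x : K) :
    curveApply K E F A h x = A x (h x) := rfl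

/-- The superposition operator of a continuous map. -/
def superpose (K : Type*) [TopologicalSpace K] {E F : Type*} [TopologicalSpace E]
    [TopologicalSpace F] (g : C(E, F)) (w : C(K, E)) : C(K, F) := g.comp w

@[simp]
theorem superpose_apply {K E F : Type*} [TopologicalSpace K] [TopologicalSpace E]
    [TopologicalSpace F] (g : C(E, F)) (w : C(K, E)) (x : K) : superpose K g w x = g (w x) := rfl

/-- On a compact domain the topology of `C(K, F)` is that of uniform convergence, so continuity of
postcomposition is already a uniform estimate. -/
theorem exists_norm_superpose_sub_le {K E F : Type*} [TopologicalSpace K] [CompactSpace K]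
    [NormedAddCommGroup E] [NormedAddCommGroup F] (g : C(E, F)) (w : C(K, E)) {ε : ℝ} (hε : 0 < ε) :
    ∃ δ > 0, ∀ q : C(K, E), ‖q‖ < δ → ∀ x, ‖g (w x + q x) - g (w x)‖ ≤ ε := by
  have hc : Continuous (superpose K g) := ContinuousMap.continuous_postcomp g
  obtain ⟨δ, hδ, H⟩ := Metric.continuousAt_iff.1 (hc.continuousAt (x := w)) ε hε
  refine ⟨δ, hδ, fun q hq x => ?_⟩
  have h1 : dist (w + q) w < δ := by rwa [dist_eq_norm, add_sub_cancel_left]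
  have h2 := (ContinuousMap.dist_apply_le_dist (f := superpose K g (w + q))
    (g := superpose K g w) x).trans (H h1).le
  simpa [dist_eq_norm] using h2

/-- The remainder is bounded pointwise by the mean value inequality on the segment from `w x` to `w
x + q x`; along it `g'` varies by at most `ε`, uniformly in `x`. -/
theorem hasFDerivAt_superpose (g : C(E, F)) (g' : C(E, E →L[ℝ] F))
    (h : ∀ x, HasFDerivAt g (g' x) x) (w : C(K, E)) :
    HasFDerivAt (superpose K g) (curveApply K E F (superpose K g' w)) w := by
  rw [hasFDerivAt_iff_isLittleO_nhds_zero, Asymptotics.isLittleO_iff]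
  intro ε hε
  obtain ⟨δ, hδ, H⟩ := exists_norm_superpose_sub_le g' w hε
  filter_upwards [Metric.ball_mem_nhds (0 : C(K, E)) hδ] with q hq
  rw [mem_ball_zero_iff] at hq
  rw [ContinuousMap.norm_le _ (by positivity)]
  intro x
  have hb : ∀ y ∈ segment ℝ (w x) (w x + q x), ‖g' y - g' (w x)‖ ≤ ε := by
    intro y hy
    rw [segment_eq_image'] at hy
    obtain ⟨s, ⟨hs0, hs1⟩, rfl⟩ := hy
    have := H (s • q) (by
      rw [norm_smul, Real.norm_of_nonneg hs0]
      exact lt_of_le_of_lt (mul_le_of_le_one_left (norm_nonneg _) hs1) hq) x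
    simpa using this
  have := (convex_segment (w x) (w x + q x)).norm_image_sub_le_of_norm_hasFDerivWithin_le'
    (fun y _ => (h y).hasFDerivWithinAt) hb (left_mem_segment ..) (right_mem_segment ..)
  simp only [add_sub_cancel_left] at this
  simp only [ContinuousMap.sub_apply, superpose_apply, ContinuousMap.add_apply, curveApply_apply]
  exact this.trans (mul_le_mul_of_nonneg_left (q.norm_coe_le_norm x) hε.le)

theorem contDiff_clm_curves {A G : Type*} [NormedAddCommGroup A] [NormedSpace ℝ A]
    [NormedAddCommGroup G] [NormedSpace ℝ G] (L : C(K, A) →L[ℝ] G) {n : WithTop ℕ∞} :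
    ContDiff ℝ n L := L.contDiff

/-- The derivative of a superposition operator is a superposition operator followed by the bounded
map `curveApply`; this drives the induction. As `F` is replaced by `E →L[ℝ] F`, both spaces are kept
in one universe. -/
theorem contDiff_superpose_nat.{u} {K : Type*} [TopologicalSpace K] [CompactSpace K] {E F : Type u}
    [NormedAddCommGroup E] [NormedSpace ℝ E] [NormedAddCommGroup F] [NormedSpace ℝ F]
    (n : ℕ) (g : C(E, F)) (hg : ContDiff ℝ ∞ g) : ContDiff ℝ n (superpose K g) := by
  induction n generalizing F with
  | zero =>
    exact contDiff_zero.2 (ContinuousMap.continuous_postcomp g)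
  | succ n ih =>
    have hg' : ContDiff ℝ ∞ (fderiv ℝ g) := hg.fderiv_right (by simp)
    push_cast
    rw [contDiff_succ_iff_hasFDerivAt]
    refine ⟨fun w => curveApply K E F (superpose K ⟨fderiv ℝ g, hg'.continuous⟩ w),
      ContDiff.comp (g := curveApply K E F) (contDiff_clm_curves (curveApply K E F))
        (ih ⟨fderiv ℝ g, hg'.continuous⟩ hg'), fun w => ?_⟩
    exact hasFDerivAt_superpose g ⟨fderiv ℝ g, hg'.continuous⟩
      (fun x => (hg.differentiable (by simp) x).hasFDerivAt) w

theorem contDiff_superpose.{u} {K : Type*} [TopologicalSpace K] [CompactSpace K] {E F : Type u}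
    [NormedAddCommGroup E] [NormedSpace ℝ E] [NormedAddCommGroup F] [NormedSpace ℝ F]
    (g : C(E, F)) (hg : ContDiff ℝ ∞ g) : ContDiff ℝ ∞ (superpose K g) :=
  contDiff_infty.2 fun n => contDiff_superpose_nat n g hg

/-- Integration from `0`, as an operator on continuous curves. -/
def curveIntegral (E : Type*) [NormedAddCommGroup E] [NormedSpace ℝ E] [CompleteSpace E] :
    C(unitInterval, E) →L[ℝ] C(unitInterval, E) :=
  LinearMap.mkContinuous
    { toFun := fun h => ⟨fun t => ∫ s in (0 : ℝ)..t, h (projIcc 0 1 zero_le_one s), by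
        have : Continuous fun t : ℝ => ∫ s in (0 : ℝ)..t, h (projIcc 0 1 zero_le_one s) :=
          intervalIntegral.continuous_primitive
            (fun a b => (h.continuous.comp continuous_projIcc).intervalIntegrable a b) 0
        exact this.comp continuous_subtype_val⟩
      map_add' := fun g h => by
        ext t
        exact intervalIntegral.integral_add
          ((g.continuous.comp continuous_projIcc).intervalIntegrable _ _)
          ((h.continuous.comp continuous_projIcc).intervalIntegrable _ _)
      map_smul' := fun c h => by
        ext t
        exact intervalIntegral.integral_smul c _ } 1 (fun h => by
    rw [ContinuousMap.norm_le _ (by positivity)]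
    intro t
    have := intervalIntegral.norm_integral_le_of_norm_le_const
      (f := fun s => h (projIcc 0 1 zero_le_one s)) (a := 0) (b := t) (C := ‖h‖)
      (fun s _ => h.norm_coe_le_norm _)
    refine this.trans ?_
    rw [sub_zero, abs_of_nonneg t.2.1, mul_comm]
    exact mul_le_mul_of_nonneg_right t.2.2 (norm_nonneg _))

theorem curveIntegral_apply [CompleteSpace E] (h : C(unitInterval, E)) (t : unitInterval) :
    curveIntegral E h t = ∫ s in (0 : ℝ)..t, h (projIcc 0 1 zero_le_one s) := rfl

/-- The primitive of a continuous curve on the unit interval, extended to the line. -/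
theorem hasDerivAt_primitive [CompleteSpace E] (h : C(unitInterval, E)) (t : ℝ) :
    HasDerivAt (fun t : ℝ => ∫ s in (0 : ℝ)..t, h (projIcc 0 1 zero_le_one s))
      (h (projIcc 0 1 zero_le_one t)) t :=
  have hc : Continuous fun s => h (projIcc 0 1 zero_le_one s) := h.continuous.comp continuous_projIcc
  intervalIntegral.integral_hasDerivAt_right (hc.intervalIntegrable _ _)
    (hc.stronglyMeasurableAtFilter _ _) hc.continuousAt

end Superposition

/-! ### Implicit functions that are smooth near the point. -/

section ImplicitFunctions

variable {X Y Z : Type*} [NormedAddCommGroup X] [NormedSpace ℝ X] [NormedAddCommGroup Y]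
  [NormedSpace ℝ Y] [NormedAddCommGroup Z] [NormedSpace ℝ Z]

theorem isOpen_setOf_isInvertible [CompleteSpace X] : IsOpen {A : X →L[ℝ] Y | A.IsInvertible} := by
  have : {A : X →L[ℝ] Y | A.IsInvertible} = range ((↑) : (X ≃L[ℝ] Y) → X →L[ℝ] Y) := by
    ext A; rfl
  rw [this]
  exact ContinuousLinearEquiv.isOpen

/-- The implicit function theorem, with smoothness of the implicit function near the point. -/
theorem exists_smooth_implicit [CompleteSpace X] [CompleteSpace Y] [CompleteSpace Z]
    {Ψ : X × Y → Z} (hΨ : ContDiff ℝ ∞ Ψ) {x₀ : X} {y₀ : Y}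
    (h₀ : Ψ (x₀, y₀) = 0) (hinv : (fderiv ℝ Ψ (x₀, y₀) ∘L .inr ℝ X Y).IsInvertible) :
    ∃ φ : X → Y, φ x₀ = y₀ ∧ ∀ᶠ x in 𝓝 x₀, ContDiffAt ℝ ∞ φ x ∧ Ψ (x, φ x) = 0 := by
  have hn : (∞ : WithTop ℕ∞) ≠ 0 := by simp
  have cd : ContDiffAt ℝ ∞ Ψ (x₀, y₀) := hΨ.contDiffAt
  set φ := cd.implicitFunction hn hinv with hφ
  have hφ0 : φ x₀ = y₀ := cd.implicitFunction_apply_self hn hinv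
  have hφs : ContDiffAt ℝ ∞ φ x₀ := cd.contDiffAt_implicitFunction hn hinv
  have hzero : ∀ᶠ x in 𝓝 x₀, Ψ (x, φ x) = 0 :=
    (cd.eventually_apply_implicitFunction hn hinv).mono fun x hx => by rw [hx, h₀]
  have hcont : ∀ᶠ x in 𝓝 x₀, ContinuousAt φ x :=
    ((hφs.of_le (m := 1) (by simp)).eventually (by simp)).mono fun x hx => hx.continuousAt
  have hinv' : ∀ᶠ x in 𝓝 x₀, (fderiv ℝ Ψ (x, φ x) ∘L .inr ℝ X Y).IsInvertible := by
    have hc : ContinuousAt (fun x => fderiv ℝ Ψ (x, φ x) ∘L .inr ℝ X Y) x₀ := by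
      have h1 : ContinuousAt (fun x => fderiv ℝ Ψ (x, φ x)) x₀ :=
        ((hΨ.continuous_fderiv (by simp)).continuousAt).comp
          (continuousAt_id.prodMk hφs.continuousAt)
      exact h1.clm_comp continuousAt_const
    exact hc.eventually_mem (isOpen_setOf_isInvertible.mem_nhds (by rw [hφ0]; exact hinv))
  refine ⟨φ, hφ0, ?_⟩
  -- Being `C^∞` at `x₀` does not give `C^∞` at nearby points, since the neighbourhoods may shrink
  -- with the order. So the implicit function theorem is applied afresh at each nearby `(x, φ x)`,
  -- and local uniqueness identifies its solution with `φ`.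
  filter_upwards [hzero, hzero.eventually_nhds, hcont, hinv'] with x hx hxn hxc hxi
  refine ⟨?_, hx⟩
  have cd' : ContDiffAt ℝ ∞ Ψ (x, φ x) := hΨ.contDiffAt
  have h1 := cd'.eventually_apply_eq_iff_implicitFunction hn hxi
  have h2 : ∀ᶠ z in 𝓝 x, Ψ (z, φ z) = Ψ (x, φ x) ↔ cd'.implicitFunction hn hxi z = φ z :=
    (continuousAt_id.prodMk hxc).eventually h1
  have h3 : φ =ᶠ[𝓝 x] cd'.implicitFunction hn hxi := by
    filter_upwards [h2, hxn] with z hz hz'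
    exact (hz.1 (by rw [hz', hx])).symm
  exact (cd'.contDiffAt_implicitFunction hn hxi).congr_of_eventuallyEq h3

end ImplicitFunctions

/-! ### Global extension of smooth germs. -/

section Extension

variable {X Y : Type*} [NormedAddCommGroup X] [NormedSpace ℝ X] [FiniteDimensional ℝ X]
  [NormedAddCommGroup Y] [NormedSpace ℝ Y]

/-- Multiplication by a bump function supported inside the ball of smoothness. Charts provide only
local data, whereas superposition operators on whole curve spaces need globally smooth maps. -/
theorem exists_contDiff_extension {G : X → Y} {x₀ : X} (h : ∀ᶠ z in 𝓝 x₀, ContDiffAt ℝ ∞ G z) :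
    ∃ G' : X → Y, ContDiff ℝ ∞ G' ∧ G' =ᶠ[𝓝 x₀] G := by
  obtain ⟨r, hr, H⟩ := Metric.eventually_nhds_iff_ball.1 h
  let b : ContDiffBump x₀ := ⟨r / 4, r / 2, by positivity, by linarith⟩
  refine ⟨fun x => b x • G x, contDiff_iff_contDiffAt.2 fun x => ?_, ?_⟩
  · by_cases hx : x ∈ Metric.ball x₀ r
    · exact b.contDiff.contDiffAt.smul (H x hx)
    · have : (fun x => b x • G x) =ᶠ[𝓝 x] fun _ => 0 := by
        have hx' : x ∈ (Metric.closedBall x₀ (r / 2))ᶜ := by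
          simp only [Metric.mem_ball, not_lt] at hx
          simp only [mem_compl_iff, Metric.mem_closedBall, not_le]
          linarith
        filter_upwards [Metric.isClosed_closedBall.isOpen_compl.mem_nhds hx'] with y hy
        simp only [mem_compl_iff, Metric.mem_closedBall, not_le] at hy
        rw [b.zero_of_le_dist hy.le, zero_smul]
      exact contDiffAt_const.congr_of_eventuallyEq this
  · filter_upwards [b.eventuallyEq_one] with x hx
    simp [hx]

end Extension

end FolBundle

end

noncomputable section

namespace FolBundle

/-! ### Integration of completely integrable total differential equations along rays. -/

section LeafwiseIntegration

variable {P W : Type} [NormedAddCommGroup P] [NormedSpace ℝ P] [NormedAddCommGroup W]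
  [NormedSpace ℝ W]

/-- Constant curves. -/
def constCurve (W : Type) [NormedAddCommGroup W] [NormedSpace ℝ W] : W →L[ℝ] C(unitInterval, W) :=
  LinearMap.mkContinuous
    { toFun := fun w => ContinuousMap.const _ w
      map_add' := fun _ _ => rfl
      map_smul' := fun _ _ => rfl } 1 (fun w => by
    rw [ContinuousMap.norm_le _ (by positivity)]
    intro t
    rw [one_mul]
    exact le_refl ‖w‖)

/-- The curve `s ↦ ((s u, w s), u)`. -/
def rayCurve (P W : Type) [NormedAddCommGroup P] [NormedSpace ℝ P] [NormedAddCommGroup W]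
    [NormedSpace ℝ W] : P × C(unitInterval, W) →L[ℝ] C(unitInterval, (P × W) × P) :=
  LinearMap.mkContinuous
    { toFun := fun q => ⟨fun s => (((s : ℝ) • q.1, q.2 s), q.1), by fun_prop⟩
      map_add' := fun a b => by ext <;> simp
      map_smul' := fun c a => by ext <;> simp [smul_comm c] } 1 (fun q => by
    rw [ContinuousMap.norm_le _ (by positivity)]
    intro t
    simp only [LinearMap.coe_mk, AddHom.coe_mk, ContinuousMap.coe_mk, one_mul]
    have h1 : ‖q.1‖ ≤ ‖q‖ := norm_fst_le q
    have h2 : ‖q.2 t‖ ≤ ‖q‖ := (q.2.norm_coe_le_norm t).trans (norm_snd_le q)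
    have h3 : ‖(t : ℝ) • q.1‖ ≤ ‖q‖ := by
      rw [norm_smul, Real.norm_of_nonneg t.2.1]
      exact (mul_le_of_le_one_left (norm_nonneg _) t.2.2).trans h1
    exact norm_prod_le_iff.2 ⟨norm_prod_le_iff.2 ⟨h3, h2⟩, h1⟩)

@[simp] theorem constCurve_apply (w : W) (t : unitInterval) : constCurve W w t = w := rfl

@[simp] theorem rayCurve_apply (q : P × C(unitInterval, W)) (s : unitInterval) :
    rayCurve P W q s = (((s : ℝ) • q.1, q.2 s), q.1) := rfl

/-- The integral equation `w(t) = w₀ + ∫₀ᵗ g((s u, w(s)), u) ds` has solutions on the unit interval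
depending smoothly on `(u, w₀)` near `0`, if `g(·, 0) = 0`. -/
theorem exists_rayCurve_solution [CompleteSpace P] [CompleteSpace W] {g : (P × W) × P → W}
    (hg : ContDiff ℝ ∞ g) (hg0 : ∀ z, g (z, 0) = 0) :
    ∃ w : P × W → C(unitInterval, W), w 0 = 0 ∧ ∀ᶠ p in 𝓝 0, ContDiffAt ℝ ∞ w p ∧
      w p = constCurve W p.2 + curveIntegral W
        (superpose unitInterval ⟨g, hg.continuous⟩ (rayCurve P W (p.1, w p))) := by
  set gc : C((P × W) × P, W) := ⟨g, hg.continuous⟩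
  let Ψ : (P × W) × C(unitInterval, W) → C(unitInterval, W) := fun q =>
    q.2 - constCurve W q.1.2 - curveIntegral W (superpose unitInterval gc (rayCurve P W (q.1.1, q.2)))
  have hray : ContDiff ℝ ∞ fun q : (P × W) × C(unitInterval, W) => rayCurve P W (q.1.1, q.2) :=
    (rayCurve P W).contDiff.comp (by fun_prop)
  have hΨ : ContDiff ℝ ∞ Ψ := by
    refine (contDiff_snd.sub ((constCurve W).contDiff.comp (by fun_prop))).sub
      ((curveIntegral W).contDiff.comp ((contDiff_superpose gc hg).comp hray))
  -- For `u = 0` the integrand vanishes, so `Ψ(0, ·)` is the identity and its derivative is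
  -- invertible. Solutions thus exist on the whole unit interval, with smallness imposed only on the
  -- data.
  have hΨ0 : ∀ w, Ψ (0, w) = w := by
    intro w
    have : superpose unitInterval gc (rayCurve P W (0, w)) = 0 := by
      ext t; simp [gc, hg0]
    simp [Ψ, this]
  have hder : fderiv ℝ Ψ (0, 0) ∘L .inr ℝ (P × W) C(unitInterval, W) = .id ℝ _ := by
    have h1 : HasFDerivAt (fun w => Ψ (0, w)) (fderiv ℝ Ψ (0, 0) ∘L .inr ℝ _ _) 0 :=
      (hΨ.differentiable (by simp) (0, 0)).hasFDerivAt.comp (0 : C(unitInterval, W))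
        (hasFDerivAt_prodMk_right (0 : P × W) 0)
    have h2 : HasFDerivAt (fun w => Ψ (0, w)) (.id ℝ _) 0 := by
      simp only [hΨ0]; exact hasFDerivAt_id _
    exact h1.unique h2
  obtain ⟨w, hw0, hw⟩ := exists_smooth_implicit hΨ (hΨ0 0)
    (by rw [hder]; exact ⟨.refl ℝ _, rfl⟩)
  refine ⟨w, hw0, hw.mono fun p hp => ⟨hp.1, ?_⟩⟩
  have := hp.2
  simp only [Ψ, sub_sub, sub_eq_zero] at this
  exact this

/-- The linearisation of the integral equation. -/
theorem fderiv_rayCurve_solution [CompleteSpace P] [CompleteSpace W] {g : (P × W) × P → W}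
    (hg : ContDiff ℝ ∞ g) {w : P × W → C(unitInterval, W)} {p : P × W}
    (hw : ∀ᶠ p in 𝓝 p, ContDiffAt ℝ ∞ w p ∧
      w p = constCurve W p.2 + curveIntegral W
        (superpose unitInterval ⟨g, hg.continuous⟩ (rayCurve P W (p.1, w p)))) (v : P)
    (t : unitInterval) :
    fderiv ℝ w p (v, 0) t = ∫ s in (0 : ℝ)..t, (fun s : unitInterval =>
      fderiv ℝ g (((s : ℝ) • p.1, w p s), p.1) (((s : ℝ) • v, fderiv ℝ w p (v, 0) s), v))
        (projIcc 0 1 zero_le_one s) := by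
  have hg' : ContDiff ℝ ∞ (fderiv ℝ g) := hg.fderiv_right (by simp)
  have hwd : HasFDerivAt w (fderiv ℝ w p) p :=
    (hw.self_of_nhds.1.differentiableAt (by simp)).hasFDerivAt
  have h1 : HasFDerivAt (fun p : P × W => rayCurve P W (p.1, w p))
      ((rayCurve P W).comp ((ContinuousLinearMap.fst ℝ P W).prod (fderiv ℝ w p))) p :=
    (rayCurve P W).hasFDerivAt.comp p (hasFDerivAt_fst.prodMk hwd)
  have h2 := (hasFDerivAt_superpose (K := unitInterval) ⟨g, hg.continuous⟩
    ⟨fderiv ℝ g, hg'.continuous⟩ (fun x => (hg.differentiable (by simp) x).hasFDerivAt)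
    (rayCurve P W (p.1, w p))).comp p h1
  have h3 := (curveIntegral W).hasFDerivAt.comp p h2
  have h4 := ((constCurve W).hasFDerivAt.comp p (hasFDerivAt_snd (𝕜 := ℝ) (p := p))).add h3
  have h5 := (hwd.congr_of_eventuallyEq (f := w)
    (Filter.EventuallyEq.symm (hw.mono fun q hq => hq.2))).unique h4
  have h6 := congrArg (fun A => A (v, 0) t) h5
  simp only [add_apply, ContinuousLinearMap.comp_apply,
    ContinuousMap.add_apply] at h6
  rw [h6]
  simp [curveIntegral_apply]

/-- The solution of the integral equation along rays is a leafwise solution of the total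
differential equation `∂_u w = G(u, w)` if the latter is integrable along the solution. -/
theorem fderiv_rayCurve_eq_of_integrable [FiniteDimensional ℝ P] [FiniteDimensional ℝ W]
    {G : P × W → P →L[ℝ] W}
    (hG : ContDiff ℝ ∞ G) {g : (P × W) × P → W} (hg : ContDiff ℝ ∞ g)
    (hgG : ∀ z, g z = G z.1 z.2) {w : P × W → C(unitInterval, W)} {p : P × W}
    (hw : ∀ᶠ p in 𝓝 p, ContDiffAt ℝ ∞ w p ∧
      w p = constCurve W p.2 + curveIntegral W
        (superpose unitInterval ⟨g, hg.continuous⟩ (rayCurve P W (p.1, w p))))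
    (hint : ∀ s : unitInterval, ∀ u v, fderiv ℝ G ((s : ℝ) • p.1, w p s)
      (u, G ((s : ℝ) • p.1, w p s) u) v =
      fderiv ℝ G ((s : ℝ) • p.1, w p s) (v, G ((s : ℝ) • p.1, w p s) v) u) (v : P) :
    fderiv ℝ w p (v, 0) 1 = G (p.1, w p 1) v := by
  have hGd : ∀ z, HasFDerivAt G (fderiv ℝ G z) z := fun z =>
    (hG.differentiable (by simp) z).hasFDerivAt
  have hgd : ∀ z c z' c', fderiv ℝ g (z, c) (z', c') = fderiv ℝ G z z' c + G z c' := by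
    intro z c z' c'
    have e : g = fun q : (P × W) × P => G q.1 q.2 := funext hgG
    have h1 : HasFDerivAt (fun q : (P × W) × P => G q.1)
        ((fderiv ℝ G z).comp (.fst ℝ (P × W) P)) (z, c) :=
      (hGd z).comp (z, c) (hasFDerivAt_fst (p := (z, c)))
    have h2 := h1.clm_apply (hasFDerivAt_snd (p := (z, c)))
    rw [e, h2.fderiv]
    simp [add_comm]
  set r : ℝ → unitInterval := projIcc 0 1 zero_le_one with hr
  have hr' : ∀ t ∈ Icc (0 : ℝ) 1, ((r t : unitInterval) : ℝ) = t := fun t ht => by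
    rw [hr, projIcc_of_mem _ ht]
  set curve : C(unitInterval, W) := superpose unitInterval ⟨g, hg.continuous⟩
    (rayCurve P W (p.1, w p)) with hcurve
  set ζ : ℝ → W := fun t => p.2 + ∫ s in (0 : ℝ)..t, curve (r s) with hζ
  have hζw : ∀ t ∈ Icc (0 : ℝ) 1, ζ t = w p (r t) := by
    intro t ht
    have := congrArg (fun A => A (r t)) hw.self_of_nhds.2
    simp only [ContinuousMap.add_apply, constCurve_apply, curveIntegral_apply] at this
    rw [this, hr' t ht]
  have hζd : ∀ t ∈ Icc (0 : ℝ) 1, HasDerivAt ζ (G (t • p.1, ζ t) p.1) t := by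
    intro t ht
    refine ((hasDerivAt_primitive curve t).const_add p.2).congr_deriv ?_
    simp [hcurve, hgG, hζw t ht, ← hr, hr' t ht]
  have hζc : ContinuousOn ζ (Icc 0 1) := fun t ht => (hζd t ht).continuousAt.continuousWithinAt
  set h := fderiv ℝ w p (v, 0) with hh
  have hch : Continuous fun s : unitInterval =>
      fderiv ℝ g (((s : ℝ) • p.1, w p s), p.1) (((s : ℝ) • v, h s), v) := by
    have : Continuous (fderiv ℝ g) := hg.continuous_fderiv (by simp)
    exact (this.comp (by fun_prop)).clm_apply (by fun_prop)
  set η : ℝ → W := fun t => ∫ s in (0 : ℝ)..t, (⟨_, hch⟩ : C(unitInterval, W)) (r s) with hη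
  have hηh : ∀ t ∈ Icc (0 : ℝ) 1, η t = h (r t) := by
    intro t ht
    have := fderiv_rayCurve_solution hg hw v (r t)
    rw [hh, this, hr' t ht]
    rfl
  -- With `u = p.1`, this is the linearised equation along the solution `ζ`. The variation `η` in
  -- the direction `v` and the curve `κ(t) = t G(t u, ζ t) v` both solve it with initial value `0`;
  -- their equality at `t = 1` is the claim.
  let F : ℝ → W → W := fun t x => G (t • p.1, ζ t) v + fderiv ℝ G (t • p.1, ζ t) (t • v, x) p.1
  have hηd : ∀ t ∈ Icc (0 : ℝ) 1, HasDerivAt η (F t (η t)) t := by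
    intro t ht
    refine (hasDerivAt_primitive _ t).congr_deriv ?_
    simp only [ContinuousMap.coe_mk, ← hr, F]
    rw [hgd, hr' t ht, hζw t ht, hηh t ht, add_comm]
  set κ : ℝ → W := fun t => t • G (t • p.1, ζ t) v with hκ
  have hκd : ∀ t ∈ Icc (0 : ℝ) 1, HasDerivAt κ (F t (κ t)) t := by
    intro t ht
    have h1 : HasDerivAt (fun t => (t • p.1, ζ t)) (p.1, G (t • p.1, ζ t) p.1) t := by
      simpa using ((hasDerivAt_id t).smul_const p.1).prodMk (hζd t ht)
    have h2 : HasDerivAt (fun t => G (t • p.1, ζ t))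
        (fderiv ℝ G (t • p.1, ζ t) (p.1, G (t • p.1, ζ t) p.1)) t :=
      (hGd _).comp_hasDerivAt t h1
    have h3 := (hasDerivAt_id t).smul (h2.clm_apply (hasDerivAt_const t v))
    refine h3.congr_deriv ?_
    -- Integrability enters here: it replaces the derivative of `G` along `(u, G u)`, applied to
    -- `v`, by the derivative along `(v, G v)`, applied to `u`.
    have hi := hint (r t) p.1 v
    rw [hr' t ht, ← hζw t ht] at hi
    have e : (t • v, κ t) = t • (v, G (t • p.1, ζ t) v) := rfl
    simp only [F, e, map_smul, smul_apply, ← hi, map_zero, add_zero, id, one_smul]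
    rw [add_comm]
  -- `F` is affine in its second argument with linear part `A`; a bound for `A` on the compact
  -- interval is the Lipschitz constant.
  let A : ℝ → W →L[ℝ] W := fun t => (ContinuousLinearMap.apply ℝ W p.1).comp
    ((fderiv ℝ G (t • p.1, ζ t)).comp (.inr ℝ P W))
  have hA : ContinuousOn A (Icc 0 1) := by
    have h1 : ContinuousOn (fun t => fderiv ℝ G (t • p.1, ζ t)) (Icc 0 1) :=
      (hG.continuous_fderiv (by simp)).comp_continuousOn
        ((continuous_id.smul continuous_const).continuousOn.prodMk hζc)
    exact continuousOn_const.clm_comp (h1.clm_comp continuousOn_const)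
  obtain ⟨C, hC⟩ := isCompact_Icc.exists_bound_of_continuousOn hA
  have hLip : ∀ t ∈ Ico (0 : ℝ) 1, LipschitzOnWith C.toNNReal (F t) univ := by
    intro t ht
    have ht' : t ∈ Icc (0 : ℝ) 1 := Ico_subset_Icc_self ht
    have hC0 : 0 ≤ C := (norm_nonneg _).trans (hC t ht')
    refine LipschitzOnWith.of_dist_le_mul fun x _ y _ => ?_
    rw [Real.coe_toNNReal _ hC0]
    have e : F t x - F t y = A t (x - y) := by
      simp only [F, A, add_sub_add_left_eq_sub, ← sub_apply, ← map_sub]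
      simp
    rw [dist_eq_norm, dist_eq_norm, e]
    exact (A t).le_of_opNorm_le (hC t ht') _
  have key := ODE_solution_unique_of_mem_Icc_right (s := fun _ => univ) hLip
    (fun t ht => (hηd t ht).continuousAt.continuousWithinAt)
    (fun t ht => (hηd t (Ico_subset_Icc_self ht)).hasDerivWithinAt) (fun _ _ => mem_univ _)
    (fun t ht => (hκd t ht).continuousAt.continuousWithinAt)
    (fun t ht => (hκd t (Ico_subset_Icc_self ht)).hasDerivWithinAt) (fun _ _ => mem_univ _)
    (by simp [hη, hκ])
  have h1 : (1 : ℝ) ∈ Icc (0 : ℝ) 1 := by simp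
  have hr1 : r 1 = 1 := by ext; rw [hr' 1 h1]; rfl
  have := key h1
  rw [hηh 1 h1, hr1] at this
  rw [this]
  simp only [hκ]
  rw [hζw 1 h1, hr1, one_smul, one_smul]

/-- Local integration of a completely integrable total differential equation
`∂_u w = G(u, w)`, with smooth dependence on the initial value. -/
theorem exists_leafwise_integral [FiniteDimensional ℝ P] [FiniteDimensional ℝ W]
    {G : P × W → P →L[ℝ] W} (hG : ∀ᶠ z in 𝓝 0, ContDiffAt ℝ ∞ G z)
    (hint : ∀ᶠ z in 𝓝 0, ∀ u v,
      fderiv ℝ G z (u, G z u) v = fderiv ℝ G z (v, G z v) u) :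
    ∃ w : P × W → W, (∀ᶠ p in 𝓝 0, ContDiffAt ℝ ∞ w p ∧
      ∀ v, fderiv ℝ w p (v, 0) = G (p.1, w p) v) ∧ ∀ᶠ y in 𝓝 0, w (0, y) = y := by
  obtain ⟨G', hG', hGG'⟩ := exists_contDiff_extension hG
  let g : (P × W) × P → W := fun z => G' z.1 z.2
  have hg : ContDiff ℝ ∞ g := by fun_prop
  obtain ⟨w, hw0, hw⟩ := exists_rayCurve_solution hg (by simp [g])
  -- For small data the whole curve `s ↦ (s u, w s)` stays where the extension `G'` has the same
  -- germs as `G`, so the integrability of `G` is available along it.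
  have hev : ∀ᶠ q : P × C(unitInterval, W) in 𝓝 0, ∀ s : unitInterval,
      (G' =ᶠ[𝓝 ((s : ℝ) • q.1, q.2 s)] G) ∧ ∀ u v,
      fderiv ℝ G ((s : ℝ) • q.1, q.2 s) (u, G ((s : ℝ) • q.1, q.2 s) u) v =
        fderiv ℝ G ((s : ℝ) • q.1, q.2 s) (v, G ((s : ℝ) • q.1, q.2 s) v) u := by
    obtain ⟨δ, hδ, H⟩ := Metric.eventually_nhds_iff_ball.1 (hGG'.eventually_nhds.and hint)
    filter_upwards [Metric.ball_mem_nhds 0 hδ] with q hq s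
    refine H _ ?_
    rw [mem_ball_zero_iff] at hq ⊢
    have := (rayCurve P W q).norm_coe_le_norm s
    refine lt_of_le_of_lt ?_ hq
    refine norm_prod_le_iff.2 ⟨?_, (q.2.norm_coe_le_norm s).trans (norm_snd_le q)⟩
    rw [norm_smul, Real.norm_of_nonneg s.2.1]
    exact (mul_le_of_le_one_left (norm_nonneg _) s.2.2).trans (norm_fst_le q)
  have hcont : ContinuousAt (fun p : P × W => (p.1, w p)) 0 :=
    continuousAt_fst.prodMk hw.self_of_nhds.1.continuousAt
  have hev' := hcont.tendsto.eventually (p := fun q => ∀ s : unitInterval,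
      (G' =ᶠ[𝓝 ((s : ℝ) • q.1, q.2 s)] G) ∧ ∀ u v,
      fderiv ℝ G ((s : ℝ) • q.1, q.2 s) (u, G ((s : ℝ) • q.1, q.2 s) u) v =
        fderiv ℝ G ((s : ℝ) • q.1, q.2 s) (v, G ((s : ℝ) • q.1, q.2 s) v) u)
      (by simp only [Prod.fst_zero, hw0]; exact hev)
  let ev : C(unitInterval, W) →L[ℝ] W := ContinuousMap.evalCLM ℝ 1
  refine ⟨fun p => w p 1, ?_, ?_⟩
  · filter_upwards [hw.eventually_nhds, hev'] with p hp hq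
    refine ⟨ev.contDiff.contDiffAt.comp p hp.self_of_nhds.1, fun v => ?_⟩
    have h1 : fderiv ℝ (fun p => w p 1) p (v, 0) = fderiv ℝ w p (v, 0) 1 := by
      have := (ev.hasFDerivAt.comp p
        (hp.self_of_nhds.1.differentiableAt (by simp)).hasFDerivAt).fderiv
      simp only [Function.comp_def] at this
      exact congrArg (fun A => A (v, 0)) this
    rw [h1, fderiv_rayCurve_eq_of_integrable hG' hg (fun _ => rfl) hp]
    · have := (hq 1).1.eq_of_nhds
      simp only [Set.Icc.coe_one, one_smul] at this
      rw [this]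
    · intro s u v
      rw [(hq s).1.fderiv_eq, (hq s).1.eq_of_nhds]
      exact (hq s).2 u v
  · have : Tendsto (fun y : W => ((0 : P), y)) (𝓝 0) (𝓝 0) :=
      (Continuous.prodMk_right (0 : P)).tendsto' 0 _ rfl
    filter_upwards [this.eventually hw] with y hy
    have h2 := congrArg (fun A => A 1) hy.2
    have h3 : superpose unitInterval ⟨g, hg.continuous⟩ (rayCurve P W (0, w (0, y))) = 0 := by
      ext t; simp [g]
    simp only [h3, map_zero, add_zero, constCurve_apply] at h2
    exact h2

end LeafwiseIntegration
end FolBundle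

end

noncomputable section

namespace FolBundle

/-! ### Straightening diffeomorphisms, alone and over a base. -/

section Straightening

/-- The inverse function theorem, with smoothness of the local inverse on its domain. -/
theorem exists_smooth_openPartialHomeomorph {X Y : Type*} [NormedAddCommGroup X] [NormedSpace ℝ X]
    [NormedAddCommGroup Y] [NormedSpace ℝ Y] [CompleteSpace X] {f : X → Y} {x₀ : X}
    (h : ∀ᶠ x in 𝓝 x₀, ContDiffAt ℝ ∞ f x) (hinv : (fderiv ℝ f x₀).IsInvertible) :
    ∃ e : OpenPartialHomeomorph X Y, x₀ ∈ e.source ∧ (∀ x, e x = f x) ∧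
      (∀ x ∈ e.source, ContDiffAt ℝ ∞ f x) ∧ ContDiffOn ℝ ∞ e.symm e.target := by
  have hn : (∞ : WithTop ℕ∞) ≠ 0 := by simp
  have h0 := h.self_of_nhds
  obtain ⟨A, hA⟩ := hinv
  have hA' : HasFDerivAt f (A : X →L[ℝ] Y) x₀ := by
    rw [hA]; exact (h0.differentiableAt hn).hasFDerivAt
  have hdc : ContinuousAt (fderiv ℝ f) x₀ :=
    (h0.fderiv_right (m := 0) (by simp)).continuousAt
  have hinv' : ∀ᶠ x in 𝓝 x₀, (fderiv ℝ f x).IsInvertible :=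
    hdc.eventually_mem (isOpen_setOf_isInvertible.mem_nhds ⟨A, hA⟩)
  obtain ⟨s, hs, hso, hxs⟩ := eventually_nhds_iff.1 (h.and hinv')
  -- Restriction to the points where `f` is smooth with invertible derivative makes the inverse
  -- smooth on its entire domain, not only at `f x₀`.
  let e := (h0.toOpenPartialHomeomorph f hA' hn).restrOpen s hso
  have hes : e.source ⊆ s := fun x hx => hx.2
  have hef : ∀ x, e x = f x := fun x => rfl
  refine ⟨e, ⟨h0.mem_toOpenPartialHomeomorph_source hA' hn, hxs⟩, hef, fun x hx => (hs x (hes hx)).1,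
    fun y hy => ?_⟩
  have hx : e.symm y ∈ e.source := e.map_target hy
  obtain ⟨A', hA'⟩ := (hs _ (hes hx)).2
  refine (e.contDiffAt_symm (f₀' := A') hy ?_ (hs _ (hes hx)).1).contDiffWithinAt
  rw [hA']
  exact ((hs _ (hes hx)).1.differentiableAt hn).hasFDerivAt

variable {P Q R : Type} [NormedAddCommGroup P] [NormedSpace ℝ P]
  [NormedAddCommGroup Q] [NormedSpace ℝ Q] [NormedAddCommGroup R] [NormedSpace ℝ R]

/-- A family of solutions of `∂_u w = G(u, w)` parametrised by the initial values is a local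
straightening diffeomorphism. -/
theorem exists_straightening {W : Type} [NormedAddCommGroup W] [NormedSpace ℝ W]
    [FiniteDimensional ℝ P] [FiniteDimensional ℝ W] {w : P × W → W} {L : P × W → P →L[ℝ] W}
    (hw : ∀ᶠ p in 𝓝 0, ContDiffAt ℝ ∞ w p ∧ ∀ v, fderiv ℝ w p (v, 0) = L p v)
    (h0 : ∀ᶠ y in 𝓝 0, w (0, y) = y) :
    ∃ e : OpenPartialHomeomorph (P × W) (P × W), 0 ∈ e.source ∧ e 0 = 0 ∧
      (∀ p, e p = (p.1, w p)) ∧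
      ContDiffOn ℝ ∞ e e.source ∧ ContDiffOn ℝ ∞ e.symm e.target ∧
      ∀ p ∈ e.source, ∀ v, fderiv ℝ e p (v, 0) = (v, L p v) := by
  obtain ⟨s, hs, hso, h0s⟩ := eventually_nhds_iff.1 hw
  have hd : ∀ p, ContDiffAt ℝ ∞ w p →
      HasFDerivAt (fun p : P × W => (p.1, w p)) ((ContinuousLinearMap.fst ℝ P W).prod (fderiv ℝ w p)) p :=
    fun p hp => hasFDerivAt_fst.prodMk (hp.differentiableAt (by simp)).hasFDerivAt
  have hy : ∀ y, fderiv ℝ w 0 (0, y) = y := by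
    have h1 : HasFDerivAt (fun y : W => w (0, y)) ((fderiv ℝ w 0).comp (.inr ℝ P W)) 0 :=
      ((hs 0 h0s).1.differentiableAt (by simp)).hasFDerivAt.comp (0 : W)
        (hasFDerivAt_prodMk_right (0 : P) (0 : W))
    have h2 : HasFDerivAt (fun y : W => w (0, y)) (.id ℝ W) 0 :=
      (hasFDerivAt_id _).congr_of_eventuallyEq h0
    intro y
    exact congrArg (fun A => A y) (h1.unique h2)
  have hinv : (fderiv ℝ (fun p : P × W => (p.1, w p)) 0).IsInvertible := by
    -- The derivative at `0` is block triangular with identities on the diagonal, because `w(0, y) =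
    -- y`.
    refine ⟨ContinuousLinearEquiv.skewProd (.refl ℝ P) (.refl ℝ W)
      ((fderiv ℝ w 0).comp (.inl ℝ P W)), ?_⟩
    rw [(hd 0 (hs 0 h0s).1).fderiv]
    ext1
    · ext1; simp
    · ext1; simp [hy]
  obtain ⟨e, he0, hef, hes, hei⟩ := exists_smooth_openPartialHomeomorph
    (f := fun p : P × W => (p.1, w p)) (x₀ := 0)
    (by filter_upwards [hw] with p hp; exact contDiffAt_fst.prodMk hp.1) hinv
  let e' := e.restrOpen s hso
  have hef' : ∀ p, e' p = (p.1, w p) := hef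
  refine ⟨e', ⟨he0, h0s⟩, ?_, hef', fun p hp => ?_, hei.mono fun p hp => hp.1, fun p hp v => ?_⟩
  · rw [hef']
    simp only [Prod.fst_zero]
    rw [show (0 : P × W) = (0, 0) from rfl, h0.self_of_nhds]
  · exact ((hes p hp.1).congr_of_eventuallyEq (.of_forall hef')).contDiffWithinAt
  · rw [show (e' : P × W → P × W) = fun p : P × W => (p.1, w p) from funext hef',
      (hd p (hs p hp.2).1).fderiv]
    simp [(hs p hp.2).2 v]

/-- In a triangular system, the first component of the solution does not depend on the second
component of the initial value. -/
theorem fst_leafwise_integral_eq {G : P × Q × R → P →L[ℝ] Q × R}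
    (hG : ContDiffAt ℝ ∞ G 0)
    (htri : ∀ᶠ z in 𝓝 0, ∀ v, (G z v).1 = (G (z.1, z.2.1, 0) v).1) {w : P × Q × R → Q × R}
    (hw : ∀ᶠ p in 𝓝 0, ContDiffAt ℝ ∞ w p ∧ ∀ v, fderiv ℝ w p (v, 0) = G (p.1, w p) v)
    (h0 : ∀ᶠ y in 𝓝 0, w (0, y) = y) :
    ∀ᶠ p in 𝓝 0, (w p).1 = (w (p.1, p.2.1, 0)).1 := by
  -- By triangularity the `Q`-component of the solution satisfies a closed equation with right-hand
  -- side `H` along each ray `t ↦ (t u, y, r)`. The solutions for `r` and for `0` in the last slot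
  -- start at the same `Q`-value `y`, and uniqueness makes them agree.
  let H : P × Q → P →L[ℝ] Q := fun z => (ContinuousLinearMap.fst ℝ Q R).comp (G (z.1, z.2, 0))
  have hH : ContDiffAt ℝ 1 H 0 := by
    have h1 : ContDiffAt ℝ ∞ (fun z : P × Q => G (z.1, z.2, 0)) 0 :=
      ContDiffAt.comp (0 : P × Q) (g := G) (f := fun z : P × Q => (z.1, z.2, (0 : R))) hG
        (by fun_prop)
    exact (contDiffAt_const.clm_comp h1).of_le (by simp)
  obtain ⟨K, T, hT, hLip⟩ := hH.exists_lipschitzOnWith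
  obtain ⟨δ, hδ, hδT⟩ := Metric.mem_nhds_iff.1 hT
  have hw0 : w 0 = 0 := h0.self_of_nhds
  have hwc : ContinuousAt w 0 := hw.self_of_nhds.1.continuousAt
  have htri' : ∀ᶠ p in 𝓝 (0 : P × Q × R), ∀ v,
      (G (p.1, w p) v).1 = (G (p.1, (w p).1, 0) v).1 := by
    have : Tendsto (fun p : P × Q × R => (p.1, w p)) (𝓝 0) (𝓝 0) := by
      have := (continuousAt_fst (p := (0 : P × Q × R))).prodMk hwc
      rw [ContinuousAt, hw0] at this
      exact this
    exact this.eventually htri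
  have hsmall : ∀ᶠ p in 𝓝 (0 : P × Q × R), w p ∈ Metric.ball (0 : Q × R) δ :=
    hwc.eventually_mem (by rw [hw0]; exact Metric.ball_mem_nhds _ hδ)
  have h0' : ∀ᶠ p : P × Q × R in 𝓝 0, w (0, p.2) = p.2 :=
    (continuous_snd.tendsto' (0 : P × Q × R) 0 rfl).eventually h0
  obtain ⟨ε, hε, hball⟩ := Metric.eventually_nhds_iff_ball.1
    (hw.and (htri'.and (hsmall.and h0')))
  filter_upwards [Metric.ball_mem_nhds 0 hε, Metric.ball_mem_nhds 0 hδ] with p hp hpδ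
  rw [mem_ball_zero_iff] at hp hpδ
  have hray : ∀ r : R, ‖r‖ ≤ ‖p‖ → ∀ t ∈ Icc (0 : ℝ) 1,
      ((t • p.1, p.2.1, r) : P × Q × R) ∈ Metric.ball (0 : P × Q × R) ε := by
    intro r hr t ht
    rw [mem_ball_zero_iff]
    refine lt_of_le_of_lt ?_ hp
    refine norm_prod_le_iff.2 ⟨?_, norm_prod_le_iff.2
      ⟨(norm_fst_le p.2).trans (norm_snd_le p), hr⟩⟩
    rw [norm_smul, Real.norm_of_nonneg ht.1]
    exact (mul_le_of_le_one_left (norm_nonneg _) ht.2).trans (norm_fst_le p)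
  have hder : ∀ r : R, ‖r‖ ≤ ‖p‖ → ∀ t ∈ Icc (0 : ℝ) 1,
      HasDerivAt (fun t : ℝ => (w (t • p.1, p.2.1, r)).1)
        (H (t • p.1, (w (t • p.1, p.2.1, r)).1) p.1) t := by
    intro r hr t ht
    obtain ⟨⟨h1, h2⟩, h3, -, -⟩ := hball _ (hray r hr t ht)
    have h4 : HasDerivAt (fun t : ℝ => ((t • p.1, p.2.1, r) : P × Q × R)) (p.1, 0) t := by
      simpa using ((hasDerivAt_id t).smul_const p.1).prodMk (hasDerivAt_const t (p.2.1, r))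
    have h5 := (h1.differentiableAt (by simp)).hasFDerivAt.comp_hasDerivAt t h4
    rw [h2] at h5
    refine ((ContinuousLinearMap.fst ℝ Q R).hasFDerivAt.comp_hasDerivAt t h5).congr_deriv ?_
    exact h3 _
  have hmem : ∀ r : R, ‖r‖ ≤ ‖p‖ → ∀ t ∈ Icc (0 : ℝ) 1,
      (w (t • p.1, p.2.1, r)).1 ∈ Metric.ball (0 : Q) δ := by
    intro r hr t ht
    have h1 := (hball _ (hray r hr t ht)).2.2.1
    rw [mem_ball_zero_iff] at h1 ⊢
    exact (norm_fst_le _).trans_lt h1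
  have hLip' : ∀ t ∈ Ico (0 : ℝ) 1, LipschitzOnWith (K * ‖p.1‖₊)
      (fun x : Q => H (t • p.1, x) p.1) (Metric.ball 0 δ) := by
    intro t ht
    have hb : ∀ x ∈ Metric.ball (0 : Q) δ, (t • p.1, x) ∈ T := by
      intro x hx
      refine hδT ?_
      rw [mem_ball_zero_iff] at hx ⊢
      refine (norm_prod_le_iff.2 ⟨le_max_left _ _, le_max_right _ _⟩).trans_lt (max_lt ?_ hx)
      rw [norm_smul, Real.norm_of_nonneg ht.1]
      exact ((mul_le_of_le_one_left (norm_nonneg _) ht.2.le).trans (norm_fst_le p)).trans_lt hpδ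
    refine LipschitzOnWith.of_dist_le_mul fun x hx y hy => ?_
    have h1 := hLip.dist_le_mul _ (hb x hx) _ (hb y hy)
    rw [dist_eq_norm, ← sub_apply]
    refine ((H (t • p.1, x) - H (t • p.1, y)).le_opNorm p.1).trans ?_
    rw [dist_eq_norm] at h1
    have h2 : dist (t • p.1, x) (t • p.1, y) = dist x y := by simp [Prod.dist_eq]
    rw [h2] at h1
    calc _ ≤ (K * dist x y) * ‖p.1‖ := by gcongr
      _ = _ := by push_cast; ring
  have hp2 : ‖p.2.2‖ ≤ ‖p‖ := (norm_snd_le p.2).trans (norm_snd_le p)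
  have hz2 : ‖(0 : R)‖ ≤ ‖p‖ := by simp
  have h1 : (1 : ℝ) ∈ Icc (0 : ℝ) 1 := by simp
  have h00 : (0 : ℝ) ∈ Icc (0 : ℝ) 1 := by simp
  have key := ODE_solution_unique_of_mem_Icc_right (s := fun _ => Metric.ball (0 : Q) δ) hLip'
    (fun t ht => (hder _ hp2 t ht).continuousAt.continuousWithinAt)
    (fun t ht => (hder _ hp2 t (Ico_subset_Icc_self ht)).hasDerivWithinAt)
    (fun t ht => hmem _ hp2 t (Ico_subset_Icc_self ht))
    (fun t ht => (hder _ hz2 t ht).continuousAt.continuousWithinAt)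
    (fun t ht => (hder _ hz2 t (Ico_subset_Icc_self ht)).hasDerivWithinAt)
    (fun t ht => hmem _ hz2 t (Ico_subset_Icc_self ht))
    (by
      have e1 := (hball _ (hray _ hp2 0 h00)).2.2.2
      have e2 := (hball _ (hray _ hz2 0 h00)).2.2.2
      simp only [zero_smul] at e1 e2 ⊢
      rw [e1, e2]) h1
  simpa using key

/-- Simultaneous straightening of the foliations given by a triangular completely integrable
system. -/
theorem exists_foliated_straightening [FiniteDimensional ℝ P] [FiniteDimensional ℝ Q]
    [FiniteDimensional ℝ R] {G : P × Q × R → P →L[ℝ] Q × R}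
    (hG : ∀ᶠ z in 𝓝 0, ContDiffAt ℝ ∞ G z)
    (hint : ∀ᶠ z in 𝓝 0, ∀ u v,
      fderiv ℝ G z (u, G z u) v = fderiv ℝ G z (v, G z v) u)
    (htri : ∀ᶠ z in 𝓝 0, ∀ v, (G z v).1 = (G (z.1, z.2.1, 0) v).1) :
    ∃ (b : OpenPartialHomeomorph (P × Q) (P × Q))
      (c : OpenPartialHomeomorph (P × Q × R) (P × Q × R)),
      (0 ∈ b.source ∧ b 0 = 0 ∧ ContDiffOn ℝ ∞ b b.source ∧ ContDiffOn ℝ ∞ b.symm b.target ∧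
        ∀ p ∈ b.source, ∀ v, fderiv ℝ b p (v, 0) = (v, (G ((b p).1, (b p).2, 0) v).1)) ∧
      (0 ∈ c.source ∧ c 0 = 0 ∧ ContDiffOn ℝ ∞ c c.source ∧ ContDiffOn ℝ ∞ c.symm c.target ∧
        ∀ p ∈ c.source, ∀ v, fderiv ℝ c p (v, 0) = (v, G (c p) v)) ∧
      ∀ p ∈ c.source, (p.1, p.2.1) ∈ b.source ∧ b (p.1, p.2.1) = ((c p).1, (c p).2.1) := by
  obtain ⟨w, hw, h0⟩ := exists_leafwise_integral hG hint
  have hfst := fst_leafwise_integral_eq hG.self_of_nhds htri hw h0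
  have hw0 : w 0 = 0 := h0.self_of_nhds
  obtain ⟨c, hc0, hc00, hcw, hcs, hci, hcd⟩ := exists_straightening hw h0
  have hincl : Tendsto (fun p : P × Q => ((p.1, p.2, 0) : P × Q × R)) (𝓝 0) (𝓝 0) :=
    Continuous.tendsto' (by fun_prop) 0 _ rfl
  have htri' : ∀ᶠ p in 𝓝 (0 : P × Q × R), ∀ v,
      (G (p.1, w p) v).1 = (G (p.1, (w p).1, 0) v).1 := by
    have : Tendsto (fun p : P × Q × R => (p.1, w p)) (𝓝 0) (𝓝 0) := by
      have := (continuousAt_fst (p := (0 : P × Q × R))).prodMk hw.self_of_nhds.1.continuousAt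
      rw [ContinuousAt, hw0] at this
      exact this
    exact this.eventually htri
  -- The base map is the `Q`-component of the same `w` with last slot `0`. It solves the base
  -- equation by triangularity, so the base needs no integrability condition of its own, and the two
  -- straightenings are compatible with the projection.
  have hwb : ∀ᶠ p in 𝓝 (0 : P × Q), ContDiffAt ℝ ∞ (fun p : P × Q => (w (p.1, p.2, 0)).1) p ∧
      ∀ v, fderiv ℝ (fun p : P × Q => (w (p.1, p.2, 0)).1) p (v, 0) =
        ((ContinuousLinearMap.fst ℝ Q R).comp (G (p.1, (w (p.1, p.2, 0)).1, 0))) v := by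
    filter_upwards [hincl.eventually hw, hincl.eventually htri'] with p hp hp'
    have hin : HasFDerivAt (fun p : P × Q => ((p.1, p.2, 0) : P × Q × R))
        ((ContinuousLinearMap.fst ℝ P Q).prod ((ContinuousLinearMap.snd ℝ P Q).prod 0)) p :=
      hasFDerivAt_fst.prodMk (hasFDerivAt_snd.prodMk (hasFDerivAt_const 0 p))
    refine ⟨contDiffAt_fst.comp p (hp.1.comp p (by fun_prop)), fun v => ?_⟩
    have h1 := ((ContinuousLinearMap.fst ℝ Q R).hasFDerivAt.comp p
      ((hp.1.differentiableAt (by simp)).hasFDerivAt.comp p hin)).fderiv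
    simp only [Function.comp_def, ContinuousLinearMap.coe_fst'] at h1
    rw [h1]
    simp only [ContinuousLinearMap.comp_apply, ContinuousLinearMap.prod_apply,
      ContinuousLinearMap.coe_fst', ContinuousLinearMap.coe_snd', zero_apply]
    have h2 := hp.2 v
    rw [show ((v, 0, 0) : P × Q × R) = (v, 0) from rfl, h2, hp' v]
  have h0b : ∀ᶠ y in 𝓝 (0 : Q), (w (0, y, 0)).1 = y := by
    have : Tendsto (fun y : Q => ((y, 0) : Q × R)) (𝓝 0) (𝓝 0) :=
      Continuous.tendsto' (by fun_prop) 0 _ rfl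
    filter_upwards [this.eventually h0] with y hy
    rw [hy]
  obtain ⟨b, hb0, hb00, hbw, hbs, hbi, hbd⟩ := exists_straightening hwb h0b
  have hproj : Tendsto (fun p : P × Q × R => (p.1, p.2.1)) (𝓝 0) (𝓝 0) :=
    Continuous.tendsto' (by fun_prop) 0 _ rfl
  obtain ⟨s, hs, hso, h0s⟩ := eventually_nhds_iff.1
    ((hproj.eventually (b.open_source.mem_nhds hb0)).and hfst)
  refine ⟨b, c.restrOpen s hso, ⟨hb0, hb00, hbs, hbi, fun p hp v => ?_⟩,
    ⟨⟨hc0, h0s⟩, hc00, hcs.mono fun p hp => hp.1, hci.mono fun p hp => hp.1, fun p hp v => ?_⟩,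
    fun p hp => ⟨(hs p hp.2).1, ?_⟩⟩
  · rw [hbd p hp v, hbw p]; rfl
  · have := hcd p hp.1 v
    rw [← hcw p] at this
    exact this
  · change b (p.1, p.2.1) = ((c p).1, (c p).2.1)
    rw [hbw, hcw, (hs p hp.2).2]

end Straightening
end FolBundle

end

noncomputable section

namespace FolBundle

/-! ### Vector space valued charts and straightened distributions. -/

section SmoothCharts

variable {E X V W : Type*} [NormedAddCommGroup E] [NormedSpace ℝ E] [TopologicalSpace X]
  [ChartedSpace E X] [NormedAddCommGroup V] [NormedSpace ℝ V] [NormedAddCommGroup W]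
  [NormedSpace ℝ W]

/-- A vector space valued partial homeomorphism that is smooth in both directions. -/
structure IsSmoothChart (E : Type*) {X V : Type*} [NormedAddCommGroup E] [NormedSpace ℝ E]
    [TopologicalSpace X] [ChartedSpace E X] [NormedAddCommGroup V] [NormedSpace ℝ V]
    (e : OpenPartialHomeomorph X V) : Prop where
  smooth : ContMDiffOn 𝓘(ℝ, E) 𝓘(ℝ, V) ∞ e e.source
  smooth_symm : ContMDiffOn 𝓘(ℝ, V) 𝓘(ℝ, E) ∞ e.symm e.target

namespace IsSmoothChart

theorem chartAt [IsManifold 𝓘(ℝ, E) ∞ X] (x : X) : IsSmoothChart E (chartAt E x) :=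
  ⟨contMDiffOn_chart, contMDiffOn_chart_symm⟩

variable {e : OpenPartialHomeomorph X V}

theorem mdifferentiable (he : IsSmoothChart E e) : e.MDifferentiable 𝓘(ℝ, E) 𝓘(ℝ, V) :=
  ⟨he.smooth.mdifferentiableOn (by simp), he.smooth_symm.mdifferentiableOn (by simp)⟩

theorem contMDiffAt (he : IsSmoothChart E e) {x : X} (hx : x ∈ e.source) :
    ContMDiffAt 𝓘(ℝ, E) 𝓘(ℝ, V) ∞ e x :=
  he.smooth.contMDiffAt (e.open_source.mem_nhds hx)

theorem contMDiffAt_symm (he : IsSmoothChart E e) {y : V} (hy : y ∈ e.target) :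
    ContMDiffAt 𝓘(ℝ, V) 𝓘(ℝ, E) ∞ e.symm y :=
  he.smooth_symm.contMDiffAt (e.open_target.mem_nhds hy)

theorem trans (he : IsSmoothChart E e) {c : OpenPartialHomeomorph V W}
    (hc : ContDiffOn ℝ ∞ c c.source) (hc' : ContDiffOn ℝ ∞ c.symm c.target) :
    IsSmoothChart E (e.trans c) where
  smooth := hc.contMDiffOn.comp (he.smooth.mono fun _ hx => hx.1) fun _ hx => hx.2
  smooth_symm := he.smooth_symm.comp (hc'.contMDiffOn.mono fun _ hx => hx.1) fun _ hx => hx.2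

theorem restrOpen (he : IsSmoothChart E e) {s : Set X} (hs : IsOpen s) :
    IsSmoothChart E (e.restrOpen s hs) where
  smooth := he.smooth.mono fun _ hx => hx.1
  smooth_symm := he.smooth_symm.mono fun _ hx => hx.1

theorem mfderiv_symm_apply (he : IsSmoothChart E e) {x : X} (hx : x ∈ e.source)
    (ξ : TangentSpace 𝓘(ℝ, E) x) :
    mfderiv 𝓘(ℝ, V) 𝓘(ℝ, E) e.symm (e x) (mfderiv 𝓘(ℝ, E) 𝓘(ℝ, V) e x ξ) = ξ :=
  congrArg (fun A => A ξ) (he.mdifferentiable.symm_comp_deriv hx)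

theorem mfderiv_apply_symm (he : IsSmoothChart E e) {y : V} (hy : y ∈ e.target) (ξ : V) :
    mfderiv 𝓘(ℝ, E) 𝓘(ℝ, V) e (e.symm y) (mfderiv 𝓘(ℝ, V) 𝓘(ℝ, E) e.symm y ξ) = ξ :=
  congrArg (fun A => A ξ) (he.mdifferentiable.comp_symm_deriv hy)

theorem isInvertible_mfderiv_symm (he : IsSmoothChart E e) {y : V} (hy : y ∈ e.target) :
    (mfderiv 𝓘(ℝ, V) 𝓘(ℝ, E) e.symm y).IsInvertible :=
  ⟨he.mdifferentiable.symm.mfderiv (x := y) hy, rfl⟩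

theorem isInvertible_mfderiv (he : IsSmoothChart E e) {x : X} (hx : x ∈ e.source) :
    (mfderiv 𝓘(ℝ, E) 𝓘(ℝ, V) e x).IsInvertible :=
  ⟨he.mdifferentiable.mfderiv hx, rfl⟩

end IsSmoothChart

variable {P : Type*} [NormedAddCommGroup P] [NormedSpace ℝ P]

/-- A chart in which a distribution is the graph of `L` becomes, after straightening, a chart in
which the distribution is the kernel of the differential of the second component. -/
theorem eq_ker_mfderiv_of_straightening {e : OpenPartialHomeomorph X (P × W)}
    (he : IsSmoothChart E e) {D : ∀ x : X, Submodule ℝ (TangentSpace 𝓘(ℝ, E) x)}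
    {L : P × W → P →L[ℝ] W} {c : OpenPartialHomeomorph (P × W) (P × W)}
    (hcs : ContDiffOn ℝ ∞ c c.source) (hci : ContDiffOn ℝ ∞ c.symm c.target)
    (hcd : ∀ p ∈ c.source, ∀ v, fderiv ℝ c p (v, 0) = (v, L (c p) v))
    {x : X} (hx : x ∈ (e.trans c.symm).source)
    (hD : ∀ v η, mfderiv 𝓘(ℝ, P × W) 𝓘(ℝ, E) e.symm (e x) (v, η) ∈ D (e.symm (e x)) ↔
      η = L (e x) v) :
    D x = (mfderiv 𝓘(ℝ, E) 𝓘(ℝ, W) (fun z => (e.trans c.symm z).2) x).toLinearMap.ker := by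
  have hx1 : x ∈ e.source := hx.1
  have hx2 : e x ∈ c.target := hx.2
  have hc : IsSmoothChart (P × W) c := ⟨hcs.contMDiffOn, hci.contMDiffOn⟩
  set p := c.symm (e x) with hp
  have hps : p ∈ c.source := c.map_target hx2
  have hcp : c p = e x := c.right_inv hx2
  have hfc : ∀ ξ : P × W, mfderiv 𝓘(ℝ, P × W) 𝓘(ℝ, P × W) c p ξ = fderiv ℝ c p ξ := by
    intro ξ; rw [mfderiv_eq_fderiv]; rfl
  have hT : mfderiv 𝓘(ℝ, E) 𝓘(ℝ, W) (fun z => (e.trans c.symm z).2) x =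
      (ContinuousLinearMap.snd ℝ P W).comp ((mfderiv 𝓘(ℝ, P × W) 𝓘(ℝ, P × W) c.symm (e x)).comp
        (mfderiv 𝓘(ℝ, E) 𝓘(ℝ, P × W) e x)) := by
    have h1 : HasMFDerivAt 𝓘(ℝ, E) 𝓘(ℝ, P × W) e x _ :=
      (he.mdifferentiable.mdifferentiableAt hx1).hasMFDerivAt
    have h2 : HasMFDerivAt 𝓘(ℝ, P × W) 𝓘(ℝ, P × W) c.symm (e x) _ :=
      (hc.mdifferentiable.mdifferentiableAt_symm hx2).hasMFDerivAt
    have h3 : HasMFDerivAt 𝓘(ℝ, P × W) 𝓘(ℝ, W) Prod.snd (c.symm (e x))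
        (ContinuousLinearMap.snd ℝ P W) := (hasFDerivAt_snd (𝕜 := ℝ)).hasMFDerivAt
    exact (h3.comp x (h2.comp x h1)).mfderiv
  ext ξ
  rw [LinearMap.mem_ker]
  change _ ↔ mfderiv 𝓘(ℝ, E) 𝓘(ℝ, W) (fun z => (e.trans c.symm z).2) x ξ = 0
  rw [hT]
  obtain ⟨⟨v, η⟩, hvη⟩ : ∃ q : P × W, mfderiv 𝓘(ℝ, E) 𝓘(ℝ, P × W) e x ξ = q := ⟨_, rfl⟩
  have hξ : mfderiv 𝓘(ℝ, P × W) 𝓘(ℝ, E) e.symm (e x) (v, η) = ξ := by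
    rw [← hvη]; exact he.mfderiv_symm_apply hx1 ξ
  have hiff : ξ ∈ D x ↔ η = L (e x) v := by
    rw [← hD v η, hξ, e.left_inv hx1]
  rw [hiff]
  change _ ↔ (mfderiv 𝓘(ℝ, P × W) 𝓘(ℝ, P × W) c.symm (e x)
    (mfderiv 𝓘(ℝ, E) 𝓘(ℝ, P × W) e x ξ)).2 = 0
  rw [hvη]
  obtain ⟨⟨v', η'⟩, hv'⟩ : ∃ q : P × W, mfderiv 𝓘(ℝ, P × W) 𝓘(ℝ, P × W) c.symm (e x) (v, η) = q :=
    ⟨_, rfl⟩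
  have h4 : mfderiv 𝓘(ℝ, P × W) 𝓘(ℝ, P × W) c p (v', η') = (v, η) := by
    rw [← hv']; exact hc.mfderiv_apply_symm hx2 (v, η)
  rw [hfc] at h4
  rw [hv']
  -- The differential of `c` maps the plane of vectors `(u, 0)` onto the graph of `L`. Its inverse
  -- therefore maps the graph onto that plane, the kernel of the second projection.
  have h5 : ∀ u, fderiv ℝ c p (u, 0) = (u, L (e x) u) := fun u => by rw [hcd p hps u, hcp]
  constructor
  · rintro rfl
    have h6 : mfderiv 𝓘(ℝ, P × W) 𝓘(ℝ, P × W) c.symm (e x) (v, L (e x) v) = (v, 0) := by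
      rw [← h5 v, ← hfc, ← hcp]
      exact hc.mfderiv_symm_apply hps (v, 0)
    rw [h6] at hv'
    exact (congrArg Prod.snd hv').symm
  · intro h
    change η' = 0 at h
    rw [h, h5] at h4
    have h7 := congrArg Prod.fst h4
    have h8 := congrArg Prod.snd h4
    simp only at h7 h8
    rw [← h8, h7]

end SmoothCharts
end FolBundle

end

noncomputable section

namespace FolBundle

/-! ### Distributions as graphs, and the integrability condition. -/

section LocalGraph

variable {E X V W : Type*} [NormedAddCommGroup E] [NormedSpace ℝ E] [TopologicalSpace X]
  [ChartedSpace E X] [NormedAddCommGroup V] [NormedSpace ℝ V] [NormedAddCommGroup W]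
  [NormedSpace ℝ W]

namespace IsSmoothChart

variable {e : OpenPartialHomeomorph X V}

/-- Pullbacks of vector fields are defined with the formal inverse of a differential; for a chart
this is the differential of the opposite map, which can be computed with. -/
theorem inverse_mfderiv_symm (he : IsSmoothChart E e) {y : V} (hy : y ∈ e.target)
    (ξ : TangentSpace 𝓘(ℝ, E) (e.symm y)) :
    (mfderiv 𝓘(ℝ, V) 𝓘(ℝ, E) e.symm y).inverse ξ = mfderiv 𝓘(ℝ, E) 𝓘(ℝ, V) e (e.symm y) ξ := by
  obtain ⟨A, hA⟩ := he.isInvertible_mfderiv_symm hy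
  rw [← hA, ContinuousLinearMap.inverse_equiv]
  have h : mfderiv 𝓘(ℝ, V) 𝓘(ℝ, E) e.symm y (mfderiv 𝓘(ℝ, E) 𝓘(ℝ, V) e (e.symm y) ξ) = ξ := by
    have := he.mfderiv_symm_apply (e.map_target hy) ξ
    rwa [e.right_inv hy] at this
  rw [← hA] at h
  exact (A.symm_apply_eq).2 h.symm

theorem inverse_mfderiv (he : IsSmoothChart E e) {x : X} (hx : x ∈ e.source) (ξ : V) :
    (mfderiv 𝓘(ℝ, E) 𝓘(ℝ, V) e x).inverse ξ = mfderiv 𝓘(ℝ, V) 𝓘(ℝ, E) e.symm (e x) ξ := by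
  obtain ⟨A, hA⟩ := he.isInvertible_mfderiv hx
  rw [← hA, ContinuousLinearMap.inverse_equiv]
  have h : mfderiv 𝓘(ℝ, E) 𝓘(ℝ, V) e x (mfderiv 𝓘(ℝ, V) 𝓘(ℝ, E) e.symm (e x) ξ) = ξ := by
    have := he.mfderiv_apply_symm (e.map_source hx) ξ
    rwa [e.left_inv hx] at this
  rw [← hA] at h
  exact (A.symm_apply_eq).2 h.symm

/-- A smooth vector field has smooth components in a smooth chart. -/
theorem contDiffAt_pullback_field [FiniteDimensional ℝ V] [FiniteDimensional ℝ E]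
    [IsManifold 𝓘(ℝ, E) ∞ X]
    (he : IsSmoothChart E e) {U : Set X} (hU : IsOpen U) {Y : ∀ x : X, TangentSpace 𝓘(ℝ, E) x}
    (hY : IsSmoothFieldOn Y U) {y : V} (hy : y ∈ e.target) (hyU : e.symm y ∈ U) :
    ContDiffAt ℝ ∞ (VectorField.mpullback 𝓘(ℝ, V) 𝓘(ℝ, E) e.symm Y : V → V) y := by
  have : IsManifold 𝓘(ℝ, E) 1 X := IsManifold.of_le (n := ∞) (by simp)
  have h1 := ContMDiffAt.mpullback_vectorField_preimage (n := ∞) (m := ∞)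
    (hY.contMDiffAt (hU.mem_nhds hyU)) (he.contMDiffAt_symm hy) (he.isInvertible_mfderiv_symm hy)
    le_rfl
  exact contMDiffAt_vectorSpace_iff_contDiffAt.1 h1

/-- A smooth vector field on the model yields a smooth vector field on the chart domain. -/
theorem isSmoothFieldOn_mpullback [FiniteDimensional ℝ V] [FiniteDimensional ℝ E]
    [IsManifold 𝓘(ℝ, E) ∞ X] (he : IsSmoothChart E e) {Z : V → V} {U : Set X}
    (hU : U ⊆ e.source) (hZ : ∀ x ∈ U, ContDiffAt ℝ ∞ Z (e x)) :
    IsSmoothFieldOn (VectorField.mpullback 𝓘(ℝ, E) 𝓘(ℝ, V) e Z) U := by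
  have : IsManifold 𝓘(ℝ, E) 1 X := IsManifold.of_le (n := ∞) (by simp)
  intro x hx
  refine (ContMDiffAt.mpullback_vectorField_preimage (n := ∞) (m := ∞)
    (contMDiffAt_vectorSpace_iff_contDiffAt.2 (hZ x hx)) (he.contMDiffAt (hU hx))
    (he.isInvertible_mfderiv (hU hx)) le_rfl).contMDiffWithinAt

end IsSmoothChart

variable {P : Type*} [NormedAddCommGroup P] [NormedSpace ℝ P]

/-- A subbundle whose fibre at a point is transverse to the second factor of a chart is near that
point the graph of a smooth family of linear maps. -/
theorem IsSubbundle.exists_graph [FiniteDimensional ℝ E] [FiniteDimensional ℝ P]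
    [FiniteDimensional ℝ W] [IsManifold 𝓘(ℝ, E) ∞ X]
    {D : ∀ x : X, Submodule ℝ (TangentSpace 𝓘(ℝ, E) x)} (hD : IsSubbundle D)
    {e : OpenPartialHomeomorph X (P × W)} (he : IsSmoothChart E e) {x₀ : X} (hx₀ : x₀ ∈ e.source)
    (ht : ∀ v, ∃! η, mfderiv 𝓘(ℝ, P × W) 𝓘(ℝ, E) e.symm (e x₀) (v, η) ∈ D (e.symm (e x₀))) :
    ∃ G : P × W → P →L[ℝ] W, ∀ᶠ z in 𝓝 (e x₀), ContDiffAt ℝ ∞ G z ∧ ∀ v η,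
      mfderiv 𝓘(ℝ, P × W) 𝓘(ℝ, E) e.symm z (v, η) ∈ D (e.symm z) ↔ η = G z v := by
  obtain ⟨U, hU, hx₀U, n, Y, hY, hspan⟩ := hD x₀
  set y : Fin n → P × W → P × W := fun i =>
    VectorField.mpullback 𝓘(ℝ, P × W) 𝓘(ℝ, E) e.symm (Y i) with hy
  -- `A z` combines the frame fields, read in the chart, with given coefficients; its range is the
  -- distribution at `z`.
  set A : P × W → (Fin n → ℝ) →L[ℝ] P × W := fun z =>
    ∑ i, (ContinuousLinearMap.proj (R := ℝ) (φ := fun _ : Fin n => ℝ) i).smulRight (y i z) with hA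
  have hAapp : ∀ z a, A z a = ∑ i, a i • y i z := fun z a => by
    simp [hA]
  have hAz : ∀ z ∈ e.target, ∀ a, mfderiv 𝓘(ℝ, P × W) 𝓘(ℝ, E) e.symm z (A z a) =
      ∑ i, a i • Y i (e.symm z) := by
    intro z hz a
    have hyi : ∀ i, mfderiv 𝓘(ℝ, P × W) 𝓘(ℝ, E) e.symm z (y i z) = Y i (e.symm z) := by
      intro i
      change mfderiv 𝓘(ℝ, P × W) 𝓘(ℝ, E) e.symm z
        ((mfderiv 𝓘(ℝ, P × W) 𝓘(ℝ, E) e.symm z).inverse _) = _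
      rw [he.inverse_mfderiv_symm hz]
      have := he.mfderiv_symm_apply (e.map_target hz) (Y i (e.symm z))
      rwa [e.right_inv hz] at this
    rw [hAapp]
    refine (map_sum (mfderiv 𝓘(ℝ, P × W) 𝓘(ℝ, E) e.symm z) _ _).trans ?_
    refine Finset.sum_congr rfl fun i _ => ?_
    refine (map_smul (mfderiv 𝓘(ℝ, P × W) 𝓘(ℝ, E) e.symm z) _ _).trans ?_
    rw [hyi]
  have hmem : ∀ z ∈ e.target, e.symm z ∈ U → ∀ ξ : P × W,
      mfderiv 𝓘(ℝ, P × W) 𝓘(ℝ, E) e.symm z ξ ∈ D (e.symm z) ↔ ∃ a, A z a = ξ := by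
    intro z hz hzU ξ
    rw [← (hspan _ hzU).2, Submodule.mem_span_range_iff_exists_fun]
    constructor
    · rintro ⟨a, ha⟩
      refine ⟨a, (he.isInvertible_mfderiv_symm hz).injective ?_⟩
      rw [hAz z hz, ha]
    · rintro ⟨a, rfl⟩
      exact ⟨a, (hAz z hz a).symm⟩
  have hnear : ∀ᶠ z in 𝓝 (e x₀), z ∈ e.target ∧ e.symm z ∈ U := by
    refine Filter.Eventually.and (e.open_target.mem_nhds (e.map_source hx₀))
      ((e.continuousAt_symm (e.map_source hx₀)).preimage_mem_nhds ?_)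
    rw [e.left_inv hx₀]; exact hU.mem_nhds hx₀U
  have hAs : ∀ᶠ z in 𝓝 (e x₀), ContDiffAt ℝ ∞ A z := by
    filter_upwards [hnear] with z hz
    refine ContDiffAt.sum fun i _ => ?_
    exact contDiffAt_const.smulRight (he.contDiffAt_pullback_field hU (hY i) hz.1 hz.2)
  have hinj : ∀ z ∈ e.target, e.symm z ∈ U → Function.Injective (A z) := by
    intro z hz hzU a b hab
    have h := linearIndependent_iff_injective_fintypeLinearCombination.1 (hspan _ hzU).1
    refine h ?_
    rw [Fintype.linearCombination_apply, Fintype.linearCombination_apply, ← hAz z hz a,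
      ← hAz z hz b, hab]
  set F : P × W → (Fin n → ℝ) →L[ℝ] P := fun z => (ContinuousLinearMap.fst ℝ P W).comp (A z)
    with hF
  have hFs : ∀ᶠ z in 𝓝 (e x₀), ContDiffAt ℝ ∞ F z := by
    filter_upwards [hAs] with z hz
    exact contDiffAt_const.clm_comp hz
  -- Transversality at the centre: uniqueness over `v = 0` gives injectivity of the `P`-component of
  -- the frame, existence over each `v` gives surjectivity. Invertibility persists nearby, and the
  -- graph map is `snd ∘ A ∘ F⁻¹`.
  have hF0 : (F (e x₀)).IsInvertible := by
    have hz := e.map_source hx₀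
    have hzU : e.symm (e x₀) ∈ U := by rwa [e.left_inv hx₀]
    have hbij : Function.Bijective (F (e x₀)) := by
      constructor
      · refine (injective_iff_map_eq_zero _).2 fun a ha => ?_
        have h1 : A (e x₀) a = (0, (A (e x₀) a).2) := Prod.ext ha rfl
        have h2 := (ht 0).unique ((hmem _ hz hzU (0, (A (e x₀) a).2)).2 ⟨a, h1⟩)
          ((hmem _ hz hzU (0, 0)).2 ⟨0, map_zero _⟩)
        rw [h2] at h1
        exact hinj _ hz hzU (h1.trans (map_zero _).symm)
      · intro v
        obtain ⟨η, hη, -⟩ := ht v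
        obtain ⟨a, ha⟩ := (hmem _ hz hzU _).1 hη
        exact ⟨a, congrArg Prod.fst ha⟩
    exact ⟨(LinearEquiv.ofBijective (F (e x₀)).toLinearMap hbij).toContinuousLinearEquiv, by
      ext; rfl⟩
  have hFi : ∀ᶠ z in 𝓝 (e x₀), (F z).IsInvertible := by
    have hc : ContinuousAt F (e x₀) := hFs.self_of_nhds.continuousAt
    exact hc.preimage_mem_nhds (isOpen_setOf_isInvertible.mem_nhds hF0)
  refine ⟨fun z => (ContinuousLinearMap.snd ℝ P W).comp ((A z).comp (F z).inverse), ?_⟩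
  filter_upwards [hAs, hFs, hFi, hnear] with z hz1 hz2 hz3 hz4
  refine ⟨contDiffAt_const.clm_comp (hz1.clm_comp (hz3.contDiffAt_map_inverse.comp z hz2)), ?_⟩
  intro v η
  rw [hmem z hz4.1 hz4.2]
  obtain ⟨Φ, hΦ⟩ := hz3
  have hinv : (F z).inverse = Φ.symm := by rw [← hΦ, ContinuousLinearMap.inverse_equiv]
  have hΦa : ∀ a, (A z a).1 = Φ a := fun a => (congrArg (fun T => T a) hΦ).symm
  simp only [ContinuousLinearMap.comp_apply, hinv]
  change _ ↔ η = (A z (Φ.symm v)).2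
  constructor
  · rintro ⟨a, ha⟩
    have : Φ a = v := by rw [← hΦa, ha]
    rw [← this, Φ.symm_apply_apply, ha]
  · rintro rfl
    refine ⟨Φ.symm v, Prod.ext ?_ rfl⟩
    rw [hΦa, Φ.apply_symm_apply]

theorem mlieBracket_eq_lieBracket {Y Z : ∀ x : V, TangentSpace 𝓘(ℝ, V) x} (x : V) :
    VectorField.mlieBracket 𝓘(ℝ, V) Y Z x = VectorField.lieBracket ℝ Y Z x := by
  rw [← VectorField.mlieBracketWithin_univ, VectorField.mlieBracketWithin_eq_lieBracketWithin]
  exact congrFun (VectorField.lieBracketWithin_univ (V := Y) (W := Z)) x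

/-- The integrability condition for a local graph description of an involutive distribution. -/
theorem IsInvolutive.symmetric_of_graph [FiniteDimensional ℝ E] [FiniteDimensional ℝ P]
    [FiniteDimensional ℝ W] [IsManifold 𝓘(ℝ, E) ∞ X]
    {D : ∀ x : X, Submodule ℝ (TangentSpace 𝓘(ℝ, E) x)} (hD : IsInvolutive D)
    {e : OpenPartialHomeomorph X (P × W)} (he : IsSmoothChart E e) {G : P × W → P →L[ℝ] W}
    {O : Set (P × W)} (hO : IsOpen O) (hOe : O ⊆ e.target)
    (hG : ∀ z ∈ O, ContDiffAt ℝ ∞ G z)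
    (hgr : ∀ z ∈ O, ∀ v η, mfderiv 𝓘(ℝ, P × W) 𝓘(ℝ, E) e.symm z (v, η) ∈ D (e.symm z) ↔ η = G z v)
    {z : P × W} (hz : z ∈ O) (u v : P) :
    fderiv ℝ G z (u, G z u) v = fderiv ℝ G z (v, G z v) u := by
  have h2 : (2 : WithTop ℕ∞) ≤ ∞ := WithTop.coe_le_coe.2 le_top
  have : IsManifold 𝓘(ℝ, E) (minSmoothness ℝ 2) X :=
    IsManifold.of_le (n := ∞) (by simpa using h2)
  -- The fields `Z u = (u, G u)` are tangent to the distribution and have constant `P`-component, so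
  -- their brackets have `P`-component `0`. A vector of the graph over `0` is zero, and the
  -- `W`-component of the bracket is the difference of the two sides.
  set Z : P → P × W → P × W := fun u w => (u, G w u) with hZ
  have hZs : ∀ u, ∀ w ∈ O, ContDiffAt ℝ ∞ (Z u) w := fun u w hw =>
    contDiffAt_const.prodMk ((hG w hw).clm_apply contDiffAt_const)
  have hU : IsOpen (e.source ∩ e ⁻¹' O) := e.isOpen_inter_preimage hO
  set U := e.source ∩ e ⁻¹' O
  have hfield : ∀ u, IsSmoothFieldOn (VectorField.mpullback 𝓘(ℝ, E) 𝓘(ℝ, P × W) e (Z u)) U :=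
    fun u => he.isSmoothFieldOn_mpullback inter_subset_left fun x hx => hZs u _ hx.2
  have hback : ∀ x ∈ U, ∀ ξ : P × W, (mfderiv 𝓘(ℝ, E) 𝓘(ℝ, P × W) e x).inverse ξ ∈ D x ↔
      ξ.2 = G (e x) ξ.1 := by
    intro x hx ξ
    rw [he.inverse_mfderiv hx.1, ← hgr _ hx.2, e.left_inv hx.1]
  have htan : ∀ u, ∀ x ∈ U, VectorField.mpullback 𝓘(ℝ, E) 𝓘(ℝ, P × W) e (Z u) x ∈ D x :=
    fun u x hx => (hback x hx _).2 rfl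
  have hxU : e.symm z ∈ U := ⟨e.map_target (hOe hz), by rwa [mem_preimage, e.right_inv (hOe hz)]⟩
  have hex : e (e.symm z) = z := e.right_inv (hOe hz)
  have key := hD U hU _ _ (hfield u) (hfield v) (htan u) (htan v) _ hxU
  have hmd : ∀ u, MDifferentiableAt 𝓘(ℝ, P × W) 𝓘(ℝ, P × W).tangent
      (fun w => (⟨w, Z u w⟩ : TangentBundle 𝓘(ℝ, P × W) (P × W))) (e (e.symm z)) := fun u =>
    (contMDiffAt_vectorSpace_iff_contDiffAt.2 (hZs u _ hxU.2)).mdifferentiableAt (by simp)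
  rw [← VectorField.mpullback_mlieBracket (n := ∞) (hmd u) (hmd v) (he.contMDiffAt hxU.1)
    (by simpa using h2)] at key
  replace key := (hback _ hxU _).1 key
  have hder : ∀ u w, fderiv ℝ (Z u) z w = (0, fderiv ℝ G z w u) := by
    intro u w
    have h1 : HasFDerivAt (Z u) _ z := (hasFDerivAt_const u z).prodMk
      ((((hG z hz).differentiableAt (by simp)).hasFDerivAt).clm_apply (hasFDerivAt_const u z))
    rw [h1.fderiv]
    simp
  have hb : VectorField.lieBracket ℝ (Z u) (Z v) z =
      (0, fderiv ℝ G z (u, G z u) v - fderiv ℝ G z (v, G z v) u) := by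
    rw [VectorField.lieBracket, hder, hder]
    simp [hZ]
  have hm : VectorField.mlieBracket 𝓘(ℝ, P × W) (Z u) (Z v) z =
      VectorField.lieBracket ℝ (Z u) (Z v) z := mlieBracket_eq_lieBracket _
  rw [hex, hm, hb] at key
  simpa [sub_eq_zero] using key

end LocalGraph
end FolBundle

end

noncomputable section

namespace FolBundle

/-! ### Charts adapted to a tangent subspace and to the fibration. -/

section AdaptedCharts

variable {E X : Type*} [NormedAddCommGroup E] [NormedSpace ℝ E]
  [TopologicalSpace X] [ChartedSpace E X] [IsManifold 𝓘(ℝ, E) ∞ X]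

/-- A chart centred at a given point, with a prescribed linear change of coordinates. -/
theorem exists_centred_chart {V : Type*} [NormedAddCommGroup V] [NormedSpace ℝ V] (x₀ : X)
    (l : E ≃L[ℝ] V) :
    ∃ e : OpenPartialHomeomorph X V, IsSmoothChart E e ∧ x₀ ∈ e.source ∧ e x₀ = 0 ∧
      ∀ v, mfderiv 𝓘(ℝ, V) 𝓘(ℝ, E) e.symm 0 v =
        mfderiv 𝓘(ℝ, E) 𝓘(ℝ, E) (chartAt E x₀).symm (chartAt E x₀ x₀) (l.symm v) := by
  set a := chartAt E x₀ x₀ with ha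
  set h : E ≃ₜ V := (Homeomorph.subRight a).trans l.toHomeomorph with hh
  have hs : ∀ v, h.symm v = l.symm v + a := fun v => rfl
  have h0 := IsSmoothChart.chartAt (E := E) x₀
  refine ⟨(chartAt E x₀).trans h.toOpenPartialHomeomorph, h0.trans ?_ ?_, ?_, ?_, fun v => ?_⟩
  · exact (l.contDiff.comp (contDiff_id.sub contDiff_const)).contDiffOn
  · exact (l.symm.contDiff.add contDiff_const).contDiffOn
  · simp
  · change l (chartAt E x₀ x₀ - a) = 0
    rw [← ha, sub_self, map_zero]
  · have h1 : HasMFDerivAt 𝓘(ℝ, V) 𝓘(ℝ, E) h.symm 0 (l.symm : V →L[ℝ] E) :=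
      ((l.symm.hasFDerivAt (x := 0)).add_const a).hasMFDerivAt
    have h2 : h.symm 0 = a := by rw [hs, map_zero, zero_add]
    have h3 : HasMFDerivAt 𝓘(ℝ, E) 𝓘(ℝ, E) (chartAt E x₀).symm (h.symm 0)
        (mfderiv 𝓘(ℝ, E) 𝓘(ℝ, E) (chartAt E x₀).symm a) := by
      rw [h2]
      exact (h0.mdifferentiable.mdifferentiableAt_symm (mem_chart_target E x₀)).hasMFDerivAt
    exact congrArg (fun A => A v) (h3.comp 0 h1).mfderiv

/-- Linear coordinates in which a given subspace is a coordinate plane. -/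
theorem exists_linear_coordinates [FiniteDimensional ℝ E] (T : Submodule ℝ E) :
    ∃ (p q : ℕ) (l : E ≃L[ℝ] EuclideanSpace ℝ (Fin p) × EuclideanSpace ℝ (Fin q)),
      ∀ v, v ∈ T ↔ (l v).2 = 0 := by
  obtain ⟨T', hT⟩ := Submodule.exists_isCompl T
  refine ⟨Module.finrank ℝ T, Module.finrank ℝ T',
    ((T.prodEquivOfIsCompl T' hT).symm.toContinuousLinearEquiv).trans
      ((ContinuousLinearEquiv.ofFinrankEq (by simp)).prodCongr
        (ContinuousLinearEquiv.ofFinrankEq (by simp))), fun v => ?_⟩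
  change _ ↔ ContinuousLinearEquiv.ofFinrankEq _ ((T.prodEquivOfIsCompl T' hT).symm v).2 = 0
  rw [EmbeddingLike.map_eq_zero_iff, Submodule.prodEquivOfIsCompl_symm_apply_snd_eq_zero]

/-- A centred chart in which a given subspace of a tangent space is a coordinate plane. -/
theorem exists_adapted_chart [FiniteDimensional ℝ E] (x₀ : X) (T : Submodule ℝ E) :
    ∃ (p q : ℕ) (e : OpenPartialHomeomorph X
        (EuclideanSpace ℝ (Fin p) × EuclideanSpace ℝ (Fin q))),
      IsSmoothChart E e ∧ x₀ ∈ e.source ∧ e x₀ = 0 ∧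
      ∀ v, mfderiv 𝓘(ℝ, EuclideanSpace ℝ (Fin p) × EuclideanSpace ℝ (Fin q)) 𝓘(ℝ, E) e.symm 0 v
        ∈ T ↔ v.2 = 0 := by
  set A : E →L[ℝ] E :=
    mfderiv 𝓘(ℝ, E) 𝓘(ℝ, E) (chartAt E x₀).symm (chartAt E x₀ x₀)
  obtain ⟨p, q, l, hl⟩ := exists_linear_coordinates (T.comap A.toLinearMap)
  obtain ⟨e, he, hx, he0, hd⟩ := exists_centred_chart x₀ l
  refine ⟨p, q, e, he, hx, he0, fun v => ?_⟩
  rw [hd v]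
  exact (hl (l.symm v)).trans (by rw [show l (l.symm v) = v from l.apply_symm_apply v])

variable {EM EB EF M B F : Type*}
  [NormedAddCommGroup EM] [NormedSpace ℝ EM]
  [NormedAddCommGroup EB] [NormedSpace ℝ EB]
  [NormedAddCommGroup EF] [NormedSpace ℝ EF]
  [TopologicalSpace M] [ChartedSpace EM M]
  [TopologicalSpace B] [ChartedSpace EB B]
  [TopologicalSpace F] [ChartedSpace EF F]
  {π : B → M}

theorem IsSmoothFibreBundle.contMDiff (hπ : IsSmoothFibreBundle EM EB EF F π) :
    ContMDiff 𝓘(ℝ, EB) 𝓘(ℝ, EM) ∞ π := by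
  intro b
  obtain ⟨e, hb, hs, -⟩ := hπ (π b)
  have hb' : b ∈ e.source := e.mem_source.2 hb
  have h1 := (hs.contMDiffAt (e.open_source.mem_nhds hb')).fst
  refine h1.congr_of_eventuallyEq ?_
  filter_upwards [e.open_source.mem_nhds hb'] with z hz
  exact (e.coe_fst hz).symm

/-- The chart of the total space of a fibre bundle built from a trivialisation and charts of the
base and of the fibre. -/
theorem IsSmoothFibreBundle.exists_chart [FiniteDimensional ℝ EF] [IsManifold 𝓘(ℝ, EF) ∞ F]
    (hπ : IsSmoothFibreBundle EM EB EF F π)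
    {P Q : Type*} [NormedAddCommGroup P] [NormedSpace ℝ P] [NormedAddCommGroup Q] [NormedSpace ℝ Q]
    (b₀ : B) {κ₀ : OpenPartialHomeomorph M (P × Q)} (hκ₀ : IsSmoothChart EM κ₀)
    (hb₀ : π b₀ ∈ κ₀.source) (h0 : κ₀ (π b₀) = 0) :
    ∃ (r : ℕ) (κ : OpenPartialHomeomorph B (P × Q × EuclideanSpace ℝ (Fin r))),
      IsSmoothChart EB κ ∧ b₀ ∈ κ.source ∧ κ b₀ = 0 ∧
      ∀ b ∈ κ.source, π b ∈ κ₀.source ∧ κ₀ (π b) = ((κ b).1, (κ b).2.1) := by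
  obtain ⟨e, hb, hs, hi⟩ := hπ (π b₀)
  have hb' : b₀ ∈ e.source := e.mem_source.2 hb
  obtain ⟨κF, hκF, hf, hf0, -⟩ := exists_centred_chart (E := EF) (e b₀).2
    (ContinuousLinearEquiv.ofFinrankEq (𝕜 := ℝ)
      (F := EuclideanSpace ℝ (Fin (Module.finrank ℝ EF))) (by simp))
  refine ⟨Module.finrank ℝ EF, (e.toOpenPartialHomeomorph.trans (κ₀.prod κF)).trans
    (Homeomorph.prodAssoc P Q _).toOpenPartialHomeomorph, ⟨?_, ?_⟩, ?_, ?_, ?_⟩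
  · intro b hb
    obtain ⟨⟨hb1, hb2⟩, -⟩ := hb
    have h1 : ContMDiffAt 𝓘(ℝ, EB) (𝓘(ℝ, EM).prod 𝓘(ℝ, EF)) ∞ e b :=
      hs.contMDiffAt (e.open_source.mem_nhds hb1)
    have h2 : ContMDiffAt 𝓘(ℝ, EB) 𝓘(ℝ, P × Q) ∞ (fun b => κ₀ (e b).1) b :=
      (hκ₀.contMDiffAt hb2.1).comp b h1.fst
    have h3 : ContMDiffAt 𝓘(ℝ, EB) 𝓘(ℝ, EuclideanSpace ℝ (Fin _)) ∞ (fun b => κF (e b).2) b :=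
      (hκF.contMDiffAt hb2.2).comp b h1.snd
    have h4 : ContMDiffAt 𝓘(ℝ, EB) 𝓘(ℝ, P) ∞ (fun b => (κ₀ (e b).1).1) b :=
      (contDiff_fst.contMDiff (E := P × Q)).contMDiffAt.comp b h2
    have h5 : ContMDiffAt 𝓘(ℝ, EB) 𝓘(ℝ, Q) ∞ (fun b => (κ₀ (e b).1).2) b :=
      (contDiff_snd.contMDiff (E := P × Q)).contMDiffAt.comp b h2
    exact (h4.prodMk_space (h5.prodMk_space h3)).contMDiffWithinAt
  · intro z hz
    obtain ⟨-, hz1, hz2⟩ := hz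
    have h1 : ContMDiffAt 𝓘(ℝ, P × Q × EuclideanSpace ℝ (Fin _)) 𝓘(ℝ, P × Q) ∞
        (fun z : P × Q × EuclideanSpace ℝ (Fin (Module.finrank ℝ EF)) => (z.1, z.2.1)) z :=
      ContDiff.contMDiff (by fun_prop) |>.contMDiffAt
    have h2 : ContMDiffAt 𝓘(ℝ, P × Q × EuclideanSpace ℝ (Fin _)) 𝓘(ℝ, EuclideanSpace ℝ (Fin _)) ∞
        (fun z : P × Q × EuclideanSpace ℝ (Fin (Module.finrank ℝ EF)) => z.2.2) z :=
      ContDiff.contMDiff (by fun_prop) |>.contMDiffAt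
    have h3 : ContMDiffAt 𝓘(ℝ, P × Q × EuclideanSpace ℝ (Fin _)) 𝓘(ℝ, EM) ∞
        (fun z : P × Q × EuclideanSpace ℝ (Fin (Module.finrank ℝ EF)) =>
          κ₀.symm (z.1, z.2.1)) z := (hκ₀.contMDiffAt_symm hz1.1).comp z h1
    have h4 : ContMDiffAt 𝓘(ℝ, P × Q × EuclideanSpace ℝ (Fin _)) 𝓘(ℝ, EF) ∞
        (fun z : P × Q × EuclideanSpace ℝ (Fin (Module.finrank ℝ EF)) =>
          κF.symm z.2.2) z := (hκF.contMDiffAt_symm hz1.2).comp z h2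
    have h5 : ContMDiffAt (𝓘(ℝ, EM).prod 𝓘(ℝ, EF)) 𝓘(ℝ, EB) ∞ e.toOpenPartialHomeomorph.symm
        (κ₀.symm (z.1, z.2.1), κF.symm z.2.2) := hi.contMDiffAt (e.open_target.mem_nhds hz2)
    exact (h5.comp z (h3.prodMk h4)).contMDiffWithinAt
  · refine ⟨⟨hb', ?_, hf⟩, trivial⟩
    change (e b₀).1 ∈ κ₀.source
    rwa [e.coe_fst hb']
  · change ((κ₀ (e b₀).1).1, (κ₀ (e b₀).1).2, κF (e b₀).2) = 0
    rw [e.coe_fst hb', h0, hf0]; rfl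
  · rintro b ⟨⟨hb1, hb2⟩, -⟩
    have h1 : (e b).1 = π b := e.coe_fst hb1
    have h2 : (e b).1 ∈ κ₀.source := hb2.1
    rw [h1] at h2
    refine ⟨h2, ?_⟩
    change _ = ((κ₀ (e b).1).1, (κ₀ (e b).1).2)
    rw [h1]

end AdaptedCharts

end FolBundle

end

noncomputable section

namespace FolBundle

/-! ### Existence of foliated coordinates. -/

section FoliatedCoordinates

variable {EM EB EF M B F : Type*}
  [NormedAddCommGroup EM] [NormedSpace ℝ EM] [FiniteDimensional ℝ EM]
  [NormedAddCommGroup EB] [NormedSpace ℝ EB] [FiniteDimensional ℝ EB]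
  [NormedAddCommGroup EF] [NormedSpace ℝ EF] [FiniteDimensional ℝ EF]
  [TopologicalSpace M] [ChartedSpace EM M] [IsManifold 𝓘(ℝ, EM) ∞ M]
  [TopologicalSpace B] [ChartedSpace EB B] [IsManifold 𝓘(ℝ, EB) ∞ B]
  [TopologicalSpace F] [ChartedSpace EF F] [IsManifold 𝓘(ℝ, EF) ∞ F]
  {π : B → M}

omit [FiniteDimensional ℝ EM] [FiniteDimensional ℝ EB] [IsManifold 𝓘(ℝ, EM) ∞ M]
  [IsManifold 𝓘(ℝ, EB) ∞ B] in
/-- The differential of the projection in fibred charts. -/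
theorem mfderiv_proj_symm {P Q R : Type*} [NormedAddCommGroup P] [NormedSpace ℝ P]
    [NormedAddCommGroup Q] [NormedSpace ℝ Q] [NormedAddCommGroup R] [NormedSpace ℝ R]
    (hπ : ContMDiff 𝓘(ℝ, EB) 𝓘(ℝ, EM) ∞ π)
    {κ₀ : OpenPartialHomeomorph M (P × Q)} (hκ₀ : IsSmoothChart EM κ₀)
    {κ : OpenPartialHomeomorph B (P × Q × R)} (hκ : IsSmoothChart EB κ)
    (hproj : ∀ b ∈ κ.source, π b ∈ κ₀.source ∧ κ₀ (π b) = ((κ b).1, (κ b).2.1))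
    {z : P × Q × R} (hz : z ∈ κ.target) (ξ : P × Q × R) :
    mfderiv 𝓘(ℝ, EB) 𝓘(ℝ, EM) π (κ.symm z) (mfderiv 𝓘(ℝ, P × Q × R) 𝓘(ℝ, EB) κ.symm z ξ) =
      mfderiv 𝓘(ℝ, P × Q) 𝓘(ℝ, EM) κ₀.symm (z.1, z.2.1) (ξ.1, ξ.2.1) := by
  have heq : ∀ w ∈ κ.target, π (κ.symm w) = κ₀.symm (w.1, w.2.1) ∧ (w.1, w.2.1) ∈ κ₀.target := by
    intro w hw
    have h1 := hproj _ (κ.map_target hw)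
    rw [κ.right_inv hw] at h1
    refine ⟨?_, ?_⟩
    · rw [← h1.2, κ₀.left_inv h1.1]
    · rw [← h1.2]; exact κ₀.map_source h1.1
  have h1 : HasMFDerivAt 𝓘(ℝ, P × Q × R) 𝓘(ℝ, EM) (π ∘ κ.symm) z _ :=
    (hπ.mdifferentiableAt (by simp)).hasMFDerivAt.comp z
      (hκ.mdifferentiable.mdifferentiableAt_symm hz).hasMFDerivAt
  have h2 : HasMFDerivAt 𝓘(ℝ, P × Q × R) 𝓘(ℝ, P × Q)
      (fun w : P × Q × R => (w.1, w.2.1)) z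
      ((ContinuousLinearMap.fst ℝ P (Q × R)).prod
        ((ContinuousLinearMap.fst ℝ Q R).comp (ContinuousLinearMap.snd ℝ P (Q × R)))) :=
    (hasFDerivAt_fst.prodMk (hasFDerivAt_fst.comp z hasFDerivAt_snd)).hasMFDerivAt
  have h3 : HasMFDerivAt 𝓘(ℝ, P × Q × R) 𝓘(ℝ, EM)
      (κ₀.symm ∘ fun w : P × Q × R => (w.1, w.2.1)) z _ :=
    HasMFDerivAt.comp z
      (hκ₀.mdifferentiable.mdifferentiableAt_symm (heq z hz).2).hasMFDerivAt h2
  have h4 : HasMFDerivAt 𝓘(ℝ, P × Q × R) 𝓘(ℝ, EM)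
      (κ₀.symm ∘ fun w : P × Q × R => (w.1, w.2.1)) z _ :=
    h1.congr_of_eventuallyEq (by
      filter_upwards [κ.open_target.mem_nhds hz] with w hw
      exact (heq w hw).1.symm)
  exact congrArg (fun A => A ξ) (hasMFDerivAt_unique h4 h3)

namespace RegularFoliation

/-- Foliated coordinates exist about every point of the total space. -/
theorem exists_foliatedCoords (S : RegularFoliation EM EB π)
    (hπ : IsSmoothFibreBundle EM EB EF F π) (b₀ : B) :
    ∃ (p q r : ℕ) (C : S.FoliatedCoords p q r), b₀ ∈ C.total.source := by
  obtain ⟨p, q, κ₀, hκ₀, hx₀, h0, hT⟩ := exists_adapted_chart (E := EM) (π b₀) (S.TFM (π b₀))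
  obtain ⟨r, κ, hκ, hb₀, hκ0, hproj⟩ := hπ.exists_chart b₀ hκ₀ hx₀ h0
  have hsm := hπ.contMDiff
  have h0t : (0 : EuclideanSpace ℝ (Fin p) × EuclideanSpace ℝ (Fin q) ×
      EuclideanSpace ℝ (Fin r)) ∈ κ.target := hκ0 ▸ κ.map_source hb₀
  have hκ0s : κ.symm 0 = b₀ := by rw [← hκ0, κ.left_inv hb₀]
  have hκ₀0s : κ₀.symm 0 = π b₀ := by rw [← h0, κ₀.left_inv hx₀]
  set P := EuclideanSpace ℝ (Fin p)
  set Q := EuclideanSpace ℝ (Fin q)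
  set R := EuclideanSpace ℝ (Fin r)
  have hπs : ∀ z ∈ κ.target, π (κ.symm z) = κ₀.symm (z.1, z.2.1) := by
    intro w hw
    have h1 := hproj _ (κ.map_target hw)
    rw [κ.right_inv hw] at h1
    rw [← h1.2, κ₀.left_inv h1.1]
  have hdπ := fun {z : P × Q × R} (hz : z ∈ κ.target) ξ => mfderiv_proj_symm hsm hκ₀ hκ hproj hz ξ
  have hdown : ∀ z ∈ κ.target, ∀ ξ : P × Q × R,
      mfderiv 𝓘(ℝ, P × Q × R) 𝓘(ℝ, EB) κ.symm z ξ ∈ S.TFB (κ.symm z) →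
      mfderiv 𝓘(ℝ, P × Q) 𝓘(ℝ, EM) κ₀.symm (z.1, z.2.1) (ξ.1, ξ.2.1) ∈
        S.TFM (κ₀.symm (z.1, z.2.1)) := by
    intro z hz ξ hξ
    rw [← hdπ hz ξ, ← hπs z hz, ← S.map_TFB]
    exact ⟨_, hξ, rfl⟩
  have hinj₀ : Function.Injective (mfderiv 𝓘(ℝ, P × Q) 𝓘(ℝ, EM) κ₀.symm 0) :=
    (hκ₀.isInvertible_mfderiv_symm (h0 ▸ κ₀.map_source hx₀)).injective
  -- `TFB` at the centre is a graph over `P`. A vector over `(v, 0)` exists because `dπ` maps `TFB`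
  -- onto `TFM`. It is unique because every vector of `TFB` there has `Q`-component `0`, so two
  -- candidates have the same projection and `dπ` is injective on `TFB`.
  have htr : ∀ v, ∃! η, mfderiv 𝓘(ℝ, P × Q × R) 𝓘(ℝ, EB) κ.symm 0 (v, η) ∈
      S.TFB (κ.symm 0) := by
    intro v
    have hπ0 : π (κ.symm 0) = κ₀.symm 0 := by rw [hκ0s, hκ₀0s]
    have hex : ∃ w ∈ S.TFB (κ.symm 0), mfderiv 𝓘(ℝ, EB) 𝓘(ℝ, EM) π (κ.symm 0) w =
        mfderiv 𝓘(ℝ, P × Q) 𝓘(ℝ, EM) κ₀.symm 0 (v, 0) := by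
      have h1 : (show EM from mfderiv 𝓘(ℝ, P × Q) 𝓘(ℝ, EM) κ₀.symm 0 (v, 0)) ∈
          (show Submodule ℝ EM from S.TFM (π (κ.symm 0))) := by
        rw [hπ0, hκ₀0s]; exact (hT (v, 0)).2 rfl
      rw [← S.map_TFB] at h1
      exact h1
    obtain ⟨w, hw, hwv⟩ := hex
    obtain ⟨⟨v', η⟩, hξ⟩ : ∃ ξ : P × Q × R, mfderiv 𝓘(ℝ, P × Q × R) 𝓘(ℝ, EB) κ.symm 0 ξ = w :=
      (hκ.isInvertible_mfderiv_symm h0t).surjective w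
    rw [← hξ] at hwv hw
    have h2 : ((v', η.1) : P × Q) = (v, 0) := hinj₀ ((hdπ h0t (v', η)).symm.trans hwv)
    have h3 : v' = v := congrArg Prod.fst h2
    rw [h3] at hw
    refine ⟨η, hw, fun η' hη' => ?_⟩
    have hq : ∀ ζ : Q × R, mfderiv 𝓘(ℝ, P × Q × R) 𝓘(ℝ, EB) κ.symm 0 (v, ζ) ∈ S.TFB (κ.symm 0) →
        ζ.1 = 0 := by
      intro ζ hζ
      have h4 := hdown 0 h0t (v, ζ) hζ
      change _ ∈ S.TFM (κ₀.symm 0) at h4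
      rw [hκ₀0s] at h4
      exact (hT (v, ζ.1)).1 h4
    have h5 := S.injOn_TFB (κ.symm 0) hη' hw
      ((hdπ h0t (v, η')).trans (Eq.trans (by rw [hq η' hη', hq η hw]) (hdπ h0t (v, η)).symm))
    have h6 : ((v, η') : P × Q × R) = (v, η) :=
      (hκ.isInvertible_mfderiv_symm h0t).injective h5
    exact congrArg Prod.snd h6
  obtain ⟨GM, hGM⟩ := S.isSubbundle_TFM.exists_graph hκ₀ hx₀ (by
    rw [h0, hκ₀0s]
    exact fun v => ⟨0, (hT (v, 0)).2 rfl, fun η hη => (hT (v, η)).1 hη⟩)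
  obtain ⟨G, hG⟩ := S.isSubbundle_TFB.exists_graph hκ hb₀ (by
    rw [hκ0]
    exact htr)
  rw [h0] at hGM
  rw [hκ0] at hG
  have hpr : Tendsto (fun z : P × Q × R => (z.1, z.2.1)) (𝓝 0) (𝓝 0) :=
    Continuous.tendsto' (by fun_prop) 0 _ rfl
  -- `TFB` projects into `TFM`, so the `Q`-component of `G` is the graph map of `TFM` and is
  -- independent of the fibre coordinate: the system is triangular.
  have hfst : ∀ᶠ z in 𝓝 (0 : P × Q × R), ∀ v, (G z v).1 = GM (z.1, z.2.1) v := by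
    filter_upwards [hG, hpr.eventually hGM, κ.open_target.mem_nhds h0t] with z hz1 hz2 hz3 v
    exact (hz2.2 v _).1 (hdown z hz3 _ ((hz1.2 v _).2 rfl))
  have hincl : Tendsto (fun z : P × Q => ((z.1, z.2, 0) : P × Q × R)) (𝓝 0) (𝓝 0) :=
    Continuous.tendsto' (by fun_prop) 0 _ rfl
  have hGM' : ∀ᶠ z in 𝓝 (0 : P × Q), ∀ v η,
      mfderiv 𝓘(ℝ, P × Q) 𝓘(ℝ, EM) κ₀.symm z (v, η) ∈ S.TFM (κ₀.symm z) ↔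
        η = (G (z.1, z.2, 0) v).1 := by
    filter_upwards [hGM, hincl.eventually hfst] with z hz1 hz2 v η
    rw [hz2 v]
    exact hz1.2 v η
  obtain ⟨O, hO', hO, h0O⟩ := eventually_nhds_iff.1 (hG.and (κ.open_target.mem_nhds h0t))
  have hint : ∀ᶠ z in 𝓝 (0 : P × Q × R), ∀ u v,
      fderiv ℝ G z (u, G z u) v = fderiv ℝ G z (v, G z v) u := by
    filter_upwards [hO.mem_nhds h0O] with z hz u v
    exact S.isInvolutive_TFB.symmetric_of_graph hκ hO (fun w hw => (hO' w hw).2)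
      (fun w hw => (hO' w hw).1.1) (fun w hw => (hO' w hw).1.2) hz u v
  have htri : ∀ᶠ z in 𝓝 (0 : P × Q × R), ∀ v, (G z v).1 = (G (z.1, z.2.1, 0) v).1 := by
    filter_upwards [hfst, hpr.eventually (hincl.eventually hfst)] with z h1 h2 v
    rw [h1, h2]
  obtain ⟨b, c, ⟨hb0, hb00, hbs, hbi, hbd⟩, ⟨hc0, hc00, hcs, hci, hcd⟩, hbc⟩ :=
    exists_foliated_straightening (hG.mono fun z hz => hz.1) hint htri
  obtain ⟨N, hN', hN, h0N⟩ := eventually_nhds_iff.1 hGM'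
  have hUM : IsOpen (κ₀.source ∩ κ₀ ⁻¹' N) := κ₀.isOpen_inter_preimage hN
  -- The maps `b` and `c` lead from straight coordinates to the given ones, hence the inverses. The
  -- domains are cut down so that the graph descriptions hold and the total domain lies over the
  -- base domain.
  set base := (κ₀.trans b.symm).restrOpen _ hUM with hbase
  have hUB : IsOpen (κ.source ∩ κ ⁻¹' O ∩ π ⁻¹' base.source) :=
    (κ.isOpen_inter_preimage hO).inter (base.open_source.preimage hsm.continuous)
  have hbaseI : IsSmoothChart EM base := (hκ₀.trans hbi hbs).restrOpen hUM
  have htotI : IsSmoothChart EB ((κ.trans c.symm).restrOpen _ hUB) :=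
    (hκ.trans hci hcs).restrOpen hUB
  refine ⟨p, q, r,
    { base := base
      total := (κ.trans c.symm).restrOpen _ hUB
      base_smooth := hbaseI.smooth
      base_symm_smooth := hbaseI.smooth_symm
      total_smooth := htotI.smooth
      total_symm_smooth := htotI.smooth_symm
      proj_mem := fun y hy => hy.2.2
      base_proj := ?_
      TFM_eq := ?_
      TFB_eq := ?_ }, ?_⟩
  · intro y hy
    have hy1 : κ y ∈ c.target := hy.1.2
    have h1 := hbc _ (c.map_target hy1)
    rw [c.right_inv hy1, ← (hproj y hy.1.1).2] at h1
    change b.symm (κ₀ (π y)) = ((c.symm (κ y)).1, (c.symm (κ y)).2.1)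
    rw [← h1.2, b.left_inv h1.1]
  · intro x hx
    exact eq_ker_mfderiv_of_straightening hκ₀
      (L := fun z => (ContinuousLinearMap.fst ℝ Q R).comp (G (z.1, z.2, 0))) hbs hbi hbd hx.1
      (hN' _ hx.2.2)
  · intro y hy
    exact eq_ker_mfderiv_of_straightening hκ hcs hci hcd hy.1 (hO' _ hy.2.1.2).1.2
  · have hbt : (0 : P × Q) ∈ b.target := hb00 ▸ b.map_source hb0
    have hct : (0 : P × Q × R) ∈ c.target := hc00 ▸ c.map_source hc0
    refine ⟨⟨hb₀, ?_⟩, ⟨hb₀, ?_⟩, ⟨hx₀, ?_⟩, hx₀, ?_⟩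
    · change κ b₀ ∈ c.target
      rwa [hκ0]
    · rwa [mem_preimage, hκ0]
    · change κ₀ (π b₀) ∈ b.target
      rwa [h0]
    · rwa [mem_preimage, h0]

/-- Foliated coordinates restricted to an open subset of the base. -/
def FoliatedCoords.restr {S : RegularFoliation EM EB π} {p q r : ℕ} (C : S.FoliatedCoords p q r)
    (hπ : Continuous π) {U : Set M} (hU : IsOpen U) : S.FoliatedCoords p q r where
  base := C.base.restrOpen U hU
  total := C.total.restrOpen _ (hU.preimage hπ)
  base_smooth := C.base_smooth.mono fun _ h => h.1
  base_symm_smooth := C.base_symm_smooth.mono fun _ h => h.1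
  total_smooth := C.total_smooth.mono fun _ h => h.1
  total_symm_smooth := C.total_symm_smooth.mono fun _ h => h.1
  proj_mem b hb := ⟨C.proj_mem b hb.1, hb.2⟩
  base_proj b hb := C.base_proj b hb.1
  TFM_eq x hx := C.TFM_eq x hx.1
  TFB_eq b hb := C.TFB_eq b hb.1

end RegularFoliation

end FoliatedCoordinates

end FolBundle

end

noncomputable section

namespace FolBundle

/-! ### The velocity of a family of sections and its order of vanishing. -/

section Velocity

variable {EM EB M B : Type*}
  [NormedAddCommGroup EM] [NormedSpace ℝ EM]
  [NormedAddCommGroup EB] [NormedSpace ℝ EB]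
  [TopologicalSpace M] [ChartedSpace EM M]
  [TopologicalSpace B] [ChartedSpace EB B]

/-- The velocity at time zero of `Φ_t (σ (γ t))` vanishes if `γ` moves against a vector that `σ`
maps to the velocity of `Φ`. -/
theorem hasMFDerivAt_transport {γ : ℝ → M} {σ : M → B} {Φ : ℝ → B → B} {z : M} (hz : γ 0 = z)
    {a : EM} {b : EB}
    (hγ : HasMFDerivAt 𝓘(ℝ, ℝ) 𝓘(ℝ, EM) γ 0 ((1 : ℝ →L[ℝ] ℝ).smulRight (-a) : ℝ →L[ℝ] EM))
    (hσ : MDifferentiableAt 𝓘(ℝ, EM) 𝓘(ℝ, EB) σ z)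
    (hab : mfderiv 𝓘(ℝ, EM) 𝓘(ℝ, EB) σ z a = b)
    (hΦ : MDifferentiableAt (𝓘(ℝ, ℝ).prod 𝓘(ℝ, EB)) 𝓘(ℝ, EB) (fun p : ℝ × B => Φ p.1 p.2)
      (0, σ z))
    (h0 : ∀ᶠ y in 𝓝 (σ z), Φ 0 y = y)
    (hb : HasMFDerivAt 𝓘(ℝ, ℝ) 𝓘(ℝ, EB) (fun s => Φ s (σ z)) 0
      ((1 : ℝ →L[ℝ] ℝ).smulRight b : ℝ →L[ℝ] EB)) :
    HasMFDerivAt 𝓘(ℝ, ℝ) 𝓘(ℝ, EB) (fun t => Φ t (σ (γ t))) 0 0 := by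
  subst hz
  have hG : HasMFDerivAt 𝓘(ℝ, ℝ) (𝓘(ℝ, ℝ).prod 𝓘(ℝ, EB)) (fun t : ℝ => (t, σ (γ t))) 0 _ :=
    (hasMFDerivAt_id (I := 𝓘(ℝ, ℝ)) (0 : ℝ)).prodMk (hσ.hasMFDerivAt.comp 0 hγ)
  have h1 := hΦ.hasMFDerivAt.comp (0 : ℝ) hG
  have hid : mfderiv 𝓘(ℝ, EB) 𝓘(ℝ, EB) (fun y => Φ 0 y) (σ (γ 0)) =
      ContinuousLinearMap.id ℝ (TangentSpace 𝓘(ℝ, EB) (σ (γ 0))) :=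
    ((hasMFDerivAt_id (I := 𝓘(ℝ, EB)) (σ (γ 0))).congr_of_eventuallyEq h0).mfderiv
  refine HasMFDerivAt.congr_mfderiv h1 ?_
  refine ContinuousLinearMap.ext_ring ?_
  change mfderiv (𝓘(ℝ, ℝ).prod 𝓘(ℝ, EB)) 𝓘(ℝ, EB) (fun p : ℝ × B => Φ p.1 p.2) (0, σ (γ 0))
    ((1 : ℝ), mfderiv 𝓘(ℝ, EM) 𝓘(ℝ, EB) σ (γ 0) ((1 : ℝ) • (-a))) = 0
  -- The derivative is a sum of two partial ones: time contributes `b`, and, `Φ 0` being the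
  -- identity near `σ z`, the moving point contributes `dσ(-a) = -b`.
  refine (mfderiv_prod_eq_add_apply hΦ).trans ?_
  have e1 : mfderiv 𝓘(ℝ, ℝ) 𝓘(ℝ, EB) (fun s => Φ s (σ (γ 0))) 0 (1 : ℝ) = b := by
    rw [hb.mfderiv]
    change (1 : ℝ) • b = b
    rw [one_smul]
  have e2 : mfderiv 𝓘(ℝ, EM) 𝓘(ℝ, EB) σ (γ 0) ((1 : ℝ) • (-a)) = -b := by
    rw [one_smul, ← hab]
    exact map_neg (mfderiv 𝓘(ℝ, EM) 𝓘(ℝ, EB) σ (γ 0)) a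
  refine (congrArg₂ (· + ·) e1 ?_).trans (add_neg_cancel b)
  exact (DFunLike.congr_fun hid (mfderiv 𝓘(ℝ, EM) 𝓘(ℝ, EB) σ (γ 0) ((1 : ℝ) • (-a)))).trans e2

/-- A smooth family of maps, read in smooth charts, is smooth. -/
theorem contDiffAt_family_in_charts {V W : Type*} [NormedAddCommGroup V] [NormedSpace ℝ V]
    [NormedAddCommGroup W] [NormedSpace ℝ W] {σt : ℝ → M → B} {c : V → M} {e : B → W} {w : V}
    (hσ : ContMDiffAt (𝓘(ℝ, ℝ).prod 𝓘(ℝ, EM)) 𝓘(ℝ, EB) ∞ (fun p : ℝ × M => σt p.1 p.2) (0, c w))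
    (hc : ContMDiffAt 𝓘(ℝ, V) 𝓘(ℝ, EM) ∞ c w)
    (he : ContMDiffAt 𝓘(ℝ, EB) 𝓘(ℝ, W) ∞ e (σt 0 (c w))) :
    ContDiffAt ℝ ∞ (fun p : ℝ × V => e (σt p.1 (c p.2))) (0, w) := by
  have h1 : ContMDiffAt 𝓘(ℝ, ℝ × V) 𝓘(ℝ, ℝ) ∞ (fun p : ℝ × V => p.1) (0, w) :=
    contDiff_fst.contMDiff.contMDiffAt
  have h2 : ContMDiffAt 𝓘(ℝ, ℝ × V) 𝓘(ℝ, V) ∞ (fun p : ℝ × V => p.2) (0, w) :=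
    contDiff_snd.contMDiff.contMDiffAt
  have h3 : ContMDiffAt 𝓘(ℝ, ℝ × V) 𝓘(ℝ, EM) ∞ (fun p : ℝ × V => c p.2) (0, w) :=
    ContMDiffAt.comp (0, w) hc h2
  have h4 : ContMDiffAt 𝓘(ℝ, ℝ × V) 𝓘(ℝ, EB) ∞ (fun p : ℝ × V => σt p.1 (c p.2)) (0, w) :=
    ContMDiffAt.comp (0, w) hσ (h1.prodMk h3)
  exact (ContMDiffAt.comp (0, w) he h4).contDiffAt

variable [IsManifold 𝓘(ℝ, EM) ∞ M] [IsManifold 𝓘(ℝ, EB) ∞ B]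

/-- The velocity at time `0` of a family of maps in the preferred charts. -/
def chartVelocity (EM EB : Type*) {M B : Type*}
    [NormedAddCommGroup EM] [NormedSpace ℝ EM] [TopologicalSpace M] [ChartedSpace EM M]
    [NormedAddCommGroup EB] [NormedSpace ℝ EB] [TopologicalSpace B] [ChartedSpace EB B]
    (σt : ℝ → M → B) (x : M) (w : EM) : EB :=
  fderiv ℝ (fun p : ℝ × EM => extChartAt 𝓘(ℝ, EB) (σt 0 x)
    (σt p.1 ((extChartAt 𝓘(ℝ, EM) x).symm p.2))) (0, w) (1, 0)

omit [IsManifold 𝓘(ℝ, EB) ∞ B] in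
theorem contDiffAt_family_extChartAt {σt : ℝ → M → B} {x : M}
    (hσ : ContMDiffAt (𝓘(ℝ, ℝ).prod 𝓘(ℝ, EM)) 𝓘(ℝ, EB) ∞ (fun p : ℝ × M => σt p.1 p.2) (0, x)) :
    ContDiffAt ℝ ∞ (fun p : ℝ × EM => extChartAt 𝓘(ℝ, EB) (σt 0 x)
      (σt p.1 ((extChartAt 𝓘(ℝ, EM) x).symm p.2))) (0, extChartAt 𝓘(ℝ, EM) x x) := by
  have hx := extChartAt_to_inv (I := 𝓘(ℝ, EM)) x
  refine contDiffAt_family_in_charts (by rwa [hx]) ?_ ?_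
  · exact (contMDiffOn_extChartAt_symm x).contMDiffAt (extChartAt_target_mem_nhds x)
  · rw [hx]; exact contMDiffAt_extChartAt

omit [IsManifold 𝓘(ℝ, EB) ∞ B] in
-- For a jointly smooth family the time derivative commutes with coordinate derivatives.
-- Stationarity of all the jets thus becomes flatness of a single function, the velocity read in
-- charts.
theorem velocityVanishes_jet_iff {σt : ℝ → M → B} {x : M} {k : ℕ∞}
    (hσ : ContMDiffAt (𝓘(ℝ, ℝ).prod 𝓘(ℝ, EM)) 𝓘(ℝ, EB) ∞ (fun p : ℝ × M => σt p.1 p.2) (0, x)) :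
    VelocityVanishes (EM := EM) (EB := EB) σt x (.jet k) ↔ ∀ i : ℕ, ((i + 1 : ℕ) : ℕ∞) ≤ k →
      iteratedFDeriv ℝ i (chartVelocity EM EB σt x) (extChartAt 𝓘(ℝ, EM) x x) = 0 := by
  refine forall₂_congr fun i _ => ?_
  have h := hasDerivAt_iteratedFDeriv_of_contDiffAt (contDiffAt_family_extChartAt hσ) i
  exact ⟨fun h' => h.unique h', fun h' => h' ▸ h⟩

/-- A smooth family whose velocity vanishes near a point has velocity vanishing to all orders. -/
theorem velocityVanishes_of_germ {σt : ℝ → M → B} {x : M} (k : JetOrder)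
    (hσ : ContMDiffAt (𝓘(ℝ, ℝ).prod 𝓘(ℝ, EM)) 𝓘(ℝ, EB) ∞ (fun p : ℝ × M => σt p.1 p.2) (0, x))
    (h : VelocityVanishes (EM := EM) (EB := EB) σt x .germ) :
    VelocityVanishes (EM := EM) (EB := EB) σt x k := by
  cases k with
  | germ => exact h
  | jet k =>
    rw [velocityVanishes_jet_iff hσ]
    intro i _
    have hx := extChartAt_to_inv (I := 𝓘(ℝ, EM)) x
    have hinv : Tendsto (extChartAt 𝓘(ℝ, EM) x).symm (𝓝 (extChartAt 𝓘(ℝ, EM) x x)) (𝓝 x) := by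
      have := continuousAt_extChartAt_symm (I := 𝓘(ℝ, EM)) x
      rwa [ContinuousAt, hx] at this
    have hH := contDiffAt_family_extChartAt hσ
    have hH' : ∀ᶠ w in 𝓝 (extChartAt 𝓘(ℝ, EM) x x), DifferentiableAt ℝ
        (fun p : ℝ × EM => extChartAt 𝓘(ℝ, EB) (σt 0 x)
          (σt p.1 ((extChartAt 𝓘(ℝ, EM) x).symm p.2))) (0, w) := by
      have h1 := (hH.of_le (m := 1) (by simp)).eventually (by simp)
      have h2 : Tendsto (fun w : EM => ((0 : ℝ), w)) (𝓝 (extChartAt 𝓘(ℝ, EM) x x))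
        (𝓝 (0, extChartAt 𝓘(ℝ, EM) x x)) := (Continuous.prodMk_right (0 : ℝ)).tendsto _
      exact (h2.eventually h1).mono fun w hw => hw.differentiableAt (by simp)
    have hsrc : ∀ᶠ y in 𝓝 x, σt 0 y ∈ (chartAt EB (σt 0 x)).source := by
      have hc : ContinuousAt (fun y => σt 0 y) x :=
        ContinuousAt.comp (x := x) (g := fun p : ℝ × M => σt p.1 p.2) (f := fun y => ((0 : ℝ), y))
          hσ.continuousAt (Continuous.prodMk_right (0 : ℝ)).continuousAt
      exact hc.preimage_mem_nhds ((chartAt EB (σt 0 x)).open_source.mem_nhds (mem_chart_source _ _))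
    have hz : chartVelocity EM EB σt x =ᶠ[𝓝 (extChartAt 𝓘(ℝ, EM) x x)] fun _ => 0 := by
      filter_upwards [hH', hinv.eventually h, hinv.eventually hsrc] with w hw1 hw2 hw3
      have h1 := hasDerivAt_slice_left hw1
      have h2 : HasMFDerivAt 𝓘(ℝ, EB) 𝓘(ℝ, EB) (extChartAt 𝓘(ℝ, EB) (σt 0 x))
          (σt 0 ((extChartAt 𝓘(ℝ, EM) x).symm w)) _ :=
        (mdifferentiableAt_extChartAt hw3).hasMFDerivAt
      have h3 : HasMFDerivAt 𝓘(ℝ, ℝ) 𝓘(ℝ, EB) (fun t => extChartAt 𝓘(ℝ, EB) (σt 0 x)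
          (σt t ((extChartAt 𝓘(ℝ, EM) x).symm w))) 0 (0 : ℝ →L[ℝ] EB) :=
        (h2.comp (0 : ℝ) hw2).congr_mfderiv (ContinuousLinearMap.comp_zero _)
      have h4 : HasFDerivAt (fun t => extChartAt 𝓘(ℝ, EB) (σt 0 x)
          (σt t ((extChartAt 𝓘(ℝ, EM) x).symm w))) (0 : ℝ →L[ℝ] EB) 0 := h3.hasFDerivAt
      exact h1.unique h4.hasDerivAt
    rw [(hz.iteratedFDeriv ℝ i).self_of_nhds]
    simp

/-- The order of vanishing of the velocity can be read in arbitrary smooth charts. -/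
theorem iteratedFDeriv_velocity_eq_zero {V W : Type*} [NormedAddCommGroup V] [NormedSpace ℝ V]
    [NormedAddCommGroup W] [NormedSpace ℝ W] {σt : ℝ → M → B} {x : M}
    (hσ : ContMDiffAt (𝓘(ℝ, ℝ).prod 𝓘(ℝ, EM)) 𝓘(ℝ, EB) ∞ (fun p : ℝ × M => σt p.1 p.2) (0, x))
    {c : OpenPartialHomeomorph M V} (hc : IsSmoothChart EM c) (hx : x ∈ c.source)
    {e : OpenPartialHomeomorph B W} (he : IsSmoothChart EB e) (hσx : σt 0 x ∈ e.source) {j : ℕ}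
    (h : ∀ i ≤ j,
      iteratedFDeriv ℝ i (chartVelocity EM EB σt x) (extChartAt 𝓘(ℝ, EM) x x) = 0) :
    iteratedFDeriv ℝ j (fun w => fderiv ℝ (fun p : ℝ × V => e (σt p.1 (c.symm p.2))) (0, w) (1, 0))
      (c x) = 0 := by
  set H : ℝ × EM → EB := fun p => extChartAt 𝓘(ℝ, EB) (σt 0 x)
    (σt p.1 ((extChartAt 𝓘(ℝ, EM) x).symm p.2)) with hHdef
  set H' : ℝ × V → W := fun p => e (σt p.1 (c.symm p.2)) with hH'def
  set ψ : V → EM := fun w => extChartAt 𝓘(ℝ, EM) x (c.symm w) with hψdef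
  set Θ : EB → W := fun y => e ((extChartAt 𝓘(ℝ, EB) (σt 0 x)).symm y) with hΘdef
  have hcx : c.symm (c x) = x := c.left_inv hx
  have hxt : c x ∈ c.target := c.map_source hx
  have hψx : ψ (c x) = extChartAt 𝓘(ℝ, EM) x x := by rw [hψdef]; simp only [hcx]
  have hH : ContDiffAt ℝ ∞ H (0, ψ (c x)) := by
    rw [hψx]; exact contDiffAt_family_extChartAt hσ
  have hψ : ContDiffAt ℝ ∞ ψ (c x) := by
    have h1 : ContMDiffAt 𝓘(ℝ, EM) 𝓘(ℝ, EM) ∞ (extChartAt 𝓘(ℝ, EM) x) (c.symm (c x)) := by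
      rw [hcx]; exact contMDiffAt_extChartAt
    exact (h1.comp (c x) (hc.contMDiffAt_symm hxt)).contDiffAt
  have hH0 : H (0, ψ (c x)) = extChartAt 𝓘(ℝ, EB) (σt 0 x) (σt 0 x) := by
    rw [hψx, hHdef]; simp only [extChartAt_to_inv]
  have hΘ : ContDiffAt ℝ ∞ Θ (H (0, ψ (c x))) := by
    rw [hH0]
    have h1 : ContMDiffAt 𝓘(ℝ, EB) 𝓘(ℝ, W) ∞ e ((extChartAt 𝓘(ℝ, EB) (σt 0 x)).symm
        (extChartAt 𝓘(ℝ, EB) (σt 0 x) (σt 0 x))) := by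
      rw [extChartAt_to_inv]; exact he.contMDiffAt hσx
    exact (h1.comp _ ((contMDiffOn_extChartAt_symm _).contMDiffAt
      (extChartAt_target_mem_nhds _))).contDiffAt
  have heq : ∀ᶠ p in 𝓝 ((0 : ℝ), c x), H' p = Θ (H (p.1, ψ p.2)) := by
    have hcs : Tendsto (fun p : ℝ × V => c.symm p.2) (𝓝 (0, c x)) (𝓝 x) := by
      have := (c.continuousAt_symm hxt).tendsto.comp
        (continuousAt_snd (p := ((0 : ℝ), c x))).tendsto
      rwa [hcx] at this
    have hst : Tendsto (fun p : ℝ × V => σt p.1 (c.symm p.2)) (𝓝 (0, c x)) (𝓝 (σt 0 x)) := by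
      have h1 : Tendsto (fun p : ℝ × V => (p.1, c.symm p.2)) (𝓝 (0, c x)) (𝓝 (0, x)) := by
        rw [nhds_prod_eq (x := (0 : ℝ)) (y := x)]
        exact (continuousAt_fst (p := ((0 : ℝ), c x))).tendsto.prodMk hcs
      exact hσ.continuousAt.tendsto.comp h1
    filter_upwards [hcs.eventually (extChartAt_source_mem_nhds (I := 𝓘(ℝ, EM)) x),
      hst.eventually (extChartAt_source_mem_nhds (I := 𝓘(ℝ, EB)) (σt 0 x))] with p h1 h2
    simp only [hH'def, hΘdef, hHdef, hψdef]
    rw [(extChartAt 𝓘(ℝ, EM) x).left_inv h1, (extChartAt 𝓘(ℝ, EB) (σt 0 x)).left_inv h2]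
  have hincl : Tendsto (fun w : V => ((0 : ℝ), w)) (𝓝 (c x)) (𝓝 (0, c x)) :=
    (Continuous.prodMk_right (0 : ℝ)).tendsto _
  have hψ' : Tendsto (fun w : V => ((0 : ℝ), ψ w)) (𝓝 (c x)) (𝓝 (0, ψ (c x))) :=
    (Continuous.prodMk_right (0 : ℝ)).continuousAt.tendsto.comp hψ.continuousAt.tendsto
  have hHev : ∀ᶠ w in 𝓝 (c x), DifferentiableAt ℝ H (0, ψ w) :=
    (hψ'.eventually ((hH.of_le (m := 1) (by simp)).eventually (by simp))).mono
      fun w hw => hw.differentiableAt (by simp)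
  have hΘev : ∀ᶠ w in 𝓝 (c x), DifferentiableAt ℝ Θ (H (0, ψ w)) :=
    ((hH.continuousAt.tendsto.comp hψ').eventually
      ((hΘ.of_le (m := 1) (by simp)).eventually (by simp))).mono
      fun w hw => hw.differentiableAt (by simp)
  have hH'ev : ∀ᶠ w in 𝓝 (c x), DifferentiableAt ℝ H' (0, w) := by
    have h1 : ContDiffAt ℝ ∞ H' (0, c x) :=
      contDiffAt_family_in_charts (by rwa [hcx]) (hc.contMDiffAt_symm hxt)
        (by rw [hcx]; exact he.contMDiffAt hσx)
    exact (hincl.eventually ((h1.of_le (m := 1) (by simp)).eventually (by simp))).mono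
      fun w hw => hw.differentiableAt (by simp)
  -- By the chain rule, the change of charts composes the velocity with `ψ` and multiplies it by the
  -- derivative of `Θ`. Both operations preserve flatness to order `j`.
  have hvel : (fun w => fderiv ℝ H' (0, w) (1, 0)) =ᶠ[𝓝 (c x)]
      fun w => fderiv ℝ Θ (H (0, ψ w)) (chartVelocity EM EB σt x (ψ w)) := by
    filter_upwards [hincl.eventually heq.eventually_nhds, hHev, hΘev, hH'ev] with w h1 h2 h3 h4
    have h5 := hasDerivAt_slice_left h4
    have h6 := h3.hasFDerivAt.comp_hasDerivAt (0 : ℝ) (hasDerivAt_slice_left h2)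
    refine h5.unique (h6.congr_of_eventuallyEq ?_)
    have h7 : Tendsto (fun s : ℝ => (s, w)) (𝓝 0) (𝓝 (0, w)) :=
      (Continuous.prodMk_left w).tendsto _
    exact h7.eventually h1
  have hflat : JetEq (j : ℕ∞) (chartVelocity EM EB σt x) 0 (ψ (c x)) := by
    intro i hi
    rw [hψx, h i (by exact_mod_cast hi)]
    simp [Pi.zero_def]
  have hcv : ContDiffAt ℝ ∞ (chartVelocity EM EB σt x) (ψ (c x)) := by
    have h1 : ContDiffAt ℝ ∞ (fderiv ℝ H) (0, ψ (c x)) := hH.fderiv_right (m := ∞) (by simp)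
    have h2 : ContDiffAt ℝ ∞ (fun w => fderiv ℝ H (0, w)) (ψ (c x)) :=
      ContDiffAt.comp (ψ (c x)) h1 (contDiffAt_const.prodMk contDiffAt_id)
    exact h2.clm_apply contDiffAt_const
  have h1 := hflat.comp_right hcv contDiffAt_const hψ
  have h2 : ContDiffAt ℝ ∞ (fun w => fderiv ℝ Θ (H (0, ψ w))) (c x) := by
    have h3 : ContDiffAt ℝ ∞ (fderiv ℝ Θ) (H (0, ψ (c x))) := hΘ.fderiv_right (m := ∞) (by simp)
    have h4 : ContDiffAt ℝ ∞ (fun w => H (0, ψ w)) (c x) :=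
      ContDiffAt.comp (g := H) (f := fun w => ((0 : ℝ), ψ w)) (c x) hH
        (contDiffAt_const.prodMk hψ)
    exact ContDiffAt.comp (c x) h3 h4
  have h3 : JetEq (j : ℕ∞) (fun w => fderiv ℝ Θ (H (0, ψ w)) (chartVelocity EM EB σt x (ψ w))) 0
      (c x) := JetEq.clm_apply_zero (A := fun w => fderiv ℝ Θ (H (0, ψ w)))
        (h := fun w => chartVelocity EM EB σt x (ψ w)) h1 h2 (hcv.comp (c x) hψ)
  have h4 := (h3.congr hvel (.refl _ _)) j le_rfl
  rw [h4]
  simp [Pi.zero_def]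

end Velocity
end FolBundle

end

noncomputable section

namespace FolBundle

/-! ### Sections and translation flows in foliated coordinates. -/

section Representation

variable {EM EB M B : Type*}
  [NormedAddCommGroup EM] [NormedSpace ℝ EM] [TopologicalSpace M] [ChartedSpace EM M]
  [NormedAddCommGroup EB] [NormedSpace ℝ EB] [TopologicalSpace B] [ChartedSpace EB B]
  [IsManifold 𝓘(ℝ, EM) ∞ M] [IsManifold 𝓘(ℝ, EB) ∞ B] {π : B → M}

/-- The partial derivatives in the leafwise directions vanish to order `k - 1`, respectively near
the point. -/
def LeafFlat {P Q R : Type*} [NormedAddCommGroup P] [NormedSpace ℝ P] [NormedAddCommGroup Q]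
    [NormedSpace ℝ Q] [NormedAddCommGroup R] [NormedSpace ℝ R] (f : P × Q → R) (z₀ : P × Q) :
    JetOrder → Prop
  | .jet k => ∀ j : ℕ, ((j + 1 : ℕ) : ℕ∞) ≤ k → ∀ v : P,
      iteratedFDeriv ℝ j (fun z => fderiv ℝ f z (v, 0)) z₀ = 0
  | .germ => ∀ v : P, ∀ᶠ z in 𝓝 z₀, fderiv ℝ f z (v, 0) = 0

namespace RegularFoliation

variable {S : RegularFoliation EM EB π}

/-- Since `lift` is defined by choice, it is computed through uniqueness, which is the injectivity
of `dπ` on `TFB`. -/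
theorem lift_eq {X : ∀ x : M, TangentSpace 𝓘(ℝ, EM) x} {b : B} (h : X (π b) ∈ S.TFM (π b))
    {w : TangentSpace 𝓘(ℝ, EB) b} (hw : w ∈ S.TFB b)
    (hπw : mfderiv 𝓘(ℝ, EB) 𝓘(ℝ, EM) π b w = X (π b)) : S.lift X b = w :=
  S.injOn_TFB b (S.lift_spec h).1 hw ((S.lift_spec h).2.trans hπw.symm)

namespace FoliatedCoords

variable {p q r : ℕ} (C : S.FoliatedCoords p q r)

theorem isSmoothChart_base : IsSmoothChart EM C.base := ⟨C.base_smooth, C.base_symm_smooth⟩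

theorem isSmoothChart_total : IsSmoothChart EB C.total := ⟨C.total_smooth, C.total_symm_smooth⟩

/-- The function `f (x, y)` representing a section. -/
def rep (σ : M → B) (w : EuclideanSpace ℝ (Fin p) × EuclideanSpace ℝ (Fin q)) :
    EuclideanSpace ℝ (Fin r) :=
  (C.total (σ (C.base.symm w))).2.2

/-- `σ` is a smooth section near `z`, with value in the domain of the coordinates. -/
structure IsSectionAt (σ : M → B) (z : M) : Prop where
  smooth : ∀ᶠ y in 𝓝 z, ContMDiffAt 𝓘(ℝ, EM) 𝓘(ℝ, EB) ∞ σ y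
  proj : ∀ᶠ y in 𝓝 z, π (σ y) = y
  mem : σ z ∈ C.total.source

namespace IsSectionAt

variable {C} {σ : M → B} {z : M}

theorem mem_base (h : C.IsSectionAt σ z) : z ∈ C.base.source := by
  have := C.proj_mem _ h.mem
  rwa [h.proj.self_of_nhds] at this

theorem eventually (h : C.IsSectionAt σ z) : ∀ᶠ y in 𝓝 z, C.IsSectionAt σ y := by
  filter_upwards [h.smooth.eventually_nhds, h.proj.eventually_nhds,
    h.smooth.self_of_nhds.continuousAt.preimage_mem_nhds (C.total.open_source.mem_nhds h.mem)] with y h1 h2 h3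
  exact ⟨h1, h2, h3⟩

/-- The coordinates `(x, y)` of the total space are pulled back from the base, so a section appears
as the graph of its representing function. -/
theorem total_eq (h : C.IsSectionAt σ z) :
    C.total (σ z) = ((C.base z).1, (C.base z).2, C.rep σ (C.base z)) := by
  have h1 := C.base_proj _ h.mem
  rw [h.proj.self_of_nhds] at h1
  rw [rep, C.base.left_inv h.mem_base, h1]

theorem contDiffAt_rep (h : C.IsSectionAt σ z) : ContDiffAt ℝ ∞ (C.rep σ) (C.base z) := by
  have hz := C.base.left_inv h.mem_base
  have h1 : ContMDiffAt 𝓘(ℝ, EuclideanSpace ℝ (Fin p) × EuclideanSpace ℝ (Fin q)) 𝓘(ℝ, EM) ∞ C.base.symm (C.base z) :=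
    C.isSmoothChart_base.contMDiffAt_symm (C.base.map_source h.mem_base)
  have h2 : ContMDiffAt 𝓘(ℝ, EM) 𝓘(ℝ, EB) ∞ σ (C.base.symm (C.base z)) := by
    rw [hz]; exact h.smooth.self_of_nhds
  have h3 : ContMDiffAt 𝓘(ℝ, EB) 𝓘(ℝ, EuclideanSpace ℝ (Fin p) × EuclideanSpace ℝ (Fin q) ×
      EuclideanSpace ℝ (Fin r)) ∞ C.total (σ (C.base.symm (C.base z))) := by
    rw [hz]; exact C.isSmoothChart_total.contMDiffAt h.mem
  have h12 : ContMDiffAt 𝓘(ℝ, EuclideanSpace ℝ (Fin p) × EuclideanSpace ℝ (Fin q)) 𝓘(ℝ, EB) ∞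
      (fun w => σ (C.base.symm w)) (C.base z) := ContMDiffAt.comp (C.base z) h2 h1
  have h4 : ContMDiffAt 𝓘(ℝ, EuclideanSpace ℝ (Fin p) × EuclideanSpace ℝ (Fin q))
      𝓘(ℝ, EuclideanSpace ℝ (Fin p) × EuclideanSpace ℝ (Fin q) × EuclideanSpace ℝ (Fin r)) ∞
      (fun w => C.total (σ (C.base.symm w))) (C.base z) := ContMDiffAt.comp (C.base z) h3 h12
  replace h4 := h4.contDiffAt
  exact contDiff_snd.contDiffAt.comp _ (contDiff_snd.contDiffAt.comp _ h4)

/-- A section that is leafwise constant to first order maps tangent vectors of the foliation of the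
base to their lifts. -/
theorem mfderiv_eq_lift (h : C.IsSectionAt σ z) (hf : ∀ v, fderiv ℝ (C.rep σ) (C.base z) (v, 0) = 0)
    {X : ∀ x : M, TangentSpace 𝓘(ℝ, EM) x} (hX : X z ∈ S.TFM z) (hπ : MDifferentiable 𝓘(ℝ, EB) 𝓘(ℝ, EM) π) :
    (mfderiv 𝓘(ℝ, EM) 𝓘(ℝ, EB) σ z (X z) : EB) = S.lift X (σ z) := by
  have hπσ : π (σ z) = z := h.proj.self_of_nhds
  have hσ := (h.smooth.self_of_nhds.mdifferentiableAt (by simp)).hasMFDerivAt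
  have hX' : X (π (σ z)) ∈ S.TFM (π (σ z)) := by rw [hπσ]; exact hX
  refine (S.lift_eq hX' (w := mfderiv 𝓘(ℝ, EM) 𝓘(ℝ, EB) σ z (X z)) ?_ ?_).symm
  -- Along `σ` the coordinates `(y, f)` become `(y, C.rep σ)`. The differential of `y` kills `X`,
  -- which is tangent to the base foliation; that of `C.rep σ` kills it because `C.rep σ` has no
  -- leafwise derivative at the point.
  · rw [C.TFB_eq _ h.mem, LinearMap.mem_ker]
    change mfderiv 𝓘(ℝ, EB) 𝓘(ℝ, EuclideanSpace ℝ (Fin q) × EuclideanSpace ℝ (Fin r))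
      (fun z => (C.total z).2) (σ z) (mfderiv 𝓘(ℝ, EM) 𝓘(ℝ, EB) σ z (X z)) = 0
    have ht : MDifferentiableAt 𝓘(ℝ, EB) 𝓘(ℝ, EuclideanSpace ℝ (Fin q) × EuclideanSpace ℝ (Fin r))
        (fun z => (C.total z).2) (σ z) :=
      ((contDiff_snd (𝕜 := ℝ) (n := ∞) (E := EuclideanSpace ℝ (Fin p))).contMDiff.contMDiffAt.comp
        (σ z) (C.isSmoothChart_total.contMDiffAt h.mem)).mdifferentiableAt (by simp)
    have h1 := ht.hasMFDerivAt.comp z hσ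
    have hbase := (C.isSmoothChart_base.mdifferentiable.mdifferentiableAt h.mem_base).hasMFDerivAt
    have hg : HasFDerivAt (fun w : EuclideanSpace ℝ (Fin p) × EuclideanSpace ℝ (Fin q) =>
        (w.2, C.rep σ w)) ((ContinuousLinearMap.snd ℝ _ _).prod (fderiv ℝ (C.rep σ) (C.base z)))
        (C.base z) :=
      hasFDerivAt_snd.prodMk (h.contDiffAt_rep.differentiableAt (by simp)).hasFDerivAt
    have h2 := hg.hasMFDerivAt.comp z hbase
    have h3 := h2.congr_of_eventuallyEq (f₁ := (fun z => (C.total z).2) ∘ σ) (by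
      filter_upwards [h.eventually] with y hy
      simp only [Function.comp_def, hy.total_eq])
    have h4 := DFunLike.congr_fun (hasMFDerivAt_unique h1 h3) (X z)
    refine h4.trans ?_
    obtain ⟨⟨v, η⟩, hv⟩ : ∃ ξ : EuclideanSpace ℝ (Fin p) × EuclideanSpace ℝ (Fin q),
      mfderiv 𝓘(ℝ, EM) 𝓘(ℝ, EuclideanSpace ℝ (Fin p) × EuclideanSpace ℝ (Fin q)) C.base z (X z) = ξ :=
      ⟨_, rfl⟩
    have h5 : η = 0 := by
      rw [C.TFM_eq _ h.mem_base, LinearMap.mem_ker] at hX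
      have h6 := (hasFDerivAt_snd (𝕜 := ℝ) (p := C.base z)).hasMFDerivAt.comp z hbase
      have h7 := DFunLike.congr_fun h6.mfderiv (X z)
      have h8 : (mfderiv 𝓘(ℝ, EM) 𝓘(ℝ, EuclideanSpace ℝ (Fin p) × EuclideanSpace ℝ (Fin q)) C.base
        z (X z)).2 = 0 := h7.symm.trans hX
      rw [hv] at h8
      exact h8
    change (((ContinuousLinearMap.snd ℝ _ _).prod (fderiv ℝ (C.rep σ) (C.base z)))
      (mfderiv 𝓘(ℝ, EM) 𝓘(ℝ, EuclideanSpace ℝ (Fin p) × EuclideanSpace ℝ (Fin q)) C.base z (X z)))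
      = 0
    rw [hv, h5]
    exact Prod.ext rfl (hf v)
  · have h1 : HasMFDerivAt 𝓘(ℝ, EM) 𝓘(ℝ, EM) (π ∘ σ) z _ :=
      (hπ (σ z)).hasMFDerivAt.comp z hσ
    have h2 : HasMFDerivAt 𝓘(ℝ, EM) 𝓘(ℝ, EM) (π ∘ σ) z _ :=
      (hasMFDerivAt_id z).congr_of_eventuallyEq h.proj
    have h3 := DFunLike.congr_fun (hasMFDerivAt_unique h1 h2) (X z)
    refine h3.trans ?_
    change X z = X (π (σ z))
    rw [hπσ]

end IsSectionAt

/-- The coordinate translations are local flows. -/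
theorem _root_.FolBundle.IsSmoothChart.isLocalFlow_translation {E X V : Type*}
    [NormedAddCommGroup E] [NormedSpace ℝ E]
    [TopologicalSpace X] [ChartedSpace E X] [NormedAddCommGroup V] [NormedSpace ℝ V]
    {e : OpenPartialHomeomorph X V} (he : IsSmoothChart E e) {x₀ : X} (hx₀ : x₀ ∈ e.source)
    (a : V) {Y : ∀ x : X, TangentSpace 𝓘(ℝ, E) x} {O : Set X} (hO : e.source ⊆ O)
    (hY : ∀ x ∈ e.source, Y x = mfderiv 𝓘(ℝ, V) 𝓘(ℝ, E) e.symm (e x) a) :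
    IsLocalFlow Y O (fun t x => e.symm (e x + t • a)) x₀ := by
  have hnear : ∀ᶠ z in 𝓝 ((0 : ℝ), x₀), z.2 ∈ e.source ∧ e z.2 + z.1 • a ∈ e.target := by
    have hc : ContinuousAt (fun z : ℝ × X => e z.2 + z.1 • a) (0, x₀) := by
      have h1 : ContinuousAt (fun z : ℝ × X => e z.2) (0, x₀) :=
        ContinuousAt.comp (g := e) (f := fun z : ℝ × X => z.2) (e.continuousAt hx₀) continuousAt_snd
      exact h1.add (continuousAt_fst.smul continuousAt_const)
    refine Filter.Eventually.and ((continuousAt_snd (p := ((0 : ℝ), x₀))).preimage_mem_nhds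
      (e.open_source.mem_nhds hx₀)) (hc.preimage_mem_nhds (e.open_target.mem_nhds ?_))
    simpa using e.map_source hx₀
  obtain ⟨u, W, hu, h0u, hW, hx, hsub⟩ := mem_nhds_prod_iff'.1 hnear
  obtain ⟨ε, hε, hεu⟩ := Metric.isOpen_iff.1 hu 0 h0u
  rw [Real.ball_eq_Ioo, zero_sub, zero_add] at hεu
  refine ⟨ε, hε, W, hW, hx, ?_, fun x hxW => ?_⟩
  · rintro ⟨t, x⟩ ⟨ht, hxW⟩
    obtain ⟨h1, h2⟩ := hsub (mk_mem_prod (hεu ht) hxW)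
    have h3 : ContMDiffAt (𝓘(ℝ, ℝ).prod 𝓘(ℝ, E)) 𝓘(ℝ, V) ∞
        (fun z : ℝ × X => e z.2 + z.1 • a) (t, x) := by
      have h4 : ContMDiffAt (𝓘(ℝ, ℝ).prod 𝓘(ℝ, E)) 𝓘(ℝ, V) ∞ (fun z : ℝ × X => e z.2) (t, x) :=
        ContMDiffAt.comp (t, x) (he.contMDiffAt h1) contMDiffAt_snd
      have h5 : ContMDiffAt (𝓘(ℝ, ℝ).prod 𝓘(ℝ, E)) 𝓘(ℝ, V) ∞ (fun z : ℝ × X => z.1 • a) (t, x) :=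
        contMDiffAt_fst.smul contMDiffAt_const
      exact h4.add h5
    exact (ContMDiffAt.comp (t, x) (he.contMDiffAt_symm h2) h3).contMDiffWithinAt
  · have h0 := hsub (mk_mem_prod h0u hxW)
    refine ⟨by simp [e.left_inv h0.1], fun t ht => ?_⟩
    obtain ⟨h1, h2⟩ := hsub (mk_mem_prod (hεu ht) hxW)
    refine ⟨hO (e.map_target h2), ?_⟩
    have h3 : HasFDerivAt (fun s : ℝ => e x + s • a)
        ((ContinuousLinearMap.id ℝ ℝ).smulRight a) t :=
      ((hasFDerivAt_id t).smul_const a).const_add (e x)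
    have h4 : HasMFDerivAt 𝓘(ℝ, V) 𝓘(ℝ, E) e.symm (e x + t • a) _ :=
      (he.mdifferentiable.mdifferentiableAt_symm h2).hasMFDerivAt
    refine (h4.comp t h3.hasMFDerivAt).congr_mfderiv ?_
    refine ContinuousLinearMap.ext_ring ?_
    change mfderiv 𝓘(ℝ, V) 𝓘(ℝ, E) e.symm (e x + t • a) ((1 : ℝ) • a) =
      (1 : ℝ) • (Y (e.symm (e x + t • a)) : E)
    rw [hY _ (e.map_target h2), e.right_inv h2, one_smul]
    exact (one_smul ℝ _).symm

end FoliatedCoords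

end RegularFoliation

end Representation
end FolBundle

end

noncomputable section

namespace FolBundle

/-! ### Distinguished sections are invariant; invariance implies leafwise flatness. -/

section Invariance

variable {EM EB M B : Type*}
  [NormedAddCommGroup EM] [NormedSpace ℝ EM] [TopologicalSpace M] [ChartedSpace EM M]
  [NormedAddCommGroup EB] [NormedSpace ℝ EB] [TopologicalSpace B] [ChartedSpace EB B]

namespace IsLocalFlow

variable {X : ∀ x : M, TangentSpace 𝓘(ℝ, EM) x} {O : Set M} {φ : ℝ → M → M} {a : M}

theorem contMDiffAt (h : IsLocalFlow X O φ a) :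
    ∀ᶠ x in 𝓝 a, ContMDiffAt (𝓘(ℝ, ℝ).prod 𝓘(ℝ, EM)) 𝓘(ℝ, EM) ∞
      (fun z : ℝ × M => φ z.1 z.2) (0, x) := by
  obtain ⟨ε, hε, W, hW, ha, hs, -⟩ := h
  filter_upwards [hW.mem_nhds ha] with x hx
  exact hs.contMDiffAt ((isOpen_Ioo.prod hW).mem_nhds ⟨by simpa using hε, hx⟩)

theorem eventually_zero (h : IsLocalFlow X O φ a) : ∀ᶠ x in 𝓝 a, φ 0 x = x := by
  obtain ⟨ε, hε, W, hW, ha, -, hs⟩ := h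
  filter_upwards [hW.mem_nhds ha] with x hx
  exact (hs x hx).1

theorem hasMFDerivAt_zero (h : IsLocalFlow X O φ a) :
    ∀ᶠ x in 𝓝 a, HasMFDerivAt 𝓘(ℝ, ℝ) 𝓘(ℝ, EM) (fun s => φ s x) 0
      ((1 : ℝ →L[ℝ] ℝ).smulRight (X x : EM) : ℝ →L[ℝ] EM) := by
  obtain ⟨ε, hε, W, hW, ha, -, hs⟩ := h
  filter_upwards [hW.mem_nhds ha] with x hx
  obtain ⟨h0, h1⟩ := hs x hx
  refine (h1 0 (by simpa using hε)).2.congr_mfderiv ?_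
  -- `X (φ 0 x)` and `X x` belong to tangent spaces at formally different points; they are compared
  -- in the common model space.
  have h2 : ∀ y, y = x → (X y : EM) = X x := by rintro _ rfl; rfl
  exact congrArg (fun v : EM => ((1 : ℝ →L[ℝ] ℝ).smulRight v : ℝ →L[ℝ] EM)) (h2 _ h0)

theorem hasMFDerivAt_neg (h : IsLocalFlow X O φ a) :
    ∀ᶠ x in 𝓝 a, HasMFDerivAt 𝓘(ℝ, ℝ) 𝓘(ℝ, EM) (fun s => φ (-s) x) 0
      ((1 : ℝ →L[ℝ] ℝ).smulRight (-(X x : EM)) : ℝ →L[ℝ] EM) := by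
  filter_upwards [h.hasMFDerivAt_zero] with x hx
  have hn : HasMFDerivAt 𝓘(ℝ, ℝ) 𝓘(ℝ, ℝ) (fun s : ℝ => -s) 0 (-(ContinuousLinearMap.id ℝ ℝ)) :=
    (hasFDerivAt_id (0 : ℝ)).neg.hasMFDerivAt
  have e : -(0 : ℝ) = 0 := neg_zero
  have hx' : HasMFDerivAt 𝓘(ℝ, ℝ) 𝓘(ℝ, EM) (fun s => φ s x) (-(0 : ℝ))
      ((1 : ℝ →L[ℝ] ℝ).smulRight (X x : EM) : ℝ →L[ℝ] EM) := by
    rw [e]; exact hx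
  refine (hx'.comp (0 : ℝ) hn).congr_mfderiv (ContinuousLinearMap.ext_ring ?_)
  change (-(1 : ℝ)) • (X x : EM) = (1 : ℝ) • (-(X x : EM))
  rw [neg_smul, smul_neg]

/-- The family `Φ_t ∘ σ ∘ φ_{-t}` is smooth. -/
theorem contMDiffAt_transport (h : IsLocalFlow X O φ a)
    {Y : ∀ b : B, TangentSpace 𝓘(ℝ, EB) b} {O' : Set B} {Φ : ℝ → B → B} {σ : M → B}
    (hσ : ContMDiffAt 𝓘(ℝ, EM) 𝓘(ℝ, EB) ∞ σ a) (hΦ : IsLocalFlow Y O' Φ (σ a)) :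
    ContMDiffAt (𝓘(ℝ, ℝ).prod 𝓘(ℝ, EM)) 𝓘(ℝ, EB) ∞
      (fun z : ℝ × M => Φ z.1 (σ (φ (-z.1) z.2))) (0, a) := by
  have h0 : φ (-0) a = a := by rw [neg_zero]; exact h.eventually_zero.self_of_nhds
  have h1 : ContMDiffAt (𝓘(ℝ, ℝ).prod 𝓘(ℝ, EM)) (𝓘(ℝ, ℝ).prod 𝓘(ℝ, EM)) ∞
      (fun z : ℝ × M => (-z.1, z.2)) (0, a) := contMDiffAt_fst.neg.prodMk contMDiffAt_snd
  have h2 : ContMDiffAt (𝓘(ℝ, ℝ).prod 𝓘(ℝ, EM)) 𝓘(ℝ, EM) ∞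
      (fun z : ℝ × M => φ (-z.1) z.2) (0, a) :=
    ContMDiffAt.comp_of_eq h.contMDiffAt.self_of_nhds h1 (by simp)
  have h3 : ContMDiffAt (𝓘(ℝ, ℝ).prod 𝓘(ℝ, EM)) 𝓘(ℝ, EB) ∞
      (fun z : ℝ × M => σ (φ (-z.1) z.2)) (0, a) := ContMDiffAt.comp_of_eq hσ h2 h0
  exact ContMDiffAt.comp_of_eq hΦ.contMDiffAt.self_of_nhds (contMDiffAt_fst.prodMk h3)
    (by simp only [h0])

end IsLocalFlow

variable [IsManifold 𝓘(ℝ, EM) ∞ M] [IsManifold 𝓘(ℝ, EB) ∞ B] {π : B → M}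
  {S : RegularFoliation EM EB π} {p q r : ℕ}

open RegularFoliation.FoliatedCoords

theorem LocalSection.isSectionAt (σ : LocalSection EM EB π) {z : M} (hz : z ∈ σ.dom)
    {C : S.FoliatedCoords p q r} (h : σ.toFun z ∈ C.total.source) : C.IsSectionAt σ.toFun z where
  smooth := by
    filter_upwards [σ.isOpen_dom.mem_nhds hz] with y hy
    exact σ.smooth.contMDiffAt (σ.isOpen_dom.mem_nhds hy)
  proj := by
    filter_upwards [σ.isOpen_dom.mem_nhds hz] with y hy
    exact σ.proj y hy
  mem := h

/-- A section that is locally constant along the leaves is invariant to all orders. -/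
theorem PointedSection.isInvariant_of_leafwise_const {P : PointedSection EM EB π}
    {C : S.FoliatedCoords p q r} (hP : C.IsSectionAt P.sec.toFun P.pt)
    (hf : ∀ᶠ z in 𝓝 P.pt, ∀ v, fderiv ℝ (C.rep P.sec.toFun) (C.base z) (v, 0) = 0)
    (hπ : MDifferentiable 𝓘(ℝ, EB) 𝓘(ℝ, EM) π) (k : JetOrder) : P.IsInvariant S k := by
  intro O X hX hO φ Φ hφ hΦ
  have hσc := hP.smooth.self_of_nhds.continuousAt
  refine velocityVanishes_of_germ k (hφ.contMDiffAt_transport hP.smooth.self_of_nhds hΦ) ?_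
  change ∀ᶠ y in 𝓝 P.pt, _
  filter_upwards [hf, hP.eventually, hX.1.mem_nhds hO, hφ.hasMFDerivAt_neg, hφ.eventually_zero,
    hσc.eventually hΦ.contMDiffAt, hσc.eventually hΦ.eventually_zero.eventually_nhds,
    hσc.eventually hΦ.hasMFDerivAt_zero] with y h1 h2 h3 h4 h5 h6 h7 h8
  exact hasMFDerivAt_transport (γ := fun t => φ (-t) y) (by rw [neg_zero, h5]) h4
    (h2.smooth.self_of_nhds.mdifferentiableAt (by simp)) (h2.mfderiv_eq_lift h1 (hX.2.2 y h3) hπ)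
    (h6.mdifferentiableAt (by simp)) h7 h8

/-- The form `f = s(y)` leaves no leafwise derivative anywhere near the point, which gives
invariance to every order at once. -/
theorem PointedSection.isInvariant_of_isDistinguished {P : PointedSection EM EB π}
    (hP : P.sec.IsDistinguished S) (hπ : MDifferentiable 𝓘(ℝ, EB) 𝓘(ℝ, EM) π) (k : JetOrder) :
    P.IsInvariant S k := by
  obtain ⟨p, q, r, C, hpt, hdom, s, hs⟩ := hP P.pt P.mem
  have hsec : ∀ z ∈ C.base.source, C.IsSectionAt P.sec.toFun z := fun z hz =>
    P.sec.isSectionAt (hdom hz) (hs z hz).1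
  refine PointedSection.isInvariant_of_leafwise_const (hsec _ hpt) ?_ hπ k
  filter_upwards [C.base.open_source.mem_nhds hpt] with z hz v
  -- No smoothness of `s` is assumed, so `s` is replaced by the representing function frozen at the
  -- leafwise coordinate of `z`, which is smooth.
  have h1 : C.rep P.sec.toFun =ᶠ[𝓝 (C.base z)] fun w =>
      C.rep P.sec.toFun ((C.base z).1, w.2) := by
    have hrep : ∀ w ∈ C.base.target, C.rep P.sec.toFun w = s w.2 := fun w hw => by
      rw [rep, (hs _ (C.base.map_target hw)).2, C.base.right_inv hw]
    have hm := C.base.map_source hz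
    have hc : Tendsto (fun w : EuclideanSpace ℝ (Fin p) × EuclideanSpace ℝ (Fin q) =>
        ((C.base z).1, w.2)) (𝓝 (C.base z)) (𝓝 (C.base z)) :=
      Continuous.tendsto' (by fun_prop) _ _ rfl
    filter_upwards [C.base.open_target.mem_nhds hm,
      hc.eventually (C.base.open_target.mem_nhds hm)] with w hw hw'
    rw [hrep w hw, hrep _ hw']
  have h2 : HasFDerivAt (fun w : EuclideanSpace ℝ (Fin p) × EuclideanSpace ℝ (Fin q) =>
      ((C.base z).1, w.2)) ((0 : _ →L[ℝ] EuclideanSpace ℝ (Fin p)).prod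
        (ContinuousLinearMap.snd ℝ _ _)) (C.base z) :=
    (hasFDerivAt_const _ _).prodMk hasFDerivAt_snd
  have h3 := (((hsec z hz).contDiffAt_rep.differentiableAt (by simp)).hasFDerivAt.comp
    (C.base z) h2).congr_of_eventuallyEq h1
  rw [h3.fderiv]
  change fderiv ℝ (C.rep P.sec.toFun) (C.base z) (0, 0) = 0
  exact map_zero _

/-- Transport of a section by the coordinate translations. -/
theorem RegularFoliation.FoliatedCoords.IsSectionAt.eventually_transport_eq
    {C : S.FoliatedCoords p q r} {σ : M → B} {z : M} (h : C.IsSectionAt σ z)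
    (v : EuclideanSpace ℝ (Fin p)) :
    ∀ᶠ w in 𝓝 ((0 : ℝ), C.base z),
      C.total (C.total.symm (C.total (σ (C.base.symm (C.base (C.base.symm w.2) + (-w.1) • (-v, 0)))) +
        w.1 • (-v, 0, 0))) = (w.2.1, w.2.2, C.rep σ (w.2 + w.1 • (v, 0))) := by
  have hz := C.base.map_source h.mem_base
  have h1 : ContinuousAt (fun w : ℝ × (EuclideanSpace ℝ (Fin p) × EuclideanSpace ℝ (Fin q)) =>
      w.2 + w.1 • (v, (0 : EuclideanSpace ℝ (Fin q)))) (0, C.base z) := by fun_prop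
  have h10 : (C.base z) + (0 : ℝ) • (v, (0 : EuclideanSpace ℝ (Fin q))) = C.base z := by simp
  have h1' : Tendsto (fun w : ℝ × (EuclideanSpace ℝ (Fin p) × EuclideanSpace ℝ (Fin q)) =>
      w.2 + w.1 • (v, (0 : EuclideanSpace ℝ (Fin q)))) (𝓝 (0, C.base z)) (𝓝 (C.base z)) := by
    rw [ContinuousAt, h10] at h1; exact h1
  have hsymm : Tendsto C.base.symm (𝓝 (C.base z)) (𝓝 z) := by
    have := C.base.continuousAt_symm hz
    rwa [ContinuousAt, C.base.left_inv h.mem_base] at this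
  have h2 : Tendsto (fun w : ℝ × (EuclideanSpace ℝ (Fin p) × EuclideanSpace ℝ (Fin q)) =>
      (w.2.1, w.2.2, C.rep σ (w.2 + w.1 • (v, (0 : EuclideanSpace ℝ (Fin q))))))
      (𝓝 (0, C.base z)) (𝓝 (C.total (σ z))) := by
    rw [h.total_eq]
    have h3 := h.contDiffAt_rep.continuousAt.tendsto.comp h1'
    have h4 : Tendsto (fun w : ℝ × (EuclideanSpace ℝ (Fin p) × EuclideanSpace ℝ (Fin q)) => w.2)
      (𝓝 (0, C.base z)) (𝓝 (C.base z)) := continuousAt_snd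
    exact ((continuous_fst.tendsto _).comp h4).prodMk_nhds
      (((continuous_snd.tendsto _).comp h4).prodMk_nhds h3)
  filter_upwards [h1'.eventually (C.base.open_target.mem_nhds hz),
    h1'.eventually (hsymm.eventually h.eventually),
    h2.eventually (C.total.open_target.mem_nhds (C.total.map_source h.mem)),
    continuousAt_snd.eventually (C.base.open_target.mem_nhds hz)] with w hw1 hw2 hw3 hw4
  -- The base flow of `-v`, run for time `-t`, translates by `+t v`; the flow upstairs, run for time
  -- `t`, translates the leafwise coordinate back. What remains is the graph of `w ↦ C.rep σ (w + t
  -- (v, 0))`.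
  have e1 : C.base (C.base.symm w.2) + (-w.1) • (-v, (0 : EuclideanSpace ℝ (Fin q))) =
      w.2 + w.1 • (v, 0) := by
    rw [C.base.right_inv hw4]
    refine congrArg (w.2 + ·) (Prod.ext ?_ ?_) <;> simp
  rw [e1, hw2.total_eq, C.base.right_inv hw1]
  have e2 : ((w.2 + w.1 • (v, (0 : EuclideanSpace ℝ (Fin q)))).1,
      (w.2 + w.1 • (v, (0 : EuclideanSpace ℝ (Fin q)))).2,
      C.rep σ (w.2 + w.1 • (v, (0 : EuclideanSpace ℝ (Fin q))))) +
      w.1 • (-v, (0 : EuclideanSpace ℝ (Fin q)), (0 : EuclideanSpace ℝ (Fin r))) =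
      (w.2.1, w.2.2, C.rep σ (w.2 + w.1 • (v, 0))) := by
    refine Prod.ext ?_ (Prod.ext ?_ ?_) <;> simp
  rw [e2, C.total.right_inv hw3]

variable [FiniteDimensional ℝ EM]

/-- The coordinate fields of the leafwise coordinates and their flows. -/
theorem RegularFoliation.FoliatedCoords.exists_coordinate_field (C : S.FoliatedCoords p q r)
    (hπ : ContMDiff 𝓘(ℝ, EB) 𝓘(ℝ, EM) ∞ π) (v : EuclideanSpace ℝ (Fin p)) :
    ∃ X : ∀ x : M, TangentSpace 𝓘(ℝ, EM) x, S.IsFoliationField C.base.source X ∧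
      (∀ x ∈ C.base.source, IsLocalFlow X C.base.source
        (fun t x => C.base.symm (C.base x + t • (v, 0))) x) ∧
      ∀ b ∈ C.total.source, IsLocalFlow (S.lift X) (π ⁻¹' C.base.source)
        (fun t b => C.total.symm (C.total b + t • (v, 0, 0))) b := by
  have hb := C.isSmoothChart_base
  have ht := C.isSmoothChart_total
  set X := VectorField.mpullback 𝓘(ℝ, EM) 𝓘(ℝ, EuclideanSpace ℝ (Fin p) × EuclideanSpace ℝ (Fin q)) C.base (fun _ => ((v, 0) : EuclideanSpace ℝ (Fin p) × EuclideanSpace ℝ (Fin q)))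
  have hXe : ∀ x ∈ C.base.source,
      X x = mfderiv 𝓘(ℝ, EuclideanSpace ℝ (Fin p) × EuclideanSpace ℝ (Fin q)) 𝓘(ℝ, EM) C.base.symm (C.base x) ((v, 0) : EuclideanSpace ℝ (Fin p) × EuclideanSpace ℝ (Fin q)) :=
    fun x hx => hb.inverse_mfderiv hx _
  have hXm : ∀ x ∈ C.base.source, X x ∈ S.TFM x := by
    intro x hx
    rw [C.TFM_eq x hx, LinearMap.mem_ker]
    have h1 : HasMFDerivAt 𝓘(ℝ, EM) 𝓘(ℝ, EuclideanSpace ℝ (Fin p) × EuclideanSpace ℝ (Fin q)) C.base x _ :=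
      (hb.mdifferentiable.mdifferentiableAt hx).hasMFDerivAt
    have h2 := ((hasFDerivAt_snd (𝕜 := ℝ) (p := C.base x)).hasMFDerivAt.comp x h1).mfderiv
    refine (DFunLike.congr_fun h2 (X x)).trans ?_
    change (mfderiv 𝓘(ℝ, EM) 𝓘(ℝ, EuclideanSpace ℝ (Fin p) × EuclideanSpace ℝ (Fin q)) C.base x (X x)).2 = 0
    have h3 := hb.mfderiv_apply_symm (C.base.map_source hx) ((v, 0) : EuclideanSpace ℝ (Fin p) × EuclideanSpace ℝ (Fin q))
    rw [C.base.left_inv hx] at h3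
    exact congrArg Prod.snd ((congrArg _ (hXe x hx)).trans h3)
  refine ⟨X, ⟨C.base.open_source, hb.isSmoothFieldOn_mpullback Subset.rfl fun _ _ =>
    contDiffAt_const, hXm⟩, fun x hx => hb.isLocalFlow_translation hx _ Subset.rfl hXe,
    fun b hb' => ht.isLocalFlow_translation hb' _ (fun y hy => C.proj_mem y hy) fun b hb' => ?_⟩
  -- The coordinate field of `(v, 0, 0)` satisfies `dy = 0` and `df = 0` and projects to that of
  -- `(v, 0)`, so it is the lift.
  refine S.lift_eq (hXm _ (C.proj_mem b hb')) ?_ ?_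
  · rw [C.TFB_eq b hb']
    refine LinearMap.mem_ker.2 ?_
    have h1 : HasMFDerivAt 𝓘(ℝ, EB) 𝓘(ℝ, EuclideanSpace ℝ (Fin p) × EuclideanSpace ℝ (Fin q) ×
      EuclideanSpace ℝ (Fin r)) C.total b _ :=
      (ht.mdifferentiable.mdifferentiableAt hb').hasMFDerivAt
    have h2 := ((hasFDerivAt_snd (𝕜 := ℝ) (p := C.total b)).hasMFDerivAt.comp b h1).mfderiv
    refine (DFunLike.congr_fun h2 _).trans ?_
    change (mfderiv 𝓘(ℝ, EB) 𝓘(ℝ, EuclideanSpace ℝ (Fin p) × EuclideanSpace ℝ (Fin q) ×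
      EuclideanSpace ℝ (Fin r)) C.total b _).2 = 0
    have h3 := ht.mfderiv_apply_symm (C.total.map_source hb') ((v, 0, 0) : EuclideanSpace ℝ (Fin p) × EuclideanSpace ℝ (Fin q) ×
      EuclideanSpace ℝ (Fin r))
    rw [C.total.left_inv hb'] at h3
    exact congrArg Prod.snd h3
  · have h1 := mfderiv_proj_symm hπ hb ht (fun b hb => ⟨C.proj_mem b hb, C.base_proj b hb⟩)
      (C.total.map_source hb') ((v, 0, 0) : EuclideanSpace ℝ (Fin p) × EuclideanSpace ℝ (Fin q) ×
      EuclideanSpace ℝ (Fin r))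
    rw [C.total.left_inv hb', ← C.base_proj b hb'] at h1
    exact h1.trans (hXe _ (C.proj_mem b hb')).symm

/-- The leafwise derivatives of an invariant section vanish to the corresponding order. -/
theorem PointedSection.IsInvariant.leafFlat {k : JetOrder} {P : PointedSection EM EB π}
    (hI : P.IsInvariant S k) (hπ : ContMDiff 𝓘(ℝ, EB) 𝓘(ℝ, EM) ∞ π)
    {C : S.FoliatedCoords p q r} (h : C.IsSectionAt P.sec.toFun P.pt) :
    LeafFlat (C.rep P.sec.toFun) (C.base P.pt) k := by
  set σ := P.sec.toFun
  have hz := C.base.map_source h.mem_base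
  have hsymm : Tendsto C.base.symm (𝓝 (C.base P.pt)) (𝓝 P.pt) := by
    have := C.base.continuousAt_symm hz
    rwa [ContinuousAt, C.base.left_inv h.mem_base] at this
  -- Invariance is tested on the coordinate field of `-v`; the sign is chosen so that the velocity
  -- in foliated coordinates is `(0, 0, ∂_v f)`.
  have key : ∀ v : EuclideanSpace ℝ (Fin p), ∃ σt : ℝ → M → B,
      VelocityVanishes (EM := EM) (EB := EB) σt P.pt k ∧
      ContMDiffAt (𝓘(ℝ, ℝ).prod 𝓘(ℝ, EM)) 𝓘(ℝ, EB) ∞ (fun p : ℝ × M => σt p.1 p.2) (0, P.pt) ∧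
      (∀ᶠ y in 𝓝 P.pt, σt 0 y = σ y) ∧
      ∀ᶠ w in 𝓝 (C.base P.pt),
        HasDerivAt (fun t => C.total (σt t (C.base.symm w)))
          (0, 0, fderiv ℝ (C.rep σ) w (v, 0)) 0 := by
    intro v
    obtain ⟨X, hX, hφ, hΦ⟩ := C.exists_coordinate_field hπ (-v)
    refine ⟨_, hI _ X hX h.mem_base _ _ (hφ _ h.mem_base) (hΦ _ h.mem),
      (hφ _ h.mem_base).contMDiffAt_transport h.smooth.self_of_nhds (hΦ _ h.mem), ?_, ?_⟩
    · filter_upwards [(hφ _ h.mem_base).eventually_zero,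
        h.smooth.self_of_nhds.continuousAt.eventually (hΦ _ h.mem).eventually_zero] with y h1 h2
      simp only [neg_zero]
      rw [h1, h2]
    · have hrep : ∀ᶠ w in 𝓝 (C.base P.pt), DifferentiableAt ℝ (C.rep σ) w :=
        ((h.contDiffAt_rep.of_le (m := 1) (by simp)).eventually (by simp)).mono
          fun w hw => hw.differentiableAt (by simp)
      have hincl : Tendsto (fun w => ((0 : ℝ), w)) (𝓝 (C.base P.pt)) (𝓝 (0, C.base P.pt)) :=
        (Continuous.prodMk_right (0 : ℝ)).tendsto _
      filter_upwards [hrep, hincl.eventually (h.eventually_transport_eq v).eventually_nhds]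
        with w h1 h2
      have h3 : HasDerivAt (fun t : ℝ => w + t • (v, (0 : EuclideanSpace ℝ (Fin q)))) (v, 0) 0 := by
        simpa using ((hasDerivAt_id (0 : ℝ)).smul_const (v, (0 : EuclideanSpace ℝ (Fin q)))).const_add w
      have h1' : HasFDerivAt (C.rep σ) (fderiv ℝ (C.rep σ) w)
          (w + (0 : ℝ) • (v, (0 : EuclideanSpace ℝ (Fin q)))) := by
        rw [zero_smul, add_zero]; exact h1.hasFDerivAt
      have h4 := (hasDerivAt_const (0 : ℝ) w.1).prodMk ((hasDerivAt_const (0 : ℝ) w.2).prodMk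
        (h1'.comp_hasDerivAt (0 : ℝ) h3))
      refine h4.congr_of_eventuallyEq ?_
      have h5 : Tendsto (fun t : ℝ => (t, w)) (𝓝 0) (𝓝 (0, w)) :=
        (Continuous.prodMk_left w).tendsto _
      exact h5.eventually h2
  cases k with
  | germ =>
    intro v
    obtain ⟨σt, hv, -, h0, hd⟩ := key v
    replace hv : ∀ᶠ y in 𝓝 P.pt, HasMFDerivAt 𝓘(ℝ, ℝ) 𝓘(ℝ, EB) (fun t : ℝ => σt t y) 0 0 := hv
    filter_upwards [hd, hsymm.eventually hv, hsymm.eventually h0, hsymm.eventually h.eventually]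
      with w h1 h2 h3 h4
    have h5 : HasMFDerivAt 𝓘(ℝ, EB) 𝓘(ℝ, EuclideanSpace ℝ (Fin p) × EuclideanSpace ℝ (Fin q) ×
        EuclideanSpace ℝ (Fin r)) C.total (σt 0 (C.base.symm w)) _ :=
      (C.isSmoothChart_total.mdifferentiable.mdifferentiableAt (by rw [h3]; exact h4.mem)).hasMFDerivAt
    have h6 : HasMFDerivAt 𝓘(ℝ, ℝ) 𝓘(ℝ, EuclideanSpace ℝ (Fin p) × EuclideanSpace ℝ (Fin q) ×
        EuclideanSpace ℝ (Fin r)) (fun t => C.total (σt t (C.base.symm w))) 0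
        (0 : ℝ →L[ℝ] EuclideanSpace ℝ (Fin p) × EuclideanSpace ℝ (Fin q) ×
        EuclideanSpace ℝ (Fin r)) :=
      (h5.comp (0 : ℝ) h2).congr_mfderiv (ContinuousLinearMap.comp_zero _)
    have h7 : HasFDerivAt (fun t => C.total (σt t (C.base.symm w)))
      (0 : ℝ →L[ℝ] EuclideanSpace ℝ (Fin p) × EuclideanSpace ℝ (Fin q) ×
        EuclideanSpace ℝ (Fin r)) 0 := h6.hasFDerivAt
    have h8 := h1.unique h7.hasDerivAt
    exact congrArg (fun z => z.2.2) h8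
  | jet k =>
    intro j hj v
    obtain ⟨σt, hv, hs, h0, hd⟩ := key v
    rw [velocityVanishes_jet_iff hs] at hv
    have hmem : σt 0 P.pt ∈ C.total.source := by rw [h0.self_of_nhds]; exact h.mem
    set H' : ℝ × (EuclideanSpace ℝ (Fin p) × EuclideanSpace ℝ (Fin q)) → _ :=
      fun z => C.total (σt z.1 (C.base.symm z.2)) with hH'
    have h1 : JetEq (j : ℕ∞) (fun w => fderiv ℝ H' (0, w) (1, 0)) 0 (C.base P.pt) := by
      intro i hi
      have hi' : i ≤ j := by exact_mod_cast hi
      rw [iteratedFDeriv_velocity_eq_zero hs C.isSmoothChart_base h.mem_base C.isSmoothChart_total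
        hmem fun i' hi'' => hv i' (le_trans (by exact_mod_cast (by omega)) hj)]
      simp [Pi.zero_def]
    have hH's : ContDiffAt ℝ ∞ H' (0, C.base P.pt) :=
      contDiffAt_family_in_charts (by rw [C.base.left_inv h.mem_base]; exact hs)
        (C.isSmoothChart_base.contMDiffAt_symm hz)
        (by rw [C.base.left_inv h.mem_base]; exact C.isSmoothChart_total.contMDiffAt hmem)
    have hincl : Tendsto (fun w => ((0 : ℝ), w)) (𝓝 (C.base P.pt)) (𝓝 (0, C.base P.pt)) :=
      (Continuous.prodMk_right (0 : ℝ)).tendsto _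
    have h2 : (fun w => fderiv ℝ H' (0, w) (1, 0)) =ᶠ[𝓝 (C.base P.pt)]
        fun w => (0, 0, fderiv ℝ (C.rep σ) w (v, 0)) := by
      filter_upwards [hd, hincl.eventually ((hH's.of_le (m := 1) (by simp)).eventually (by simp))]
        with w hw1 hw2
      exact (hasDerivAt_slice_left (hw2.differentiableAt (by simp))).unique hw1
    have h3 : ContDiffAt ℝ ∞ (fun w => fderiv ℝ (C.rep σ) w (v, 0)) (C.base P.pt) :=
      (h.contDiffAt_rep.fderiv_right (m := ∞) (by simp)).clm_apply contDiffAt_const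
    have h4 := h1.congr h2.symm (.refl _ _)
    have h5 := h4.comp_left (g := fun z => z.2.2) (by fun_prop)
      (contDiffAt_const.prodMk (contDiffAt_const.prodMk h3)) contDiffAt_const
    have h6 := h5 j le_rfl
    refine Eq.trans h6 ?_
    have : ((fun z : EuclideanSpace ℝ (Fin p) × EuclideanSpace ℝ (Fin q) ×
      EuclideanSpace ℝ (Fin r) => z.2.2) ∘
      (0 : EuclideanSpace ℝ (Fin p) × EuclideanSpace ℝ (Fin q) → _)) = fun _ => 0 := rfl
    rw [this]
    simp

end Invariance
end FolBundle

end

noncomputable section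

namespace FolBundle

/-! ### Contact of sections, and freezing of the leafwise variable. -/

section Contact

variable {P Q R : Type*} [NormedAddCommGroup P] [NormedSpace ℝ P] [NormedAddCommGroup Q]
  [NormedSpace ℝ Q] [NormedAddCommGroup R] [NormedSpace ℝ R]

/-- Contact of order `k` of two maps between normed spaces. -/
def Contact (f g : P → R) (z : P) : JetOrder → Prop
  | .jet k => JetEq k f g z
  | .germ => f =ᶠ[𝓝 z] g

/-- Leafwise derivatives to order `k - 1` are determined by derivatives of `f` to order `k`, so
flatness belongs to the class and passes to any of its representatives. -/
theorem LeafFlat.congr {k : JetOrder} {f g : P × Q → R} {z : P × Q} (h : LeafFlat f z k)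
    (hfg : Contact f g z k) (hf : ContDiffAt ℝ ∞ f z) (hg : ContDiffAt ℝ ∞ g z) :
    LeafFlat g z k := by
  cases k with
  | jet k =>
    intro j hj v
    rw [← h j hj v]
    have h1 : JetEq ((j : ℕ∞) + 1) f g z := fun i hi => hfg i (hi.trans (by exact_mod_cast hj))
    exact ((h1.fderiv_apply hf hg (v, 0)) j le_rfl).symm
  | germ =>
    intro v
    filter_upwards [h v, Filter.EventuallyEq.fderiv (𝕜 := ℝ) hfg] with w h1 h2
    rw [← h2, h1]

/-- A leafwise flat function agrees to the corresponding order with a function of the transverse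
variable. -/
theorem LeafFlat.contact_freeze [FiniteDimensional ℝ P] {k : JetOrder} {f : P × Q → R} {x₀ : P}
    {y₀ : Q} (h : LeafFlat f (x₀, y₀) k) (hf : ContDiffAt ℝ ∞ f (x₀, y₀)) :
    Contact f (fun w => f (x₀, w.2)) (x₀, y₀) k := by
  cases k with
  | jet k =>
    intro i hi
    exact jetEq_freeze_left i hf fun j hj v => h j (le_trans (by exact_mod_cast hj) hi) v
  | germ =>
    have hd : ∀ᶠ z in 𝓝 (x₀, y₀), DifferentiableAt ℝ f z :=
      ((hf.of_le (m := 1) (by simp)).eventually (by simp)).mono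
        fun w hw => hw.differentiableAt (by simp)
    -- `LeafFlat` provides a neighbourhood for each direction separately; a finite basis of `P`
    -- gives a common one.
    have hb : ∀ᶠ z in 𝓝 (x₀, y₀), ∀ v, fderiv ℝ f z (v, 0) = 0 := by
      have hb' := Filter.eventually_all.2 fun i => h (Module.finBasis ℝ P i)
      filter_upwards [hb'] with z hz v
      have : (fderiv ℝ f z).toLinearMap ∘ₗ LinearMap.inl ℝ P Q = 0 :=
        (Module.finBasis ℝ P).ext fun i => hz i
      exact LinearMap.congr_fun this v
    obtain ⟨ε, hε, hball⟩ := Metric.eventually_nhds_iff_ball.1 (hd.and hb)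
    change f =ᶠ[𝓝 (x₀, y₀)] fun w => f (x₀, w.2)
    filter_upwards [Metric.ball_mem_nhds _ hε] with w hw
    -- A ball in the product is a product of balls, so `w` and the frozen point lie in one convex
    -- leafwise slice, on which `f` has zero derivative.
    rw [← ball_prod_same] at hw hball
    have hmem : ∀ x ∈ Metric.ball x₀ ε, (x, w.2) ∈ Metric.ball x₀ ε ×ˢ Metric.ball y₀ ε :=
      fun x hx => ⟨hx, hw.2⟩
    have hder : ∀ x ∈ Metric.ball x₀ ε, HasFDerivAt (fun x => f (x, w.2))
        ((fderiv ℝ f (x, w.2)).comp (.inl ℝ P Q)) x := fun x hx =>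
      (hball _ (hmem x hx)).1.hasFDerivAt.comp x (hasFDerivAt_prodMk_left x w.2)
    exact Metric.isOpen_ball.is_const_of_fderiv_eq_zero (𝕜 := ℝ) (f := fun x => f (x, w.2))
      (convex_ball x₀ ε).isPreconnected
      (fun x hx => (hder x hx).differentiableAt.differentiableWithinAt)
      (fun x hx => by
        rw [(hder x hx).fderiv]
        ext v
        exact (hball _ (hmem x hx)).2 v) hw.1 (Metric.mem_ball_self hε)

variable {EM EB M B : Type*}
  [NormedAddCommGroup EM] [NormedSpace ℝ EM] [TopologicalSpace M] [ChartedSpace EM M]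
  [NormedAddCommGroup EB] [NormedSpace ℝ EB] [TopologicalSpace B] [ChartedSpace EB B]
  [IsManifold 𝓘(ℝ, EM) ∞ M] [IsManifold 𝓘(ℝ, EB) ∞ B] {π : B → M}
  {S : RegularFoliation EM EB π} {p q r : ℕ} {C : S.FoliatedCoords p q r}

open RegularFoliation.FoliatedCoords

/-- A change of charts in the source and the target preserves jets of maps. -/
theorem JetEq.change_charts {V W : Type*} [NormedAddCommGroup V] [NormedSpace ℝ V]
    [NormedAddCommGroup W] [NormedSpace ℝ W] {k : ℕ∞} {f₁ f₂ : P → R} {z : P}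
    (h : JetEq k f₁ f₂ z) (h₁ : ContDiffAt ℝ ∞ f₁ z) (h₂ : ContDiffAt ℝ ∞ f₂ z)
    {c : V → P} {w : V} (hc : ContDiffAt ℝ ∞ c w) (hcw : c w = z) {e : R → W}
    (he : ContDiffAt ℝ ∞ e (f₁ z)) {g₁ g₂ : V → W} (hg₁ : g₁ =ᶠ[𝓝 w] e ∘ f₁ ∘ c)
    (hg₂ : g₂ =ᶠ[𝓝 w] e ∘ f₂ ∘ c) : JetEq k g₁ g₂ w := by
  subst hcw
  have he' : ContDiffAt ℝ ∞ e (f₂ (c w)) := h.apply_eq ▸ he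
  exact ((h.comp_left he h₁ h₂).comp_right (he.comp _ h₁) (he'.comp _ h₂) hc).congr hg₁ hg₂

omit [IsManifold 𝓘(ℝ, EM) ∞ M] [IsManifold 𝓘(ℝ, EB) ∞ B] in
theorem contDiffAt_writtenInExtChartAt {σ : M → B} {z : M}
    (h : ContMDiffAt 𝓘(ℝ, EM) 𝓘(ℝ, EB) ∞ σ z) :
    ContDiffAt ℝ ∞ (writtenInExtChartAt 𝓘(ℝ, EM) 𝓘(ℝ, EB) z σ) (extChartAt 𝓘(ℝ, EM) z z) := by
  have := (contMDiffAt_iff.1 h).2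
  simpa [contDiffWithinAt_univ] using this

omit [IsManifold 𝓘(ℝ, EM) ∞ M] in
theorem tendsto_extChartAt_symm (z : M) :
    Tendsto (extChartAt 𝓘(ℝ, EM) z).symm (𝓝 (extChartAt 𝓘(ℝ, EM) z z)) (𝓝 z) := by
  have := continuousAt_extChartAt_symm (I := 𝓘(ℝ, EM)) z
  rwa [ContinuousAt, extChartAt_to_inv] at this

namespace RegularFoliation.FoliatedCoords

theorem tendsto_base_symm (C : S.FoliatedCoords p q r) {z : M} (hz : z ∈ C.base.source) :
    Tendsto C.base.symm (𝓝 (C.base z)) (𝓝 z) := by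
  have := C.base.continuousAt_symm (C.base.map_source hz)
  rwa [ContinuousAt, C.base.left_inv hz] at this

namespace IsSectionAt

variable {σ τ : M → B} {z : M}

/-- This passes from the preferred charts, where jets are defined, to foliated coordinates. The
centre `b` of the target chart is a separate argument so that two sections with equal values are
read in literally the same chart. -/
theorem rep_eventuallyEq_written (h : C.IsSectionAt σ z) {b : B} (hb : σ z = b) :
    C.rep σ =ᶠ[𝓝 (C.base z)]
      (fun y => (C.total ((extChartAt 𝓘(ℝ, EB) b).symm y)).2.2) ∘
        writtenInExtChartAt 𝓘(ℝ, EM) 𝓘(ℝ, EB) z σ ∘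
        fun w => extChartAt 𝓘(ℝ, EM) z (C.base.symm w) := by
  subst hb
  have h1 := C.tendsto_base_symm h.mem_base
  filter_upwards [h1.eventually (extChartAt_source_mem_nhds (I := 𝓘(ℝ, EM)) z),
    (h.smooth.self_of_nhds.continuousAt.tendsto.comp h1).eventually
      (extChartAt_source_mem_nhds (I := 𝓘(ℝ, EB)) (σ z))] with w h2 h3
  simp only [Function.comp_def] at h3
  simp only [Function.comp_def, writtenInExtChartAt, rep]
  rw [(extChartAt 𝓘(ℝ, EM) z).left_inv h2, (extChartAt 𝓘(ℝ, EB) (σ z)).left_inv h3]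

theorem written_eventuallyEq_rep (h : C.IsSectionAt σ z) {b : B} (hb : σ z = b) :
    writtenInExtChartAt 𝓘(ℝ, EM) 𝓘(ℝ, EB) z σ =ᶠ[𝓝 (extChartAt 𝓘(ℝ, EM) z z)]
      (fun y => extChartAt 𝓘(ℝ, EB) b (C.total.symm y)) ∘
        (fun w => (w.1, w.2, C.rep σ w)) ∘
        fun w => C.base ((extChartAt 𝓘(ℝ, EM) z).symm w) := by
  subst hb
  filter_upwards [(tendsto_extChartAt_symm (EM := EM) z).eventually h.eventually] with w hw
  simp only [Function.comp_def, writtenInExtChartAt]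
  rw [← hw.total_eq, C.total.left_inv hw.mem]

/-- Contact of sections is contact of their coordinate representations. -/
theorem contact_rep {P₁ P₂ : PointedSection EM EB π} {k : JetOrder} (H : SameJet k P₁ P₂)
    (h₁ : C.IsSectionAt P₁.sec.toFun P₁.pt) (h₂ : C.IsSectionAt P₂.sec.toFun P₂.pt) :
    Contact (C.rep P₁.sec.toFun) (C.rep P₂.sec.toFun) (C.base P₁.pt) k := by
  cases k with
  | germ =>
    obtain ⟨-, h⟩ := H
    filter_upwards [(C.tendsto_base_symm h₁.mem_base).eventually h] with w hw
    rw [rep, rep, hw]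
  | jet k =>
    obtain ⟨hpt, hval, h⟩ := H
    rw [← hpt] at h₂
    refine JetEq.change_charts h (contDiffAt_writtenInExtChartAt h₁.smooth.self_of_nhds)
      (contDiffAt_writtenInExtChartAt h₂.smooth.self_of_nhds)
      (c := fun w => extChartAt 𝓘(ℝ, EM) P₁.pt (C.base.symm w)) ?_ ?_ ?_
      (h₁.rep_eventuallyEq_written rfl) (h₂.rep_eventuallyEq_written hval.symm)
    · have h3 : ContMDiffAt 𝓘(ℝ, EM) 𝓘(ℝ, EM) ∞ (extChartAt 𝓘(ℝ, EM) P₁.pt)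
          (C.base.symm (C.base P₁.pt)) := by
        rw [C.base.left_inv h₁.mem_base]; exact contMDiffAt_extChartAt
      exact (ContMDiffAt.comp (C.base P₁.pt) h3
        (C.isSmoothChart_base.contMDiffAt_symm (C.base.map_source h₁.mem_base))).contDiffAt
    · rw [C.base.left_inv h₁.mem_base]
    · simp only [writtenInExtChartAt, Function.comp_apply, extChartAt_to_inv]
      have h3 : ContMDiffAt 𝓘(ℝ, EB) 𝓘(ℝ, EuclideanSpace ℝ (Fin p) × EuclideanSpace ℝ (Fin q) ×
          EuclideanSpace ℝ (Fin r)) ∞ C.total ((extChartAt 𝓘(ℝ, EB) (P₁.sec.toFun P₁.pt)).symm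
          (extChartAt 𝓘(ℝ, EB) (P₁.sec.toFun P₁.pt) (P₁.sec.toFun P₁.pt))) := by
        rw [extChartAt_to_inv]; exact C.isSmoothChart_total.contMDiffAt h₁.mem
      have h4 := (ContMDiffAt.comp _ h3 ((contMDiffOn_extChartAt_symm _).contMDiffAt
        (extChartAt_target_mem_nhds _))).contDiffAt
      exact contDiff_snd.contDiffAt.comp _ (contDiff_snd.contDiffAt.comp _ h4)

/-- The section is recovered from the graph of its representing function, so contact of these
functions gives contact of graphs and, after a change of charts, of sections. -/
theorem sameJet_of_contact {P₁ P₂ : PointedSection EM EB π} {k : JetOrder} (hpt : P₁.pt = P₂.pt)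
    (h₁ : C.IsSectionAt P₁.sec.toFun P₁.pt) (h₂ : C.IsSectionAt P₂.sec.toFun P₂.pt)
    (H : Contact (C.rep P₁.sec.toFun) (C.rep P₂.sec.toFun) (C.base P₁.pt) k) :
    SameJet k P₁ P₂ := by
  rw [← hpt] at h₂
  have hz := C.base.map_source h₁.mem_base
  cases k with
  | germ =>
    refine ⟨hpt, ?_⟩
    have hc : Tendsto C.base (𝓝 P₁.pt) (𝓝 (C.base P₁.pt)) := C.base.continuousAt h₁.mem_base
    filter_upwards [hc.eventually H, h₁.eventually, h₂.eventually] with y h3 h4 h5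
    refine C.total.injOn h4.mem h5.mem ?_
    rw [h4.total_eq, h5.total_eq, h3]
  | jet k =>
    have hval : P₁.sec.toFun P₁.pt = P₂.sec.toFun P₁.pt := by
      refine C.total.injOn h₁.mem h₂.mem ?_
      rw [h₁.total_eq, h₂.total_eq, JetEq.apply_eq H]
    refine ⟨hpt, hval, ?_⟩
    have hbase : ContDiffAt ℝ ∞ (fun w => C.base ((extChartAt 𝓘(ℝ, EM) P₁.pt).symm w))
        (extChartAt 𝓘(ℝ, EM) P₁.pt P₁.pt) := by
      have h3 : ContMDiffAt 𝓘(ℝ, EM) 𝓘(ℝ, EuclideanSpace ℝ (Fin p) × EuclideanSpace ℝ (Fin q)) ∞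
          C.base ((extChartAt 𝓘(ℝ, EM) P₁.pt).symm (extChartAt 𝓘(ℝ, EM) P₁.pt P₁.pt)) := by
        rw [extChartAt_to_inv]; exact C.isSmoothChart_base.contMDiffAt h₁.mem_base
      exact (ContMDiffAt.comp _ h3 ((contMDiffOn_extChartAt_symm _).contMDiffAt
        (extChartAt_target_mem_nhds _))).contDiffAt
    have hgraph : JetEq k (fun w => (w.1, w.2, C.rep P₁.sec.toFun w))
        (fun w => (w.1, w.2, C.rep P₂.sec.toFun w)) (C.base P₁.pt) := by
      have h3 := JetEq.prodMk (k := k) (JetEq.refl (f := Prod.snd)) H contDiffAt_snd contDiffAt_snd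
        h₁.contDiffAt_rep h₂.contDiffAt_rep
      exact JetEq.prodMk (JetEq.refl (f := Prod.fst)) h3 contDiffAt_fst contDiffAt_fst
        (contDiffAt_snd.prodMk h₁.contDiffAt_rep) (contDiffAt_snd.prodMk h₂.contDiffAt_rep)
    refine hgraph.change_charts (contDiffAt_fst.prodMk (contDiffAt_snd.prodMk h₁.contDiffAt_rep))
      (contDiffAt_fst.prodMk (contDiffAt_snd.prodMk h₂.contDiffAt_rep)) hbase
      (by rw [extChartAt_to_inv]) ?_ (h₁.written_eventuallyEq_rep rfl)
      (h₂.written_eventuallyEq_rep hval.symm)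
    rw [← h₁.total_eq]
    have h3 : ContMDiffAt 𝓘(ℝ, EB) 𝓘(ℝ, EB) ∞ (extChartAt 𝓘(ℝ, EB) (P₁.sec.toFun P₁.pt))
        (C.total.symm (C.total (P₁.sec.toFun P₁.pt))) := by
      rw [C.total.left_inv h₁.mem]; exact contMDiffAt_extChartAt
    exact (ContMDiffAt.comp _ h3 (C.isSmoothChart_total.contMDiffAt_symm
      (C.total.map_source h₁.mem))).contDiffAt

end IsSectionAt

end RegularFoliation.FoliatedCoords

end Contact
end FolBundle

end

noncomputable section

namespace FolBundle

/-! ### Smooth families of distinguished sections. -/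

section Families

variable {EM EB EF M B F : Type*}
  [NormedAddCommGroup EM] [NormedSpace ℝ EM] [FiniteDimensional ℝ EM]
  [NormedAddCommGroup EB] [NormedSpace ℝ EB] [FiniteDimensional ℝ EB]
  [NormedAddCommGroup EF] [NormedSpace ℝ EF] [FiniteDimensional ℝ EF]
  [TopologicalSpace M] [ChartedSpace EM M] [IsManifold 𝓘(ℝ, EM) ∞ M]
  [TopologicalSpace B] [ChartedSpace EB B] [IsManifold 𝓘(ℝ, EB) ∞ B]
  [TopologicalSpace F] [ChartedSpace EF F] [IsManifold 𝓘(ℝ, EF) ∞ F]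
  {π : B → M} {S : RegularFoliation EM EB π}

open RegularFoliation.FoliatedCoords

/-- Near every parameter, a smooth family of pointed sections can be replaced by a smooth family of
distinguished pointed sections without changing those jets that are invariant. -/
theorem exists_distinguished_plot (hπ : IsSmoothFibreBundle EM EB EF F π)
    (S : RegularFoliation EM EB π) {n : ℕ} {v : Set (EuclideanSpace ℝ (Fin n))} (hv : IsOpen v)
    {ψ : EuclideanSpace ℝ (Fin n) → PointedSection EM EB π}
    (hψ : (sectionPlots EM EB π).isPlotOn hv ψ) {a₀ : EuclideanSpace ℝ (Fin n)} (ha₀ : a₀ ∈ v) :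
    ∃ (v' : Set (EuclideanSpace ℝ (Fin n))) (hv' : IsOpen v'), a₀ ∈ v' ∧ v' ⊆ v ∧
      ∃ ψ' : EuclideanSpace ℝ (Fin n) → {P : PointedSection EM EB π // P.sec.IsDistinguished S},
        (sectionPlots EM EB π).isPlotOn hv' (fun a => (ψ' a).1) ∧
        ∀ a ∈ v', ∀ k, (∃ P : PointedSection EM EB π, P.IsInvariant S k ∧
          toJet k P = toJet k (ψ a)) → toJet k (ψ' a).1 = toJet k (ψ a) := by
  have hsm := hπ.contMDiff
  obtain ⟨p, q, r, C, hC⟩ := S.exists_foliatedCoords hπ ((ψ a₀).sec.toFun (ψ a₀).pt)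
  obtain ⟨hpt, hψ2⟩ := hψ
  obtain ⟨V, O, hV, ha₀V, hVv, hO, hxO, hdom, hF⟩ := hψ2 a₀ ha₀ (ψ a₀).pt (ψ a₀).mem
  set x₀ := (ψ a₀).pt with hx₀
  have hsec₀ := (ψ a₀).sec.isSectionAt (ψ a₀).mem hC
  have hx₀b : x₀ ∈ C.base.source := hsec₀.mem_base
  set w₀ := C.base x₀ with hw₀
  have hw₀t : w₀ ∈ C.base.target := C.base.map_source hx₀b
  -- the coordinate expression of the family
  set g : EuclideanSpace ℝ (Fin n) × (EuclideanSpace ℝ (Fin p) × EuclideanSpace ℝ (Fin q)) →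
    EuclideanSpace ℝ (Fin r) := fun z => C.rep (ψ z.1).sec.toFun z.2 with hg
  have hgs : ∀ a ∈ V, ∀ w ∈ C.base.target, C.base.symm w ∈ O →
      (ψ a).sec.toFun (C.base.symm w) ∈ C.total.source → ContDiffAt ℝ ∞ g (a, w) := by
    intro a ha w hw hwO hwt
    have h1 : ContMDiffAt 𝓘(ℝ, EuclideanSpace ℝ (Fin n) ×
        (EuclideanSpace ℝ (Fin p) × EuclideanSpace ℝ (Fin q))) 𝓘(ℝ, EuclideanSpace ℝ (Fin n)) ∞
        (fun z : EuclideanSpace ℝ (Fin n) ×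
          (EuclideanSpace ℝ (Fin p) × EuclideanSpace ℝ (Fin q)) => z.1) (a, w) :=
      contDiff_fst.contMDiff.contMDiffAt
    have h2 : ContMDiffAt 𝓘(ℝ, EuclideanSpace ℝ (Fin n) ×
        (EuclideanSpace ℝ (Fin p) × EuclideanSpace ℝ (Fin q)))
        𝓘(ℝ, EuclideanSpace ℝ (Fin p) × EuclideanSpace ℝ (Fin q)) ∞
        (fun z : EuclideanSpace ℝ (Fin n) ×
          (EuclideanSpace ℝ (Fin p) × EuclideanSpace ℝ (Fin q)) => z.2) (a, w) :=
      contDiff_snd.contMDiff.contMDiffAt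
    have h3 := ContMDiffAt.comp (a, w) (C.isSmoothChart_base.contMDiffAt_symm hw) h2
    have h4 := hF.contMDiffAt (x := (a, C.base.symm w)) ((hV.prod hO).mem_nhds ⟨ha, hwO⟩)
    have h5 := ContMDiffAt.comp (a, w) (g := fun z : EuclideanSpace ℝ (Fin n) × M =>
      (ψ z.1).sec.toFun z.2) (f := fun z => (z.1, C.base.symm z.2)) h4 (h1.prodMk h3)
    have h6 := ContMDiffAt.comp (a, w) (g := C.total) (f := fun z : EuclideanSpace ℝ (Fin n) ×
      (EuclideanSpace ℝ (Fin p) × EuclideanSpace ℝ (Fin q)) =>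
        (ψ z.1).sec.toFun (C.base.symm z.2)) (C.isSmoothChart_total.contMDiffAt hwt) h5
    exact contDiff_snd.contDiffAt.comp _ (contDiff_snd.contDiffAt.comp _ h6.contDiffAt)
  -- the conditions under which the frozen sections are defined
  have hmix : Tendsto (fun z : EuclideanSpace ℝ (Fin n) × EuclideanSpace ℝ (Fin p) ×
      (EuclideanSpace ℝ (Fin p) × EuclideanSpace ℝ (Fin q)) => (z.2.1, z.2.2.2))
      (𝓝 (a₀, w₀.1, w₀)) (𝓝 w₀) := Continuous.tendsto' (by fun_prop) _ _ rfl
  have hmix' : Tendsto (fun z : EuclideanSpace ℝ (Fin n) × EuclideanSpace ℝ (Fin p) ×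
      (EuclideanSpace ℝ (Fin p) × EuclideanSpace ℝ (Fin q)) => (z.1, (z.2.1, z.2.2.2)))
      (𝓝 (a₀, w₀.1, w₀)) (𝓝 (a₀, w₀)) := Continuous.tendsto' (by fun_prop) _ _ rfl
  have hsymm := C.tendsto_base_symm hx₀b
  have hFc : Tendsto (fun z : EuclideanSpace ℝ (Fin n) ×
      (EuclideanSpace ℝ (Fin p) × EuclideanSpace ℝ (Fin q)) =>
      (ψ z.1).sec.toFun (C.base.symm z.2)) (𝓝 (a₀, w₀)) (𝓝 ((ψ a₀).sec.toFun x₀)) := by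
    have h1 : Tendsto (fun z : EuclideanSpace ℝ (Fin n) ×
      (EuclideanSpace ℝ (Fin p) × EuclideanSpace ℝ (Fin q)) => (z.1, C.base.symm z.2))
      (𝓝 (a₀, w₀)) (𝓝 (a₀, x₀)) :=
      (continuous_fst.tendsto (a₀, w₀)).prodMk_nhds (hsymm.comp (continuous_snd.tendsto (a₀, w₀)))
    exact ((hF.contMDiffAt (x := (a₀, x₀))
      ((hV.prod hO).mem_nhds ⟨ha₀V, hxO⟩)).continuousAt.tendsto).comp h1
  have hgc : ContinuousAt g (a₀, w₀) := (hgs a₀ ha₀V w₀ hw₀t (by rwa [C.base.left_inv hx₀b])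
    (by rw [C.base.left_inv hx₀b]; exact hC)).continuousAt
  -- The middle variable is the leafwise coordinate at which a section will be frozen. Treating it
  -- as independent of `a` and `w` yields a product neighbourhood `A × Ξ × W`, hence one domain `U`
  -- for all parameters.
  have hcond : ∀ᶠ z in 𝓝 (a₀, w₀.1, w₀), z.1 ∈ V ∧ (z.2.1, z.2.2.2) ∈ C.base.target ∧
      C.base.symm (z.2.1, z.2.2.2) ∈ O ∧
      (ψ z.1).sec.toFun (C.base.symm (z.2.1, z.2.2.2)) ∈ C.total.source ∧
      (z.2.2.1, z.2.2.2, g (z.1, (z.2.1, z.2.2.2))) ∈ C.total.target := by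
    have h1 : Tendsto (fun z : EuclideanSpace ℝ (Fin n) × EuclideanSpace ℝ (Fin p) ×
        (EuclideanSpace ℝ (Fin p) × EuclideanSpace ℝ (Fin q)) =>
        (z.2.2.1, z.2.2.2, g (z.1, (z.2.1, z.2.2.2))))
        (𝓝 (a₀, w₀.1, w₀)) (𝓝 (C.total ((ψ a₀).sec.toFun x₀))) := by
      rw [hsec₀.total_eq]
      have h2 : Tendsto (fun z : EuclideanSpace ℝ (Fin n) × EuclideanSpace ℝ (Fin p) ×
        (EuclideanSpace ℝ (Fin p) × EuclideanSpace ℝ (Fin q)) => z.2.2.1)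
        (𝓝 (a₀, w₀.1, w₀)) (𝓝 w₀.1) := Continuous.tendsto' (by fun_prop) _ _ rfl
      have h3 : Tendsto (fun z : EuclideanSpace ℝ (Fin n) × EuclideanSpace ℝ (Fin p) ×
        (EuclideanSpace ℝ (Fin p) × EuclideanSpace ℝ (Fin q)) => z.2.2.2)
        (𝓝 (a₀, w₀.1, w₀)) (𝓝 w₀.2) := Continuous.tendsto' (by fun_prop) _ _ rfl
      exact h2.prodMk_nhds (h3.prodMk_nhds (hgc.tendsto.comp hmix'))
    have h4 : Tendsto (fun z : EuclideanSpace ℝ (Fin n) × EuclideanSpace ℝ (Fin p) ×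
        (EuclideanSpace ℝ (Fin p) × EuclideanSpace ℝ (Fin q)) => z.1)
        (𝓝 (a₀, w₀.1, w₀)) (𝓝 a₀) := Continuous.tendsto' (by fun_prop) _ _ rfl
    filter_upwards [h4.eventually (hV.mem_nhds ha₀V),
      hmix.eventually (C.base.open_target.mem_nhds hw₀t),
      hmix.eventually (hsymm.eventually (hO.mem_nhds hxO)),
      hmix'.eventually (hFc.eventually (C.total.open_source.mem_nhds hC)),
      h1.eventually (C.total.open_target.mem_nhds (C.total.map_source hC))] with z e1 e2 e3 e4 e5
    exact ⟨e1, e2, e3, e4, e5⟩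
  obtain ⟨A, T, hA, haA, hT, hwT, hsub⟩ := mem_nhds_prod_iff'.1 hcond
  obtain ⟨Ξ, W, hΞ, hξΞ, hW, hwW, hsub'⟩ := mem_nhds_prod_iff'.1 (hT.mem_nhds hwT)
  have hco : ∀ a ∈ A, ∀ ξ ∈ Ξ, ∀ w ∈ W, a ∈ V ∧ (ξ, w.2) ∈ C.base.target ∧
      C.base.symm (ξ, w.2) ∈ O ∧ (ψ a).sec.toFun (C.base.symm (ξ, w.2)) ∈ C.total.source ∧
      (w.1, w.2, g (a, (ξ, w.2))) ∈ C.total.target := fun a ha ξ hξ w hw =>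
    hsub (mk_mem_prod ha (hsub' (mk_mem_prod hξ hw)))
  have hU : IsOpen (C.base.source ∩ C.base ⁻¹' W) := C.base.isOpen_inter_preimage hW
  set U := C.base.source ∩ C.base ⁻¹' W with hUdef
  set N := C.base.source ∩ C.base ⁻¹' (W ∩ Prod.fst ⁻¹' Ξ) with hNdef
  have hN : IsOpen N := C.base.isOpen_inter_preimage (hW.inter (hΞ.preimage continuous_fst))
  have hNU : N ⊆ U := fun x hx => ⟨hx.1, hx.2.1⟩
  have hv'o : IsOpen (v ∩ (fun a => (ψ a).pt) ⁻¹' N) :=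
    hpt.continuousOn.isOpen_inter_preimage hv hN
  set v' := A ∩ (v ∩ (fun a => (ψ a).pt) ⁻¹' N) with hv'def
  have hv' : IsOpen v' := hA.inter hv'o
  have ha₀v' : a₀ ∈ v' := ⟨haA, ha₀, hx₀b, hwW, hξΞ⟩
  -- The frozen section: over `(x, y)` its fibre coordinate is that of `ψ a` over `(x_a, y)`, with
  -- `x_a` the leafwise coordinate of the base point of `ψ a`. The construction does not involve
  -- `k`.
  set τ : EuclideanSpace ℝ (Fin n) → M → B := fun a z =>
    C.total.symm ((C.base z).1, (C.base z).2, g (a, ((C.base (ψ a).pt).1, (C.base z).2))) with hτ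
  have hbpt : ∀ a ∈ v', C.base (ψ a).pt ∈ W ∧ (C.base (ψ a).pt).1 ∈ Ξ := fun a ha => ha.2.2.2
  have hcz : ∀ a ∈ v', ∀ z ∈ U, a ∈ V ∧ ((C.base (ψ a).pt).1, (C.base z).2) ∈ C.base.target ∧
      C.base.symm ((C.base (ψ a).pt).1, (C.base z).2) ∈ O ∧
      (ψ a).sec.toFun (C.base.symm ((C.base (ψ a).pt).1, (C.base z).2)) ∈ C.total.source ∧
      ((C.base z).1, (C.base z).2, g (a, ((C.base (ψ a).pt).1, (C.base z).2))) ∈ C.total.target :=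
    fun a ha z hz => hco a ha.1 _ (hbpt a ha).2 _ hz.2
  have hτtotal : ∀ a ∈ v', ∀ z ∈ U, C.total (τ a z) =
      ((C.base z).1, (C.base z).2, g (a, ((C.base (ψ a).pt).1, (C.base z).2))) :=
    fun a ha z hz => C.total.right_inv (hcz a ha z hz).2.2.2.2
  have hτmem : ∀ a ∈ v', ∀ z ∈ U, τ a z ∈ C.total.source :=
    fun a ha z hz => C.total.map_target (hcz a ha z hz).2.2.2.2
  have hτproj : ∀ a ∈ v', ∀ z ∈ U, π (τ a z) = z := by
    intro a ha z hz
    refine C.base.injOn (C.proj_mem _ (hτmem a ha z hz)) hz.1 ?_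
    rw [C.base_proj _ (hτmem a ha z hz), hτtotal a ha z hz]
  have hτs : ContMDiffOn (𝓘(ℝ, EuclideanSpace ℝ (Fin n)).prod 𝓘(ℝ, EM)) 𝓘(ℝ, EB) ∞
      (fun z : EuclideanSpace ℝ (Fin n) × M => τ z.1 z.2) (v' ×ˢ U) := by
    rintro ⟨a, z⟩ ⟨ha, hz⟩
    obtain ⟨h1, h2, h3, h4, h5⟩ := hcz a ha z hz
    have b1 : ContMDiffAt (𝓘(ℝ, EuclideanSpace ℝ (Fin n)).prod 𝓘(ℝ, EM))
        𝓘(ℝ, EuclideanSpace ℝ (Fin p) × EuclideanSpace ℝ (Fin q)) ∞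
        (fun z : EuclideanSpace ℝ (Fin n) × M => C.base z.2) (a, z) :=
      ContMDiffAt.comp (a, z) (C.isSmoothChart_base.contMDiffAt hz.1) contMDiffAt_snd
    have b2 : ContMDiffAt (𝓘(ℝ, EuclideanSpace ℝ (Fin n)).prod 𝓘(ℝ, EM))
        𝓘(ℝ, EuclideanSpace ℝ (Fin p) × EuclideanSpace ℝ (Fin q)) ∞
        (fun z : EuclideanSpace ℝ (Fin n) × M => C.base (ψ z.1).pt) (a, z) := by
      have c1 : ContMDiffAt 𝓘(ℝ, EuclideanSpace ℝ (Fin n)) 𝓘(ℝ, EM) ∞ (fun a => (ψ a).pt) a :=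
        hpt.contMDiffAt (hv.mem_nhds ha.2.1)
      have c2 : ContMDiffAt 𝓘(ℝ, EuclideanSpace ℝ (Fin n))
        𝓘(ℝ, EuclideanSpace ℝ (Fin p) × EuclideanSpace ℝ (Fin q)) ∞ (fun a => C.base (ψ a).pt) a :=
        ContMDiffAt.comp a (C.isSmoothChart_base.contMDiffAt ha.2.2.1) c1
      exact ContMDiffAt.comp (a, z) (g := fun a => C.base (ψ a).pt)
        (f := fun z : EuclideanSpace ℝ (Fin n) × M => z.1) c2 contMDiffAt_fst
    have b3 : ContMDiffAt (𝓘(ℝ, EuclideanSpace ℝ (Fin n)).prod 𝓘(ℝ, EM))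
        𝓘(ℝ, EuclideanSpace ℝ (Fin p)) ∞
        (fun z : EuclideanSpace ℝ (Fin n) × M => (C.base (ψ z.1).pt).1) (a, z) :=
      ContMDiffAt.comp (a, z) (g := Prod.fst (α := EuclideanSpace ℝ (Fin p)))
        contDiff_fst.contMDiff.contMDiffAt b2
    have b4 : ContMDiffAt (𝓘(ℝ, EuclideanSpace ℝ (Fin n)).prod 𝓘(ℝ, EM))
        𝓘(ℝ, EuclideanSpace ℝ (Fin q)) ∞
        (fun z : EuclideanSpace ℝ (Fin n) × M => (C.base z.2).2) (a, z) :=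
      ContMDiffAt.comp (a, z) (g := Prod.snd (β := EuclideanSpace ℝ (Fin q)))
        contDiff_snd.contMDiff.contMDiffAt b1
    have b5 : ContMDiffAt (𝓘(ℝ, EuclideanSpace ℝ (Fin n)).prod 𝓘(ℝ, EM))
        𝓘(ℝ, EuclideanSpace ℝ (Fin p)) ∞
        (fun z : EuclideanSpace ℝ (Fin n) × M => (C.base z.2).1) (a, z) :=
      ContMDiffAt.comp (a, z) (g := Prod.fst (α := EuclideanSpace ℝ (Fin p)))
        contDiff_fst.contMDiff.contMDiffAt b1
    have b6 : ContMDiffAt (𝓘(ℝ, EuclideanSpace ℝ (Fin n)).prod 𝓘(ℝ, EM))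
        𝓘(ℝ, EuclideanSpace ℝ (Fin r)) ∞ (fun z : EuclideanSpace ℝ (Fin n) × M =>
          g (z.1, ((C.base (ψ z.1).pt).1, (C.base z.2).2))) (a, z) :=
      ContMDiffAt.comp (a, z) (g := g) (hgs a h1 _ h2 h3 h4).contMDiffAt
        (contMDiffAt_fst.prodMk_space (b3.prodMk_space b4))
    exact (ContMDiffAt.comp (a, z) (C.isSmoothChart_total.contMDiffAt_symm h5)
      (b5.prodMk_space (b4.prodMk_space b6))).contMDiffWithinAt
  have hex : ∀ a, ∃ P : PointedSection EM EB π, P.sec.IsDistinguished S ∧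
      (a ∈ v' → P.pt = (ψ a).pt ∧ P.sec.dom = U ∧ P.sec.toFun = τ a) := by
    have h1 : ∀ a ∈ v', ∃ P : PointedSection EM EB π, P.sec.IsDistinguished S ∧
        (P.pt = (ψ a).pt ∧ P.sec.dom = U ∧ P.sec.toFun = τ a) := by
      intro a ha
      refine ⟨⟨(ψ a).pt, ⟨U, τ a, hU, ?_, hτproj a ha⟩, hNU ha.2.2⟩, ?_, rfl, rfl, rfl⟩
      · exact ContMDiffOn.comp (t := v' ×ˢ U) (f := fun z => (a, z)) hτs
          (contMDiff_const.prodMk contMDiff_id).contMDiffOn fun z hz => ⟨ha, hz⟩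
      · intro x hx
        -- `IsDistinguished` asks for coordinates over a subset of the domain of the section, hence
        -- the restriction to `U`.
        refine ⟨p, q, r, C.restr hsm.continuous hU, ⟨hx.1, hx⟩, fun z hz => hz.2,
          fun y => g (a, ((C.base (ψ a).pt).1, y)), fun z hz => ⟨⟨hτmem a ha z hz.2, ?_⟩, ?_⟩⟩
        · change π (τ a z) ∈ U
          rw [hτproj a ha z hz.2]; exact hz.2
        · exact congrArg (fun z => z.2.2) (hτtotal a ha z hz.2)
    intro a
    by_cases ha : a ∈ v'
    · obtain ⟨P, hP, h⟩ := h1 a ha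
      exact ⟨P, hP, fun _ => h⟩
    -- Parametrisations are total functions; outside `v'` the section belonging to `a₀` serves as a
    -- default value.
    · obtain ⟨P, hP, -⟩ := h1 a₀ ha₀v'
      exact ⟨P, hP, fun h => absurd h ha⟩
  choose Q hQ hQv using hex
  refine ⟨v', hv', ha₀v', fun a ha => ha.2.1, fun a => ⟨Q a, hQ a⟩, ⟨?_, ?_⟩, ?_⟩
  · exact (hpt.mono fun a ha => ha.2.1).congr fun a ha => (hQv a ha).1
  · intro a₁ ha₁ x₁ hx₁
    rw [(hQv a₁ ha₁).2.1] at hx₁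
    exact ⟨v', U, hv', ha₁, Subset.rfl, hU, hx₁, fun a ha => (hQv a ha).2.1.ge,
      hτs.congr fun z hz => by rw [(hQv z.1 hz.1).2.2]⟩
  · rintro a ha k ⟨P, hP, hPψ⟩
    obtain ⟨h1, h2, h3⟩ := hQv a ha
    have hPs : SameJet k P (ψ a) := Quotient.exact hPψ
    have hUa : (ψ a).pt ∈ U := hNU ha.2.2
    have hmem : (ψ a).sec.toFun (ψ a).pt ∈ C.total.source := by
      have h4 := (hcz a ha _ hUa).2.2.2.1
      rwa [show ((C.base (ψ a).pt).1, (C.base (ψ a).pt).2) = C.base (ψ a).pt from rfl,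
        C.base.left_inv hUa.1] at h4
    have hsψ := (ψ a).sec.isSectionAt (ψ a).mem hmem
    have hptP : P.pt = (ψ a).pt := by cases k <;> exact hPs.1
    have hvalP : P.sec.toFun P.pt = (ψ a).sec.toFun P.pt := by
      cases k with
      | jet k => exact hPs.2.1
      | germ => exact hPs.2.self_of_nhds
    have hsP : C.IsSectionAt P.sec.toFun P.pt :=
      P.sec.isSectionAt P.mem (by rw [hvalP, hptP]; exact hmem)
    have hsQ : C.IsSectionAt (Q a).sec.toFun (Q a).pt :=
      (Q a).sec.isSectionAt (Q a).mem (by rw [h1, h3]; exact hτmem a ha _ hUa)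
    -- Only some representative `P` of the class of `ψ a` is given as invariant. Its leafwise
    -- flatness is carried over to `ψ a` by contact.
    have hflat := (hP.leafFlat hsm hsP).congr (hsP.contact_rep hPs hsψ) hsP.contDiffAt_rep
      (by rw [hptP]; exact hsψ.contDiffAt_rep)
    rw [hptP] at hflat
    have hfr := hflat.contact_freeze hsψ.contDiffAt_rep
    have hrepQ : C.rep (Q a).sec.toFun =ᶠ[𝓝 (C.base (ψ a).pt)]
        fun w => C.rep (ψ a).sec.toFun ((C.base (ψ a).pt).1, w.2) := by
      filter_upwards [C.base.open_target.mem_nhds (C.base.map_source hUa.1), hW.mem_nhds hUa.2]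
        with w hw1 hw2
      rw [h3, rep, hτtotal a ha _ ⟨C.base.map_target hw1, by rwa [mem_preimage, C.base.right_inv hw1]⟩,
        C.base.right_inv hw1]
    have hQψ : SameJet k (ψ a) (Q a) := by
      refine IsSectionAt.sameJet_of_contact h1.symm hsψ hsQ ?_
      cases k with
      | jet k => exact JetEq.congr hfr (.refl _ _) hrepQ
      | germ => exact Filter.EventuallyEq.trans hfr hrepQ.symm
    exact Quotient.sound ((jetSetoid EM EB π k).iseqv.symm hQψ)

end Families
end FolBundle

end

/-! ### Equality of the two spaces and of their diffeologies. -/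

theorem proposition4p9
    {EM EB EF M B F : Type*}
    [NormedAddCommGroup EM] [NormedSpace ℝ EM] [FiniteDimensional ℝ EM]
    [NormedAddCommGroup EB] [NormedSpace ℝ EB] [FiniteDimensional ℝ EB]
    [NormedAddCommGroup EF] [NormedSpace ℝ EF] [FiniteDimensional ℝ EF]
    [TopologicalSpace M] [T2Space M] [ChartedSpace EM M] [IsManifold 𝓘(ℝ, EM) ∞ M]
    [TopologicalSpace B] [T2Space B] [ChartedSpace EB B] [IsManifold 𝓘(ℝ, EB) ∞ B]
    [TopologicalSpace F] [T2Space F] [ChartedSpace EF F] [IsManifold 𝓘(ℝ, EF) ∞ F]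
    (π : B → M) (hπ : FolBundle.IsSmoothFibreBundle EM EB EF F π)
    (S : FolBundle.RegularFoliation EM EB π) (k : FolBundle.JetOrder) :
    FolBundle.invariantJets S k = FolBundle.distinguishedJets S k ∧
      FolBundle.distinguishedDiffeology S k =
        FolBundle.subspaceDiffeology (FolBundle.distinguishedJets S k) := by
  have hπd : MDifferentiable 𝓘(ℝ, EB) 𝓘(ℝ, EM) π := hπ.contMDiff.mdifferentiable (by simp)
  refine ⟨Subset.antisymm ?_ ?_, ?_⟩
  · rintro _ ⟨P, rfl, hP⟩
    -- A single pointed section is a constant plot over `ℝ⁰`, so this inclusion is a case of the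
    -- parametrised statement.
    obtain ⟨v', -, h0, -, ψ', -, h⟩ := FolBundle.exists_distinguished_plot hπ S (n := 0)
      isOpen_univ (ψ := fun _ => P) ((FolBundle.sectionPlots EM EB π).isPlotOn_univ.2
        ((FolBundle.sectionPlots EM EB π).isPlot_const P)) (mem_univ 0)
    exact ⟨(ψ' 0).1, (ψ' 0).2, h 0 h0 k ⟨P, hP, rfl⟩⟩
  · rintro _ ⟨P, hP, rfl⟩
    exact ⟨P, rfl, FolBundle.PointedSection.isInvariant_of_isDistinguished hP hπd k⟩
  · refine DiffeologicalSpace.ext ?_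
    funext n p
    refine propext ⟨fun H a ha => ?_, fun H a ha => ?_⟩
    · obtain ⟨v, hv, hav, hvu, ψ, hψ, e⟩ := H a ha
      exact ⟨v, hv, hav, hvu, fun w => (ψ w).1, hψ, fun w hw => congrArg Subtype.val (e w hw)⟩
    · obtain ⟨v, hv, hav, -, ψ, hψ, e⟩ := H a ha
      -- The lift `ψ` may consist of arbitrary sections. It is exchanged for a lift by distinguished
      -- ones with the same classes, since the classes `p w` are distinguished and therefore
      -- invariant.
      obtain ⟨v', hv', hav', hv'v, ψ', hψ', e'⟩ :=
        FolBundle.exists_distinguished_plot hπ S hv hψ hav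
      refine ⟨v', hv', hav', subset_univ _, ψ', hψ', fun w hw => Subtype.ext ?_⟩
      have ew : FolBundle.toJet k (ψ w) = (p w).1 := e w (hv'v hw)
      obtain ⟨P, hP, hPw⟩ := (p w).2
      exact (e' w hw k ⟨P, FolBundle.PointedSection.isInvariant_of_isDistinguished hP hπd k,
        hPw.trans ew.symm⟩).trans ew
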